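/- Let $K$ be a field of characteristic $p>0$, $n\ge 0$, $P_n=K[x_1,\dots,x_n]$, and let $\mathcal D=\mathcal D(P_n)\subseteq \mathrm{End}_K(P_n)$ be the ring of $K$-linear differential operators on $P_n$. For $\beta\in\mathbb N^n$ let $\partial^{[\beta]}=\partial_1^{[\beta_1]}\cdots\partial_n^{[\beta_n]}\in\mathcal D$ be the divided power operator $x^\alpha\mapsto\prod_i\binom{\alpha_i}{\beta_i}x^{\alpha-\beta}$. Let $F_i=\sum_{|\alpha|+|\beta|\le i}Kx^\alpha\partial^{[\beta]}$ be the canonical filtration of $\mathcal D$. A filtration of standard type on a finitely generated $\mathcal D$-module $M$ is $\{F'_iM_0\}_{i\ge0}$, where $M_0$ is a finite dimensional generating subspace of $M$ and $\{F_i'\}$ is a finite dimensional filtration of $\mathcal D$ equivalent to $\{F_i\}$, i.e. $F_i\subseteq F'_{ai+b}$ and $F'_i\subseteq F_{ci+d}$ for $i\gg0$, for some natural numbers $a,c>0$ and $b,d$. A nonzero finitely generated $M$ is holonomic if for some filtration of standard type $\{M_i\}$ the function $\dim_K M_i$ is bounded, for $i\gg0$, by a polynomial in $i$ of degree $n$.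 A function $f:\mathbb N\to\mathbb N$ is an almost polynomial with period $k\geq 1$, degree $d$ and leading coefficient $a$ if there are polynomials $q_s\in\mathbb Q[t]$, $s\in\mathbb Z/k\mathbb Z$, all of degree $d$ with leading coefficient $a$, such that $f(i)=q_{i\bmod k}(i)$ for $i\gg0$. A finitely generated $M$ has dimension $d$ and multiplicity $e(M)$ if, for each finite dimensional generating subspace $M_0$, the function $i\mapsto\dim_K(F_iM_0)$ is an almost polynomial of degree $d$ with leading coefficient $e(M)/d!$. Let $\mathfrak m$ be a maximal ideal of $P_n$. For each $i$ let $g_i\in K[x_i]$ be the monic irreducible generator of $K[x_i]\cap\mathfrak m$ and write $g_i=f_i(x_i^{p^{k_i}})$ with $f_i$ irreducible separable; put $k=k_1+\cdots+k_n$. Let $A(\mathfrak m)$ be the subalgebra of $\mathcal D$ generated by all $x_i$ and all $\partial_i^{[j]}$ with $j<p^{k_i}$, and let $\mathfrak z=\mathfrak m\cap K[x_1^{p^{k_1}},\dots,x_n^{p^{k_n}}]$. Let $V(\mathfrak m)$ be the quotient of $A(\mathfrak m)$ by the left ideal generated by $\mathfrak z$ and all $\partial_i^{[j]}$, $0<j<p^{k_i}$;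 it is a simple $A(\mathfrak m)$-module annihilated by $\mathfrak z$, and every simple $A(\mathfrak m)$-module annihilated by $\mathfrak z$ is isomorphic to it. Put $U(\mathfrak m)=\mathcal D\otimes_{A(\mathfrak m)}V(\mathfrak m)$. Let $(P_n/\mathfrak m)^{sep}$ be the maximal separable subextension of $P_n/\mathfrak m$ over $K$. Then: 1. The map $\mathfrak m\mapsto[U(\mathfrak m)]$ is a bijection from $\mathrm{Max}(P_n)$ onto the set of isoclasses of simple finitely presented $\mathcal D$-modules; its inverse is $[M]\mapsto\mathrm{ass}_{P_n}(M)$, the set of associated primes of the $P_n$-module $M$. In particular, $\mathrm{ass}_{P_n}(U(\mathfrak m))=\{\mathfrak m\}$. 2. Every simple finitely presented $\mathcal D$-module is holonomic. 3. (An analogue of Quillen's Lemma) $\mathrm{End}_{\mathcal D}(U(\mathfrak m))\simeq(P_n/\mathfrak m)^{sep}$ as $K$-algebras. 4. $U(\mathfrak m)_i:=F_i(1\otimes V(\mathfrak m))$ is a filtration of standard type on $U(\mathfrak m)$. Moreover $$U(\mathfrak m)=\bigoplus_{(i_1,\dots,i_n)\in\mathbb N^n}\partial_1^{[i_1p^{k_1}]}\cdots\partial_n^{[i_np^{k_n}]}\otimes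 V(\mathfrak m),\qquad U(\mathfrak m)_i=\bigoplus_{i_1p^{k_1}+\cdots+i_np^{k_n}\le i}\partial_1^{[i_1p^{k_1}]}\cdots\partial_n^{[i_np^{k_n}]}\otimes V(\mathfrak m),$$ where in each summand the map $v\mapsto\partial_1^{[i_1p^{k_1}]}\cdots\partial_n^{[i_np^{k_n}]}\otimes v$ is injective on $V(\mathfrak m)$, and (a) the Poincaré series is $\sum_{i\ge0}\dim_K(U(\mathfrak m)_i)\,\omega^i=\dfrac{p^k[(P_n/\mathfrak m)^{sep}:K]}{(1-\omega)\prod_{i=1}^n(1-\omega^{p^{k_i}})}$; (b) $U(\mathfrak m)$ has dimension $n$ and multiplicity $e(U(\mathfrak m))=[(P_n/\mathfrak m)^{sep}:K]=\dim_K\mathrm{End}_{\mathcal D}(U(\mathfrak m))$, a natural number; (c) $i\mapsto\dim_K(U(\mathfrak m)_i)$ is an almost polynomial with period $p^{\max\{k_1,\dots,k_n\}}$ (period $1$ if $n=0$), degree $n$ and leading coefficient $[(P_n/\mathfrak m)^{sep}:K]/n!$. -/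

import Mathlib

open scoped TensorProduct

universe u v

noncomputable section

namespace DModCharP

/-! ### Rings of differential operators -/

section DiffOps

variable (K : Type u) [Field K] (R : Type v) [CommRing R] [Algebra K R]

/-- The commutator `f x - x f` of a `K`-linear endomorphism `f` of `R` with multiplication
by `x`, as a linear map in `f`. -/
def comm (x : R) : Module.End K (Module.End K R) :=
  LinearMap.mulRight K (Algebra.lmul K R x) - LinearMap.mulLeft K (Algebra.lmul K R x)

/-- The order filtration: `D(R)_0 = End_R(R)`, and `D(R)_i` consists of the `f` such that all
commutators `f x - x f` with `x` in `R` lie in `D(R)_{i-1}`. -/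
def diffOpsLE : ℕ → Submodule K (Module.End K R)
  | 0 => ⨅ x : R, LinearMap.ker (comm K R x)
  | i + 1 => ⨅ x : R, (diffOpsLE i).comap (comm K R x)

variable {K R}

theorem comm_apply (x : R) (f : Module.End K R) :
    comm K R x f = f * Algebra.lmul K R x - Algebra.lmul K R x * f := rfl

theorem mem_zero {f : Module.End K R} : f ∈ diffOpsLE K R 0 ↔ ∀ x, comm K R x f = 0 := by
  simp [diffOpsLE]

theorem mem_succ {i : ℕ} {f : Module.End K R} :
    f ∈ diffOpsLE K R (i + 1) ↔ ∀ x, comm K R x f ∈ diffOpsLE K R i := by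
  simp [diffOpsLE]

theorem comm_mul (x : R) (f g : Module.End K R) :
    comm K R x (f * g) = f * comm K R x g + comm K R x f * g := by
  simp only [comm_apply, mul_sub, sub_mul, mul_assoc]; abel

theorem le_succ (i : ℕ) : diffOpsLE K R i ≤ diffOpsLE K R (i + 1) := by
  induction i with
  | zero =>
    intro f hf
    rw [mem_succ]; intro x
    rw [mem_zero.1 hf x]; exact zero_mem _
  | succ i ih =>
    intro f hf
    rw [mem_succ] at hf ⊢
    exact fun x => ih (hf x)

theorem diffOps_mono : Monotone (diffOpsLE K R) := monotone_nat_of_le_succ le_succ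

theorem lmul_mem (a : R) : Algebra.lmul K R a ∈ diffOpsLE K R 0 := by
  rw [mem_zero]; intro x
  rw [comm_apply, ← map_mul, ← map_mul, mul_comm, sub_self]

theorem mul_mem_diffOps (i j : ℕ) : ∀ f g : Module.End K R,
    f ∈ diffOpsLE K R i → g ∈ diffOpsLE K R j → f * g ∈ diffOpsLE K R (i + j) := by
  induction i generalizing j with
  | zero =>
    induction j with
    | zero =>
      intro f g hf hg
      rw [mem_zero] at *
      intro x
      rw [comm_mul, hf, hg]; simp
    | succ j ihj =>
      intro f g hf hg
      rw [← add_assoc, mem_succ]; intro x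
      rw [comm_mul, mem_zero.1 hf, zero_mul, add_zero]
      exact ihj _ _ hf (mem_succ.1 hg x)
  | succ i ihi =>
    induction j with
    | zero =>
      intro f g hf hg
      rw [add_zero, mem_succ]; intro x
      rw [comm_mul, mem_zero.1 hg, mul_zero, zero_add]
      exact ihi 0 _ _ (mem_succ.1 hf x) hg
    | succ j ihj =>
      intro f g hf hg
      rw [← add_assoc, mem_succ]; intro x
      rw [comm_mul]
      refine add_mem (ihj _ _ hf (mem_succ.1 hg x)) ?_
      have := ihi (j + 1) _ _ (mem_succ.1 hf x) hg
      rwa [show i + 1 + j = i + (j + 1) by omega]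

variable (K R)

/-- The ring `D(R)` of `K`-linear differential operators on `R`, a subalgebra of `End_K(R)`. -/
def diffOps : Subalgebra K (Module.End K R) where
  carrier := {f | ∃ i, f ∈ diffOpsLE K R i}
  mul_mem' := by
    rintro f g ⟨i, hi⟩ ⟨j, hj⟩
    exact ⟨i + j, mul_mem_diffOps i j f g hi hj⟩
  add_mem' := by
    rintro f g ⟨i, hi⟩ ⟨j, hj⟩
    exact ⟨max i j, add_mem (diffOps_mono (le_max_left i j) hi)
      (diffOps_mono (le_max_right i j) hj)⟩
  algebraMap_mem' := by
    intro c
    refine ⟨0, ?_⟩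
    rw [← (Algebra.lmul K R).commutes c]
    exact lmul_mem _

end DiffOps

/-! ### Filtrations, growth, almost polynomials -/

/-- `f : ℕ → ℕ` is an almost polynomial with period `k`, degree `d` and leading coefficient `a`:
for `i ≫ 0`, `f i` is the value at `i` of a polynomial over `ℚ` that depends only on `i` mod `k`,
and all these polynomials have degree `d` and leading coefficient `a`. -/
def IsAlmostPolynomial (f : ℕ → ℕ) (k d : ℕ) (a : ℚ) : Prop :=
  0 < k ∧ ∃ q : ZMod k → Polynomial ℚ,
    (∀ s, (q s).degree = (d : WithBot ℕ) ∧ (q s).leadingCoeff = a) ∧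
    ∀ᶠ i in Filter.atTop, (f i : ℚ) = (q (i : ZMod k)).eval (i : ℚ)

section Filtrations

variable {K : Type u} [Field K] {D : Type v} [Ring D] [Algebra K D]

/-- A finite dimensional filtration `K ⊆ G₀ ⊆ G₁ ⊆ ⋯` of the algebra `D`. -/
structure IsFinFiltration (G : ℕ → Submodule K D) : Prop where
  mono : Monotone G
  exhaust : ∀ a, ∃ i, a ∈ G i
  one_mem : (1 : D) ∈ G 0
  mul_mem : ∀ i j, ∀ a ∈ G i, ∀ b ∈ G j, a * b ∈ G (i + j)
  finite : ∀ i, FiniteDimensional K (G i)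

/-- Equivalence of filtrations. -/
def FiltrationEquiv (G H : ℕ → Submodule K D) : Prop :=
  ∃ a b c d : ℕ, 0 < a ∧ 0 < c ∧
    ∀ᶠ i in Filter.atTop, G i ≤ H (a * i + b) ∧ H i ≤ G (c * i + d)

/-- The subspaces `G_i M₀` of a `D`-module `M`. -/
def filMul {M : Type*} [AddCommGroup M] [Module K M] [Module D M]
    (G : ℕ → Submodule K D) (M₀ : Submodule K M) (i : ℕ) : Submodule K M :=
  Submodule.span K {x | ∃ g ∈ G i, ∃ m ∈ M₀, x = g • m}

end Filtrations

/-! ### Induced modules over noncommutative rings -/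

section Induced

variable {K : Type u} [Field K] {D : Type*} [Ring D] [Algebra K D] (A : Subalgebra K D)
  (V : Type*) [AddCommGroup V] [Module K V] [Module A V]

/-- The `D`-submodule of `D ⊗[K] V` generated by all `da ⊗ v - d ⊗ av` with `a` in `A`. -/
def balancing : Submodule D (D ⊗[K] V) :=
  Submodule.span D {t | ∃ (d : D) (a : A) (v : V), t = (d * (a : D)) ⊗ₜ[K] v - d ⊗ₜ[K] (a • v)}

/-- The induced module `D ⊗_A V`, a left `D`-module, for a subalgebra `A` of a (noncommutative)
`K`-algebra `D` and a left `A`-module `V`. -/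
abbrev Induced : Type _ := (D ⊗[K] V) ⧸ balancing A V

/-- The bilinear map `(d, v) ↦ d ⊗ v` into `D ⊗_A V`. -/
def Induced.tmul : D →ₗ[K] V →ₗ[K] Induced A V :=
  (TensorProduct.mk K D V).compr₂ ((balancing A V).mkQ.restrictScalars K)

end Induced

/-! ### Isomorphism classes of simple finitely presented modules -/

section IsoClasses

/-- A simple finitely presented (left) `D`-module. -/
structure SimpleFP (D : Type u) [Ring D] where
  carrier : Type u
  [addCommGroup : AddCommGroup carrier]
  [module : Module D carrier]
  isSimple : IsSimpleModule D carrier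
  isFinitelyPresented : Module.FinitePresentation D carrier

attribute [instance] SimpleFP.addCommGroup SimpleFP.module

/-- Isomorphism of modules. -/
instance SimpleFP.setoid (D : Type u) [Ring D] : Setoid (SimpleFP D) where
  r M N := Nonempty (M.carrier ≃ₗ[D] N.carrier)
  iseqv := ⟨fun _ => ⟨LinearEquiv.refl _ _⟩, fun ⟨e⟩ => ⟨e.symm⟩, fun ⟨e⟩ ⟨f⟩ => ⟨e.trans f⟩⟩

/-- The set of isoclasses of simple finitely presented `D`-modules. -/
def SimpleFPClass (D : Type u) [Ring D] : Type (u + 1) := Quotient (SimpleFP.setoid D)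

/-- The isoclass of a simple finitely presented module. -/
def isoClass (D : Type u) [Ring D] (M : Type u) [AddCommGroup M] [Module D M]
    (h : IsSimpleModule D M ∧ Module.FinitePresentation D M) : SimpleFPClass D :=
  Quotient.mk _ ⟨M, h.1, h.2⟩

end IsoClasses

/-! ### The algebra `D(P_n)` -/

section Pn

variable (K : Type u) [Field K] (n : ℕ)

/-- The polynomial algebra `P_n = K[x_1, …, x_n]`. -/
abbrev Pn : Type u := MvPolynomial (Fin n) K

/-- The ring `D(P_n)` of differential operators. -/
def DPn : Type u := diffOps K (Pn K n)

instance : Ring (DPn K n) := inferInstanceAs (Ring (diffOps K (Pn K n)))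

instance : Algebra K (DPn K n) := inferInstanceAs (Algebra K (diffOps K (Pn K n)))

variable {n}

/-- The divided power operator `∂^[β]` on `P_n`: it sends `x^α` to `∏ᵢ (αᵢ choose βᵢ) x^(α-β)`
(which is zero unless `β ≤ α`). -/
def hasse (β : Fin n →₀ ℕ) : Module.End K (Pn K n) :=
  (MvPolynomial.basisMonomials (Fin n) K).constr K fun α =>
    MvPolynomial.monomial (α - β) (∏ i, ((α i).choose (β i) : K))

theorem hasse_monomial (β α : Fin n →₀ ℕ) (c : K) :
    hasse K β (MvPolynomial.monomial α c)
      = MvPolynomial.monomial (α - β) (c * ∏ i, ((α i).choose (β i) : K)) := by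
  have h : (MvPolynomial.monomial α c : Pn K n)
      = c • MvPolynomial.basisMonomials (Fin n) K α := by
    simp [MvPolynomial.smul_monomial]
  rw [h, map_smul, hasse, Module.Basis.constr_basis, MvPolynomial.smul_monomial, smul_eq_mul]

theorem comm_X_hasse_zero (β : Fin n →₀ ℕ) (i : Fin n) (h : β i = 0) :
    comm K (Pn K n) (MvPolynomial.X i) (hasse K β) = 0 := by
  refine (MvPolynomial.basisMonomials (Fin n) K).ext fun α => ?_
  rw [comm_apply]
  simp only [MvPolynomial.coe_basisMonomials, LinearMap.sub_apply, Module.End.mul_apply,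
    LinearMap.zero_apply, Algebra.coe_lmul_eq_mul, LinearMap.mul_apply', MvPolynomial.X,
    MvPolynomial.monomial_mul, hasse_monomial, one_mul]
  rw [sub_eq_zero]
  have h1 : Finsupp.single i 1 + α - β = Finsupp.single i 1 + (α - β) := by
    ext j
    by_cases hj : j = i
    · subst hj; simp [h]
    · simp [Ne.symm hj]
  have h2 : ∀ j, (((Finsupp.single i 1 + α : Fin n →₀ ℕ) j).choose (β j) : K) = ((α j).choose (β j) : K) := by
    intro j
    by_cases hj : j = i
    · subst hj; simp [h]
    · simp [Ne.symm hj]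
  simp only [h1, h2]

theorem comm_X_hasse (β : Fin n →₀ ℕ) (i : Fin n) :
    comm K (Pn K n) (MvPolynomial.X i) (hasse K (β + Finsupp.single i 1)) = hasse K β := by
  refine (MvPolynomial.basisMonomials (Fin n) K).ext fun α => ?_
  rw [comm_apply]
  simp only [MvPolynomial.coe_basisMonomials, LinearMap.sub_apply, Module.End.mul_apply,
    Algebra.coe_lmul_eq_mul, LinearMap.mul_apply', MvPolynomial.X,
    MvPolynomial.monomial_mul, hasse_monomial, one_mul]
  have h1 : Finsupp.single i 1 + α - (β + Finsupp.single i 1) = α - β := by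
    ext j; simp; omega
  rw [h1, sub_eq_iff_eq_add]
  have key : ∀ γ : Fin n →₀ ℕ, ∏ j, ((γ j).choose ((β + Finsupp.single i 1 : Fin n →₀ ℕ) j) : K)
      = ((γ i).choose (β i + 1) : K) * ∏ j ∈ Finset.univ.erase i, ((γ j).choose (β j) : K) := by
    intro γ
    rw [← Finset.mul_prod_erase _ _ (Finset.mem_univ i)]
    congr 1
    · simp
    · refine Finset.prod_congr rfl fun j hj => ?_
      simp [Ne.symm (Finset.ne_of_mem_erase hj)]
  have e1 : ∏ j ∈ Finset.univ.erase i, (((Finsupp.single i 1 + α : Fin n →₀ ℕ) j).choose (β j) : K)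
      = ∏ j ∈ Finset.univ.erase i, ((α j).choose (β j) : K) := by
    refine Finset.prod_congr rfl fun j hj => ?_
    simp [Ne.symm (Finset.ne_of_mem_erase hj)]
  rw [key, key, e1, ← Finset.mul_prod_erase _ _ (Finset.mem_univ i)]
  set Q := ∏ j ∈ Finset.univ.erase i, ((α j).choose (β j) : K)
  have e2 : (((Finsupp.single i 1 + α : Fin n →₀ ℕ) i).choose (β i + 1) : K)
      = ((α i).choose (β i) : K) + ((α i).choose (β i + 1) : K) := by
    have : (Finsupp.single i 1 + α : Fin n →₀ ℕ) i = α i + 1 := by simp [add_comm]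
    rw [this, Nat.choose_succ_succ]; push_cast; rfl
  rw [e2, add_mul, map_add]
  congr 1
  by_cases hc : β i + 1 ≤ α i
  · have h3 : α - β = Finsupp.single i 1 + (α - (β + Finsupp.single i 1)) := by
      ext j
      by_cases hj : j = i
      · subst hj; simp; omega
      · simp [Ne.symm hj]
    rw [← h3]
  · rw [Nat.choose_eq_zero_of_lt (by omega)]; simp

theorem comm_mem_of_comm_X {S : Submodule K (Module.End K (Pn K n))}
    (hl : ∀ a, ∀ f ∈ S, Algebra.lmul K (Pn K n) a * f ∈ S)
    (hr : ∀ a, ∀ f ∈ S, f * Algebra.lmul K (Pn K n) a ∈ S)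
    {f : Module.End K (Pn K n)} (hf : ∀ i, comm K (Pn K n) (MvPolynomial.X i) f ∈ S)
    (h : Pn K n) : comm K (Pn K n) h f ∈ S := by
  induction h using MvPolynomial.induction_on with
  | C c =>
    have : comm K (Pn K n) (MvPolynomial.C c) f = 0 := by
      rw [comm_apply, ← MvPolynomial.algebraMap_eq, AlgHom.commutes, Algebra.commutes, sub_self]
    rw [this]; exact zero_mem _
  | add a b ha hb =>
    have : comm K (Pn K n) (a + b) f = comm K (Pn K n) a f + comm K (Pn K n) b f := by
      simp only [comm_apply, map_add, mul_add, add_mul]; abel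
    rw [this]; exact add_mem ha hb
  | mul_X a i ha =>
    have : comm K (Pn K n) (a * MvPolynomial.X i) f
        = comm K (Pn K n) a f * Algebra.lmul K (Pn K n) (MvPolynomial.X i)
          + Algebra.lmul K (Pn K n) a * comm K (Pn K n) (MvPolynomial.X i) f := by
      simp only [comm_apply, map_mul, mul_sub, sub_mul, mul_assoc]; abel
    rw [this]; exact add_mem (hr _ _ ha) (hl _ _ (hf i))

theorem hasse_mem_diffOps (N : ℕ) : ∀ β : Fin n →₀ ℕ, ∑ i, β i ≤ N →
    hasse K β ∈ diffOpsLE K (Pn K n) N := by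
  induction N with
  | zero =>
    intro β hβ
    rw [mem_zero]; intro h
    have h0 : ∀ i, β i = 0 := by simpa using hβ
    have := comm_mem_of_comm_X K (S := ⊥) (f := hasse K β) (by simp) (by simp)
      (fun i => by rw [comm_X_hasse_zero K β i (h0 i)]; exact zero_mem _) h
    simpa using this
  | succ N ih =>
    intro β hβ
    rw [mem_succ]
    refine comm_mem_of_comm_X K ?_ ?_ ?_
    · intro a f hf
      simpa using mul_mem_diffOps 0 N _ _ (lmul_mem a) hf
    · intro a f hf
      simpa using mul_mem_diffOps N 0 _ _ hf (lmul_mem a)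
    · intro i
      by_cases h0 : β i = 0
      · rw [comm_X_hasse_zero K β i h0]; exact zero_mem _
      · have hb : β - Finsupp.single i 1 + Finsupp.single i 1 = β := by
          ext j
          by_cases hj : j = i
          · subst hj; simp; omega
          · simp [Ne.symm hj]
        have hs : ∑ j, (β - Finsupp.single i 1 : Fin n →₀ ℕ) j + 1 = ∑ j, β j := by
          conv_rhs => rw [← hb]
          simp [Finset.sum_add_distrib, Finsupp.single_apply]
        rw [← hb, comm_X_hasse]
        exact ih _ (by omega)

/-- The element `∂^[β] = ∂₁^[β₁] ⋯ ∂ₙ^[βₙ]` of `D(P_n)`. -/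
def dop (β : Fin n →₀ ℕ) : DPn K n :=
  (⟨hasse K β, _, hasse_mem_diffOps K _ β le_rfl⟩ : diffOps K (Pn K n))

/-- The inclusion of `P_n` in `D(P_n)`: a polynomial acts by multiplication. -/
def ofPoly (h : Pn K n) : DPn K n :=
  (⟨Algebra.lmul K (Pn K n) h, 0, lmul_mem h⟩ : diffOps K (Pn K n))

variable (n)

/-- The canonical filtration `F_i = ⊕_{|α| + |β| ≤ i} K x^α ∂^[β]`. -/
def canonicalFil (i : ℕ) : Submodule K (DPn K n) :=
  Submodule.span K {a | ∃ α β : Fin n →₀ ℕ, ∑ j, α j + ∑ j, β j ≤ i ∧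
    a = ofPoly K (MvPolynomial.monomial α 1) * dop K β}

section Modules

variable (M : Type v) [AddCommGroup M] [Module K M] [Module (DPn K n) M]

/-- Filtrations of standard type of a `D(P_n)`-module: `{G_i M₀}` where `G` is a finite dimensional
filtration of `D(P_n)` equivalent to the canonical one and `M₀` is a finite dimensional
generating subspace. -/
def IsStandardType (N : ℕ → Submodule K M) : Prop :=
  ∃ (G : ℕ → Submodule K (DPn K n)) (M₀ : Submodule K M),
    IsFinFiltration G ∧ FiltrationEquiv G (canonicalFil K n) ∧
    FiniteDimensional K M₀ ∧ Submodule.span (DPn K n) (M₀ : Set M) = ⊤ ∧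
    ∀ i, N i = filMul G M₀ i

/-- Holonomic modules: nonzero finitely generated modules with a filtration of standard type whose
dimensions are bounded, for `i ≫ 0`, by a polynomial of degree `n`. -/
def IsHolonomic : Prop :=
  Nontrivial M ∧ Module.Finite (DPn K n) M ∧
  ∃ N : ℕ → Submodule K M, IsStandardType K n M N ∧
    ∃ q : Polynomial ℚ, q.degree = (n : WithBot ℕ) ∧
      ∀ᶠ i in Filter.atTop, (Module.finrank K (N i) : ℚ) ≤ q.eval (i : ℚ)

/-- The finitely generated module `M` has dimension `d` and multiplicity `e`: for each finite
dimensional generating subspace `M₀`, the function `i ↦ dim_K (F_i M₀)` is an almost polynomial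
of degree `d` with leading coefficient `e / d!`. -/
def HasMultiplicity (d : ℕ) (e : ℚ) : Prop :=
  Module.Finite (DPn K n) M ∧
  ∀ M₀ : Submodule K M, FiniteDimensional K M₀ →
    Submodule.span (DPn K n) (M₀ : Set M) = ⊤ →
    ∃ k, IsAlmostPolynomial (fun i => Module.finrank K (filMul (canonicalFil K n) M₀ i)) k d
      (e / (d.factorial : ℚ))

end Modules

/-- The associated primes over `P_n` of a `D(P_n)`-module: the prime ideals that are
annihilators of an element. -/
def assP (M : Type v) [AddCommGroup M] [Module (DPn K n) M] : Set (Ideal (Pn K n)) :=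
  {I | I.IsPrime ∧ ∃ u : M, ∀ h, h ∈ I ↔ ofPoly K h • u = 0}

theorem assP_congr {M : Type*} {N : Type*} [AddCommGroup M] [Module (DPn K n) M]
    [AddCommGroup N] [Module (DPn K n) N] (e : M ≃ₗ[DPn K n] N) : assP K n M = assP K n N := by
  ext I
  constructor
  · rintro ⟨hI, u, hu⟩
    refine ⟨hI, e u, fun h => ?_⟩
    rw [hu, ← map_smul, map_eq_zero_iff _ e.injective]
  · rintro ⟨hI, u, hu⟩
    refine ⟨hI, e.symm u, fun h => ?_⟩
    rw [hu, ← map_smul, map_eq_zero_iff _ e.symm.injective]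

/-- `[M] ↦ ass(M)` on isoclasses. -/
def assClass : SimpleFPClass (DPn K n) → Set (Ideal (Pn K n)) :=
  Quotient.lift (fun M => assP K n M.carrier) fun _ _ ⟨e⟩ => assP_congr K n e

/-! ### The modules `U(m)` -/

variable {n} (p : ℕ) (m : MaximalSpectrum (Pn K n))

/-- The monic irreducible generator `g_i` of the ideal `K[x_i] ∩ m` of `K[x_i]`. -/
def gPoly (i : Fin n) : Polynomial K :=
  minpoly K (Ideal.Quotient.mk m.asIdeal (MvPolynomial.X i))

/-- The exponent `k_i`: `g_i = f_i(x_i ^ (p ^ k_i))` with `f_i` separable. (There is exactly one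
such exponent.) -/
def kExp (i : Fin n) : ℕ :=
  sInf {k | ∃ f : Polynomial K, f.Separable ∧ gPoly K m i = Polynomial.expand K (p ^ k) f}

/-- The subalgebra `A(m) = ⊗_i (Λ_{i,[p^{k_i}]} ⊗ K[x_i])` of `D(P_n)`, generated by the `x_i` and
the `∂_i^[j]` with `j < p ^ k_i`. -/
def algA : Subalgebra K (DPn K n) :=
  Algebra.adjoin K ({a | ∃ i, a = ofPoly K (MvPolynomial.X i)} ∪
    {a | ∃ i j, j < p ^ kExp K p m i ∧ a = dop K (Finsupp.single i j)})

/-- The kernel of `K[x_1^{p^{k_1}}, …, x_n^{p^{k_n}}] → P_n/m`. This subalgebra of `P_n` modulo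
the `g_i` is `⊗_i L_i' = ∏_ν Γ_ν`; the kernel contains the `g_i`, and modulo the `g_i` it is the
product of all the factors `Γ_ν` but the one that embeds in `P_n/m`, which is `Γ(m)`. -/
def centralKer : Set (Pn K n) :=
  {h | h ∈ m.asIdeal ∧
    h ∈ Algebra.adjoin K {a | ∃ i, a = (MvPolynomial.X i : Pn K n) ^ p ^ kExp K p m i}}

/-- The left ideal of `A(m)` generated by the kernel above and the `∂_i^[j]`, `0 < j < p^{k_i}`. -/
def leftIdealJ : Submodule (algA K p m) (algA K p m) :=
  Submodule.span (algA K p m)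
    ({a | ∃ h ∈ centralKer K p m, (a : DPn K n) = ofPoly K h} ∪
     {a | ∃ i j, 0 < j ∧ j < p ^ kExp K p m i ∧ (a : DPn K n) = dop K (Finsupp.single i j)})

/-- The `A(m)`-module `V(m)`: the simple module over
`A(m)/(g_1, …, g_n) = ∏_ν M_{p^k}(Γ_ν)` that belongs to the factor `Γ(m)`. -/
abbrev modV : Type u := algA K p m ⧸ leftIdealJ K p m

/-- The `D(P_n)`-module `U(m) = D(P_n) ⊗_{A(m)} V(m)`. -/
abbrev modU : Type u := Induced (algA K p m) (modV K p m)

/-- The subspace `1 ⊗ V(m)` of `U(m)`. -/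
def oneTensorV : Submodule K (modU K p m) :=
  LinearMap.range (Induced.tmul (algA K p m) (modV K p m) 1)

/-- The filtration `U(m)_i = F_i (1 ⊗ V(m))`. -/
def filU (i : ℕ) : Submodule K (modU K p m) :=
  filMul (canonicalFil K n) (oneTensorV K p m) i

/-- The multi-index `(i_1 p^{k_1}, …, i_n p^{k_n})`. -/
def scaleIdx (β : Fin n →₀ ℕ) : Fin n →₀ ℕ :=
  Finsupp.equivFunOnFinite.symm fun i => β i * p ^ kExp K p m i

/-- The map `Λ(m) ⊗ V(m) → U(m)`: the family `(v_β)` is sent to the sum of the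
`∂_1^[β_1 p^{k_1}] ⋯ ∂_n^[β_n p^{k_n}] ⊗ v_β`. -/
def expandU : ((Fin n →₀ ℕ) →₀ modV K p m) →ₗ[K] modU K p m :=
  Finsupp.lsum K fun β =>
    Induced.tmul (algA K p m) (modV K p m) (dop K (scaleIdx K p m β))

/-- The maximal separable subextension `(P_n/m)^sep` of the field `P_n/m` over `K`. -/
def residueSep : Subalgebra K (Pn K n ⧸ m.asIdeal) :=
  letI := Ideal.Quotient.field m.asIdeal
  (separableClosure K (Pn K n ⧸ m.asIdeal)).toSubalgebra

end Pn

end DModCharP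
end

open DModCharP

/-! Everything rests on one device, `IsLowering`. Suppose linear maps e_β : N → W, indexed by
multi-indices, and operators T_i on W satisfy T_i e_(β+1_i) = e_β, and T_i e_β = 0 when β_i = 0.
Applying the T_i to a finite sum ∑ e_β(v_β) moves a coefficient of top degree under e_0 and kills
all other terms. So if e_0 is injective, the sum map is injective and the joint kernel of the T_i on
its image is e_0(N). Moreover a nonzero T-stable subspace of the image meets e_0(N).

Characteristic p enters through ad(a^(p^s)) = (ad a)^(p^s) (`ad_pow_char`): x_i^(p^s) commutes with
∂_i^[j] for j < p^s, and its commutator lowers larger divided powers by p^s. Put y_i = x_i^(p^k_i).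
The y_i are central in A(m), and with T_i = ad y_i one gets that D is a free right A(m)-module on
the ∂^[β p^k]; hence U(m) is the direct sum of the ∂^[β p^k] ⊗ V(m). By the theory of killed
vectors, V(m) is a sum of copies of the field Γ(m) = K[y]/z, one for each monomial of the box, and
its vectors killed by all ∂_i^[j] are Γ(m)·1. Since the y_i are separable modulo m, Γ(m) is the
separable part of the residue field (`residueFrob_range`).

The crux is `exists_rightMul_eq_smul`. The lowering operator on U(m) is right minus left
multiplication by y_i, and right multiplication does not come from D. But it is locally nilpotent,
so on a given vector right and left multiplication by y_i^(p^s) agree for large s; by separability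
y_i = r(y_i^(p^s)) in Γ(m), so on that vector right multiplication by y_i is left multiplication by
r(y_i^(p^s)). Hence A(m)-submodules of U(m) are stable under lowering and D-endomorphisms commute
with it. Simplicity and End U(m) = Γ(m) follow from the device.

For the classification, write a simple finitely presented module as D/I. Generators of I lie in an
algebra generated by the x_i and the ∂_i^[j] with j < p^k, which is finite over its central
polynomial subalgebra. A proper left ideal there can be enlarged to contain a maximal ideal of that
center, and remains proper after extension to D by freeness; maximality of I then puts the maximal
ideal inside I. An associated prime above it is maximal by integrality, and `exists_hom_modU` maps
U(m) onto the module.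

For growth, U(m) is a union of finite dimensional layers U_k of dimension p^(kn)[Γ(m):K], and U(m)
is the direct sum of the ∂^[p^k β] U_k. F_i M₀ splits along this sum, with pieces that fill U_k once
their degree is large. Summing n times with step p^k gives degree n and cancels the factor p^(kn).
-/

noncomputable section

namespace DModCharP

/-! ### Families with lowering operators -/

section Lowering

variable {K N W : Type*} [Field K] [AddCommGroup N] [Module K N] [AddCommGroup W] [Module K W]
  {n : ℕ}

/-- The operators `T i` lower the `i`-th index of the family of linear maps `e`. -/
structure IsLowering (e : (Fin n →₀ ℕ) → N →ₗ[K] W) (T : Fin n → W →ₗ[K] W) : Prop where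
  succ : ∀ i β v, T i (e (β + Finsupp.single i 1) v) = e β v
  zero : ∀ i β v, β i = 0 → T i (e β v) = 0

theorem sub_single_add_single {i : Fin n} {β : Fin n →₀ ℕ} {q : ℕ} (h : q ≤ β i) :
    β - Finsupp.single i q + Finsupp.single i q = β := by
  ext j
  by_cases hj : j = i
  · subst hj; simp; omega
  · simp [Ne.symm hj]

variable (K) in
/-- Shift of the `i`-th index. -/
def shift (i : Fin n) : ((Fin n →₀ ℕ) →₀ N) →ₗ[K] ((Fin n →₀ ℕ) →₀ N) :=
  Finsupp.lcomapDomain (· + Finsupp.single i 1) (add_left_injective _)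

theorem shift_apply (i : Fin n) (f : (Fin n →₀ ℕ) →₀ N) (β : Fin n →₀ ℕ) :
    shift K i f β = f (β + Finsupp.single i 1) := rfl

theorem sum_sub_single {i : Fin n} {β : Fin n →₀ ℕ} {q : ℕ} (h : q ≤ β i) :
    ∑ j, (β - Finsupp.single i q) j + q = ∑ j, β j := by
  conv_rhs => rw [← sub_single_add_single h]
  simp [Finset.sum_add_distrib, Finsupp.single_apply]

namespace IsLowering

variable {e : (Fin n →₀ ℕ) → N →ₗ[K] W} {T : Fin n → W →ₗ[K] W}

/-- The lowering operator becomes a shift of coefficient families, so later arguments only inspect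
coefficients. -/
theorem apply_lsum (h : IsLowering e T) (i : Fin n) (f : (Fin n →₀ ℕ) →₀ N) :
    T i (Finsupp.lsum K e f) = Finsupp.lsum K e (shift K i f) := by
  suffices T i ∘ₗ Finsupp.lsum K e = Finsupp.lsum K e ∘ₗ shift K i from LinearMap.congr_fun this f
  refine Finsupp.lhom_ext fun β v => ?_
  simp only [LinearMap.comp_apply, Finsupp.lsum_single]
  by_cases h0 : β i = 0
  · have : shift K i (Finsupp.single β v) = 0 := by
      ext γ
      rw [shift_apply, Finsupp.single_apply, if_neg, Finsupp.zero_apply]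
      rintro rfl
      simp at h0
    rw [this, h.zero i β v h0, map_zero]
  · obtain ⟨γ, rfl⟩ : ∃ γ : Fin n →₀ ℕ, β = γ + Finsupp.single i 1 :=
      ⟨_, (sub_single_add_single (Nat.one_le_iff_ne_zero.2 h0)).symm⟩
    have : shift K i (Finsupp.single (γ + Finsupp.single i 1) v) = Finsupp.single γ v := by
      ext δ
      rw [shift_apply, Finsupp.single_apply, Finsupp.single_apply]
      simp
    rw [this, h.succ, Finsupp.lsum_single]

/-- A subspace stable under the lowering operators contains the image under `e 0` of each
coefficient of top degree of each of its elements. -/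
theorem top_coeff_mem (h : IsLowering e T) (S : Submodule K W) (hS : ∀ i, ∀ w ∈ S, T i w ∈ S) :
    ∀ (M : ℕ) (f : (Fin n →₀ ℕ) →₀ N) (β₀ : Fin n →₀ ℕ), ∑ j, β₀ j = M →
      (∀ β, f β ≠ 0 → ∑ j, β j ≤ M) → Finsupp.lsum K e f ∈ S → e 0 (f β₀) ∈ S := by
  intro M
  induction M with
  | zero =>
    intro f β₀ h0 hf hS
    have h00 : ∀ β : Fin n →₀ ℕ, ∑ j, β j ≤ 0 → β = 0 := by
      intro β hβ
      ext j
      simpa using (Finset.sum_eq_zero_iff.1 (Nat.le_zero.1 hβ)) j (Finset.mem_univ j)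
    obtain rfl := h00 β₀ h0.le
    have : f = Finsupp.single 0 (f 0) := by
      ext β
      by_cases hβ : f β = 0
      · rw [hβ, Finsupp.single_apply]
        split_ifs with h1
        · rw [h1, hβ]
        · rfl
      · rw [h00 β (hf β hβ)]; simp
    rwa [this, Finsupp.lsum_single] at hS
  | succ M ih =>
    intro f β₀ h0 hf hfS
    obtain ⟨i, hi⟩ : ∃ i, β₀ i ≠ 0 := by
      by_contra! hc
      simp [hc] at h0
    have h1 : 1 ≤ β₀ i := Nat.one_le_iff_ne_zero.2 hi
    -- Lowering in a direction with `β₀ i ≠ 0` keeps the coefficient at `β₀`, now at a smaller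
    -- index, and cuts the degree bound by one.
    have := ih (shift K i f) (β₀ - Finsupp.single i 1) ?_ ?_ ?_
    · rwa [shift_apply, sub_single_add_single h1] at this
    · have := sum_sub_single h1
      omega
    · intro β hβ
      have := hf _ hβ
      simp [Finset.sum_add_distrib, Finsupp.single_apply] at this
      omega
    · rw [← h.apply_lsum]
      exact hS i _ hfS

theorem exists_top (f : (Fin n →₀ ℕ) →₀ N) (hf : f ≠ 0) :
    ∃ β₀, f β₀ ≠ 0 ∧ ∀ β, f β ≠ 0 → ∑ j, β j ≤ ∑ j, β₀ j := by
  obtain ⟨β₀, h0, h1⟩ := Finset.exists_max_image f.support (fun β => ∑ j, β j)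
    (Finsupp.support_nonempty_iff.2 hf)
  exact ⟨β₀, by simpa using h0, fun β hβ => h1 β (by simpa using hβ)⟩

/-- A nonzero element of the kernel would have a nonzero top coefficient sent to zero by `e 0`:
apply `top_coeff_mem` to the subspace `⊥`. -/
theorem injective (h : IsLowering e T) (h0 : Function.Injective (e 0)) :
    Function.Injective (Finsupp.lsum K e) := by
  rw [injective_iff_map_eq_zero]
  intro f hf
  by_contra hne
  obtain ⟨β₀, h1, h2⟩ := exists_top f hne
  have := h.top_coeff_mem ⊥ (by simp) _ f β₀ rfl h2 (by simpa using hf)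
  exact h1 (h0 (by simpa using this))

/-- A nonzero subspace that is stable under the lowering operators meets the image of `e 0`. -/
theorem exists_mem_of_ne_zero (h : IsLowering e T) (S : Submodule K W)
    (hS : ∀ i, ∀ w ∈ S, T i w ∈ S) (f : (Fin n →₀ ℕ) →₀ N) (hf : f ≠ 0)
    (hfS : Finsupp.lsum K e f ∈ S) : ∃ v, v ≠ 0 ∧ e 0 v ∈ S := by
  obtain ⟨β₀, h1, h2⟩ := exists_top f hf
  exact ⟨_, h1, h.top_coeff_mem S hS _ f β₀ rfl h2 hfS⟩

/-- By injectivity all shifts of `f` vanish, and every nonzero index occurs in some shift. This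
later locates the image of the generator of U(m) under an endomorphism. -/
theorem eq_single_of_forall_eq_zero (h : IsLowering e T) (h0 : Function.Injective (e 0))
    (f : (Fin n →₀ ℕ) →₀ N) (hf : ∀ i, T i (Finsupp.lsum K e f) = 0) :
    f = Finsupp.single 0 (f 0) := by
  ext β
  by_cases hβ : β = 0
  · simp [hβ]
  · obtain ⟨i, hi⟩ : ∃ i, β i ≠ 0 := by
      by_contra! hc
      exact hβ (by ext j; simp [hc])
    have h1 := hf i
    rw [h.apply_lsum, ← map_zero (Finsupp.lsum K e)] at h1
    have h2 := h.injective h0 h1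
    have h3 := DFunLike.congr_fun h2 (β - Finsupp.single i 1)
    rw [shift_apply, sub_single_add_single (Nat.one_le_iff_ne_zero.2 hi)] at h3
    rw [h3, Finsupp.single_apply, if_neg (Ne.symm hβ), Finsupp.zero_apply]

end IsLowering

end Lowering

/-! ### Multiplication in `D(P_n)` -/

section Mul

variable (K : Type u) [Field K] {n : ℕ}

/-- `D(P_n)` acts on `P_n`. -/
def toEnd : DPn K n →ₐ[K] Module.End K (Pn K n) := (diffOps K (Pn K n)).val

theorem toEnd_injective : Function.Injective (toEnd K (n := n)) := Subtype.val_injective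

@[simp] theorem toEnd_dop (β : Fin n →₀ ℕ) : toEnd K (dop K β) = hasse K β := rfl

@[simp] theorem toEnd_ofPoly (h : Pn K n) : toEnd K (ofPoly K h) = Algebra.lmul K (Pn K n) h := rfl

theorem toEnd_ofPoly_apply (h g : Pn K n) : toEnd K (ofPoly K h) g = h * g := rfl

/-- `ofPoly` as a homomorphism of algebras. -/
def ofPolyHom : Pn K n →ₐ[K] DPn K n where
  toFun := ofPoly K
  map_one' := toEnd_injective K (by rw [toEnd_ofPoly, map_one, map_one])
  map_mul' a b := toEnd_injective K (by simp only [toEnd_ofPoly, map_mul])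
  map_zero' := toEnd_injective K (by simp)
  map_add' a b := toEnd_injective K (by simp)
  commutes' c := toEnd_injective K (by rw [toEnd_ofPoly, AlgHom.commutes, AlgHom.commutes])

theorem ofPolyHom_apply (h : Pn K n) : ofPolyHom K h = ofPoly K h := rfl

theorem ofPoly_mul (a b : Pn K n) : ofPoly K (a * b) = ofPoly K a * ofPoly K b :=
  map_mul (ofPolyHom K) a b

theorem ofPoly_add (a b : Pn K n) : ofPoly K (a + b) = ofPoly K a + ofPoly K b :=
  map_add (ofPolyHom K) a b

theorem ofPoly_one : ofPoly K (1 : Pn K n) = 1 := map_one (ofPolyHom K)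

theorem ofPoly_pow (a : Pn K n) (m : ℕ) : ofPoly K (a ^ m) = ofPoly K a ^ m :=
  map_pow (ofPolyHom K) a m

theorem ofPoly_commute (a b : Pn K n) : ofPoly K a * ofPoly K b = ofPoly K b * ofPoly K a := by
  rw [← ofPoly_mul, mul_comm, ofPoly_mul]

theorem dop_zero : dop K (0 : Fin n →₀ ℕ) = 1 := by
  refine toEnd_injective K ((MvPolynomial.basisMonomials (Fin n) K).ext fun α => ?_)
  simp [hasse_monomial]

theorem dop_mul (β γ : Fin n →₀ ℕ) :
    dop K β * dop K γ = ((∏ i, (β i + γ i).choose (β i) : ℕ) : K) • dop K (β + γ) := by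
  refine toEnd_injective K ((MvPolynomial.basisMonomials (Fin n) K).ext fun α => ?_)
  simp only [map_mul, toEnd_dop, map_smul, MvPolynomial.coe_basisMonomials, Module.End.mul_apply,
    hasse_monomial, LinearMap.smul_apply, MvPolynomial.smul_monomial, smul_eq_mul, one_mul]
  have h1 : α - γ - β = α - (β + γ) := by
    rw [add_comm, tsub_add_eq_tsub_tsub]
  rw [h1]
  congr 1
  push_cast
  rw [← Finset.prod_mul_distrib, ← Finset.prod_mul_distrib]
  refine Finset.prod_congr rfl fun i _ => ?_
  norm_cast
  simp only [Finsupp.coe_tsub, Pi.sub_apply, Finsupp.coe_add, Pi.add_apply]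
  -- In each variable: C(α, β+γ) C(β+γ, γ) = C(α, γ) C(α−γ, β).
  have := Nat.choose_mul (n := α i) (k := β i + γ i) (s := γ i) (by omega)
  rw [Nat.add_sub_cancel, ← Nat.choose_symm_add] at this
  rw [← this, mul_comm]

/-- The commutator `d a - a d`, as a linear map in `d`. -/
def ad (a : DPn K n) : DPn K n →ₗ[K] DPn K n := LinearMap.mulRight K a - LinearMap.mulLeft K a

theorem ad_apply (a d : DPn K n) : ad K a d = d * a - a * d := rfl

theorem toEnd_ad (i : Fin n) (d : DPn K n) :
    toEnd K (ad K (ofPoly K (MvPolynomial.X i)) d) = comm K (Pn K n) (MvPolynomial.X i) (toEnd K d) := by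
  rw [ad_apply, comm_apply, map_sub, map_mul, map_mul, toEnd_ofPoly]

theorem ad_X_dop_add (i : Fin n) (β : Fin n →₀ ℕ) :
    ad K (ofPoly K (MvPolynomial.X i)) (dop K (β + Finsupp.single i 1)) = dop K β :=
  toEnd_injective K (by rw [toEnd_ad, toEnd_dop, comm_X_hasse, toEnd_dop])

theorem ad_X_dop_zero (i : Fin n) (β : Fin n →₀ ℕ) (h : β i = 0) :
    ad K (ofPoly K (MvPolynomial.X i)) (dop K β) = 0 :=
  toEnd_injective K (by rw [toEnd_ad, toEnd_dop, comm_X_hasse_zero K β i h, map_zero])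

theorem ad_X_pow_iterate (i : Fin n) (m : ℕ) (β : Fin n →₀ ℕ) :
    (ad K (ofPoly K (MvPolynomial.X i)) ^ m) (dop K (β + Finsupp.single i m)) = dop K β := by
  induction m with
  | zero => simp
  | succ m ih =>
    rw [pow_succ, Module.End.mul_apply, Finsupp.single_add, ← add_assoc, ad_X_dop_add, ih]

theorem ad_X_pow_iterate_zero (i : Fin n) (m : ℕ) (β : Fin n →₀ ℕ) (h : β i < m) :
    (ad K (ofPoly K (MvPolynomial.X i)) ^ m) (dop K β) = 0 := by
  obtain ⟨m', rfl⟩ : ∃ m', m = m' + 1 + β i := ⟨m - 1 - β i, by omega⟩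
  obtain ⟨γ, hγ⟩ : ∃ γ, γ = β - Finsupp.single i (β i) := ⟨_, rfl⟩
  have h1 : β = γ + Finsupp.single i (β i) := by rw [hγ, sub_single_add_single le_rfl]
  have h2 : γ i = 0 := by simp [hγ]
  have h3 := ad_X_pow_iterate K i (β i) γ
  rw [← h1] at h3
  rw [pow_add, Module.End.mul_apply, h3, pow_succ, Module.End.mul_apply, ad_X_dop_zero K i γ h2,
    map_zero]

/-- Left and right multiplication by `a` commute, so their difference obeys the Frobenius identity
in characteristic p. -/
theorem ad_pow_char (p : ℕ) [Fact p.Prime] [CharP K p] (a : DPn K n) (s : ℕ) :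
    ad K (a ^ p ^ s) = ad K a ^ p ^ s := by
  have hc : Commute (LinearMap.mulRight K a) (LinearMap.mulLeft K a) := by
    ext d
    simp [mul_assoc]
  have : CharP (Module.End K (DPn K n)) p := by
    have : Nontrivial (Module.End K (DPn K n)) := by
      refine ⟨1, 0, fun h => ?_⟩
      have h1 : (1 : DPn K n) = 0 := LinearMap.congr_fun h 1
      have h2 : (1 : Module.End K (Pn K n)) = 0 := by rw [← map_one (toEnd K), h1, map_zero]
      have h3 := LinearMap.congr_fun h2 1
      simp at h3
    exact charP_of_injective_algebraMap (algebraMap K (Module.End K (DPn K n))).injective p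
  rw [ad, ad, sub_pow_char_pow_of_commute p s hc, LinearMap.pow_mulLeft, LinearMap.pow_mulRight]

variable (p : ℕ) [Fact p.Prime] [CharP K p]

theorem ad_X_pow_dop_add (i : Fin n) (s : ℕ) (β : Fin n →₀ ℕ) :
    ad K (ofPoly K (MvPolynomial.X i ^ p ^ s)) (dop K (β + Finsupp.single i (p ^ s))) = dop K β := by
  rw [ofPoly_pow, ad_pow_char K p, ad_X_pow_iterate]

theorem ad_X_pow_dop_zero (i : Fin n) (s : ℕ) (β : Fin n →₀ ℕ) (h : β i < p ^ s) :
    ad K (ofPoly K (MvPolynomial.X i ^ p ^ s)) (dop K β) = 0 := by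
  rw [ofPoly_pow, ad_pow_char K p, ad_X_pow_iterate_zero K i _ β h]

theorem ad_mul (a d b : DPn K n) : ad K a (d * b) = d * ad K a b + ad K a d * b := by
  simp only [ad_apply, mul_sub, sub_mul, mul_assoc]; abel

end Mul


/-! ### Binomial coefficients modulo `p` -/

section Binomial

variable (p : ℕ) [hp : Fact p.Prime]

/-- Lucas: the last `s` base-p digits of `b * p ^ s` are zero and the higher part is unchanged by
adding `c`, so every factor is 1. -/
theorem choose_mul_pow_add_modEq_one (s : ℕ) :
    ∀ b c : ℕ, c < p ^ s → (b * p ^ s + c).choose (b * p ^ s) ≡ 1 [MOD p] := by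
  have hp0 : 0 < p := hp.out.pos
  induction s with
  | zero =>
    intro b c hc
    obtain rfl : c = 0 := by simpa using hc
    simp [Nat.ModEq]
  | succ s ih =>
    intro b c hc
    refine Choose.choose_modEq_choose_mod_mul_choose_div_nat.trans ?_
    have e1 : b * p ^ (s + 1) % p = 0 := by
      rw [pow_succ, ← mul_assoc]; exact Nat.mul_mod_left _ _
    have e2 : b * p ^ (s + 1) / p = b * p ^ s := by
      rw [pow_succ, ← mul_assoc]; exact Nat.mul_div_cancel _ hp0
    have e3 : (b * p ^ (s + 1) + c) / p = b * p ^ s + c / p := by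
      rw [pow_succ, ← mul_assoc, mul_comm, Nat.mul_add_div hp0]
    rw [e1, e2, e3, Nat.choose_zero_right, one_mul]
    exact ih b (c / p) ((Nat.div_lt_iff_lt_mul hp0).2 (by rwa [← pow_succ]))

/-- Kummer: adding `a` and `b` produces a carry out of the top digit. This is why products of
bounded divided powers that leave the box vanish. -/
theorem dvd_choose_add_of_lt (s : ℕ) :
    ∀ a b : ℕ, a < p ^ s → b < p ^ s → p ^ s ≤ a + b → p ∣ (a + b).choose a := by
  have hp0 : 0 < p := hp.out.pos
  induction s with
  | zero => intro a b ha hb hab; simp at *; omega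
  | succ s ih =>
    intro a b ha hb hab
    refine (Nat.ModEq.dvd_iff Choose.choose_modEq_choose_mod_mul_choose_div_nat dvd_rfl).2 ?_
    -- Without a carry in the lowest digit the induction applies to the quotients by p. With one,
    -- the lowest digit of the sum drops below that of `a` and its Lucas factor is zero.
    by_cases h : a % p + b % p < p
    · refine Dvd.dvd.mul_left ?_ _
      have e : (a + b) / p = a / p + b / p := by
        rw [Nat.add_div hp0, if_neg (by omega), add_zero]
      rw [e]
      refine ih _ _ ((Nat.div_lt_iff_lt_mul hp0).2 (by rwa [← pow_succ]))
        ((Nat.div_lt_iff_lt_mul hp0).2 (by rwa [← pow_succ])) ?_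
      rw [← e]
      exact (Nat.le_div_iff_mul_le hp0).2 (by rwa [← pow_succ])
    · have e : (a + b) % p = a % p + b % p - p := by
        rw [Nat.add_mod, Nat.mod_eq_sub_mod (by omega), Nat.mod_eq_of_lt]
        have := Nat.mod_lt a hp0
        have := Nat.mod_lt b hp0
        omega
      have h2 : (a + b) % p < a % p := by
        have := Nat.mod_lt b hp0
        omega
      rw [Nat.choose_eq_zero_of_lt h2, zero_mul]
      exact dvd_zero p

end Binomial

section Structure

variable (K : Type u) [Field K] {n : ℕ}

theorem dop_mul_of_disjoint (β γ : Fin n →₀ ℕ) (h : ∀ i, β i = 0 ∨ γ i = 0) :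
    dop K β * dop K γ = dop K (β + γ) := by
  rw [dop_mul]
  have : ∏ i, (β i + γ i).choose (β i) = 1 := by
    refine Finset.prod_eq_one fun i _ => ?_
    rcases h i with h | h <;> simp [h]
  rw [this, Nat.cast_one, one_smul]

/-! ### The decomposition `D(P_n) = ⊕ ∂^[β] P_n` -/

/-- The map `h ↦ ∂^[β] h`. -/
def dopMulPoly (β : Fin n →₀ ℕ) : Pn K n →ₗ[K] DPn K n :=
  LinearMap.mulLeft K (dop K β) ∘ₗ (ofPolyHom K).toLinearMap

theorem dopMulPoly_apply (β : Fin n →₀ ℕ) (h : Pn K n) :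
    dopMulPoly K β h = dop K β * ofPoly K h := rfl

theorem ad_ofPoly_ofPoly (a b : Pn K n) : ad K (ofPoly K a) (ofPoly K b) = 0 := by
  rw [ad_apply, ofPoly_commute, sub_self]

theorem isLowering_dopMulPoly :
    IsLowering (dopMulPoly K (n := n)) fun i => ad K (ofPoly K (MvPolynomial.X i)) where
  succ i β h := by
    rw [dopMulPoly_apply, ad_mul, ad_ofPoly_ofPoly, mul_zero, zero_add, ad_X_dop_add,
      dopMulPoly_apply]
  zero i β h h0 := by
    rw [dopMulPoly_apply, ad_mul, ad_ofPoly_ofPoly, mul_zero, zero_add, ad_X_dop_zero K i β h0,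
      zero_mul]

theorem ofPoly_injective : Function.Injective (ofPoly K (n := n)) := by
  intro a b h
  have : toEnd K (ofPoly K a) 1 = toEnd K (ofPoly K b) 1 := by rw [h]
  simpa [toEnd_ofPoly_apply] using this

theorem dopMulPoly_zero_injective : Function.Injective (dopMulPoly K (0 : Fin n →₀ ℕ)) := by
  intro a b h
  rw [dopMulPoly_apply, dopMulPoly_apply, dop_zero, one_mul, one_mul] at h
  exact ofPoly_injective K h

theorem ad_X_comm (i j : Fin n) (d : DPn K n) :
    ad K (ofPoly K (MvPolynomial.X i)) (ad K (ofPoly K (MvPolynomial.X j)) d) =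
      ad K (ofPoly K (MvPolynomial.X j)) (ad K (ofPoly K (MvPolynomial.X i)) d) := by
  simp only [ad_apply, sub_mul, mul_sub, mul_assoc]
  rw [ofPoly_commute K (MvPolynomial.X j) (MvPolynomial.X i)]
  simp only [← mul_assoc]
  rw [ofPoly_commute K (MvPolynomial.X j) (MvPolynomial.X i)]
  abel

/-- Commuting with the variables forces commuting with all of `P_n`, and a `P_n`-linear endomorphism
is multiplication by its value at 1. -/
theorem eq_ofPoly_of_ad_X {d : DPn K n}
    (h : ∀ i, ad K (ofPoly K (MvPolynomial.X i)) d = 0) : d = ofPoly K (toEnd K d 1) := by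
  have h1 : ∀ a, comm K (Pn K n) a (toEnd K d) = 0 := fun a => by
    simpa using comm_mem_of_comm_X K (S := ⊥) (f := toEnd K d) (by simp) (by simp)
      (fun i => by rw [← toEnd_ad, h i, map_zero]; exact zero_mem _) a
  refine toEnd_injective K (LinearMap.ext fun a => ?_)
  have h2 := LinearMap.congr_fun (h1 a) 1
  rw [comm_apply, LinearMap.sub_apply, LinearMap.zero_apply, sub_eq_zero] at h2
  simpa [toEnd_ofPoly_apply, mul_comm] using h2

/-- An operator all of whose commutators with the variables are in `∑ ∂^[β] P_n` is in
`∑ ∂^[β] P_n`. -/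
theorem mem_range_of_ad_X {d : DPn K n}
    (h : ∀ i, ad K (ofPoly K (MvPolynomial.X i)) d ∈
      LinearMap.range (Finsupp.lsum K (dopMulPoly K (n := n)))) :
    d ∈ LinearMap.range (Finsupp.lsum K (dopMulPoly K (n := n))) := by
  classical
  have hL := isLowering_dopMulPoly K (n := n)
  -- This is a Poincaré lemma: the equations for the commutators with the x_i are integrated one
  -- variable at a time. What finally remains commutes with every x_i, hence is a polynomial.
  suffices H : ∀ S : Finset (Fin n), ∃ g ∈ LinearMap.range (Finsupp.lsum K (dopMulPoly K (n := n))),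
      ∀ i ∈ S, ad K (ofPoly K (MvPolynomial.X i)) (d - g) = 0 by
    obtain ⟨g, hg, h1⟩ := H Finset.univ
    have h2 := eq_ofPoly_of_ad_X K (d := d - g) fun i => h1 i (Finset.mem_univ i)
    rw [← sub_add_cancel d g]
    refine add_mem ⟨Finsupp.single 0 (toEnd K (d - g) 1), ?_⟩ hg
    rw [Finsupp.lsum_single, dopMulPoly_apply, dop_zero, one_mul, ← h2]
  intro S
  induction S using Finset.induction_on with
  | empty => exact ⟨0, zero_mem _, by simp⟩
  | insert j S hj ih =>
    obtain ⟨g, hg, h1⟩ := ih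
    obtain ⟨f, hf⟩ : ad K (ofPoly K (MvPolynomial.X j)) (d - g) ∈
        LinearMap.range (Finsupp.lsum K (dopMulPoly K (n := n))) := by
      rw [map_sub]
      refine sub_mem (h j) ?_
      obtain ⟨f, rfl⟩ := hg
      rw [hL.apply_lsum j f]
      exact ⟨_, rfl⟩
    -- The operators ad x_i commute, so the j-th commutator of `d - g` still commutes with the
    -- variables already treated; its expansion therefore has no index that is positive in a
    -- direction of `S`.
    have hf0 : ∀ i ∈ S, ∀ β, f (β + Finsupp.single i 1) = 0 := by
      intro i hi β
      have h2 : Finsupp.lsum K (dopMulPoly K) (shift K i f) = 0 := by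
        rw [← hL.apply_lsum i f, hf, ad_X_comm, h1 i hi, map_zero]
      rw [← map_zero (Finsupp.lsum K (dopMulPoly K (n := n)))] at h2
      exact DFunLike.congr_fun (hL.injective (dopMulPoly_zero_injective K) h2) β
    -- Raising the j-th index gives a primitive in direction j. By `hf0` it commutes with the x_i, i
    -- ∈ S, and so does not spoil the earlier directions.
    set G := f.sum fun β v => dopMulPoly K (β + Finsupp.single j 1) v with hG
    have hGr : G ∈ LinearMap.range (Finsupp.lsum K (dopMulPoly K (n := n))) :=
      Submodule.sum_mem _ fun β _ => ⟨Finsupp.single (β + Finsupp.single j 1) (f β), by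
        rw [Finsupp.lsum_single]⟩
    refine ⟨g + G, add_mem hg hGr, ?_⟩
    intro i hi
    rw [← sub_sub, map_sub, sub_eq_zero]
    rcases Finset.mem_insert.1 hi with rfl | hi
    · rw [← hf, Finsupp.lsum_apply, hG, map_finsuppSum]
      exact Finset.sum_congr rfl fun β _ => (hL.succ _ β (f β)).symm
    · rw [h1 i hi, hG, map_finsuppSum]
      symm
      refine Finset.sum_eq_zero fun β hβ => hL.zero i _ _ ?_
      have hij : i ≠ j := fun h => hj (h ▸ hi)
      have hβ0 : β i = 0 := by
        by_contra hne
        have := hf0 i hi (β - Finsupp.single i 1)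
        rw [sub_single_add_single (Nat.one_le_iff_ne_zero.2 hne)] at this
        exact (Finsupp.mem_support_iff.1 hβ) this
      simp [hβ0, hij.symm]

/-- Induction on the order: the commutators with the variables have smaller order, and
`mem_range_of_ad_X` integrates them. -/
theorem lsum_dopMulPoly_surjective :
    Function.Surjective (Finsupp.lsum K (dopMulPoly K (n := n))) := by
  suffices H : ∀ (N : ℕ) (d : DPn K n), toEnd K d ∈ diffOpsLE K (Pn K n) N →
      d ∈ LinearMap.range (Finsupp.lsum K (dopMulPoly K (n := n))) by
    intro d
    obtain ⟨N, hN⟩ := d.2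
    exact H N d hN
  intro N
  induction N with
  | zero =>
    intro d hd
    refine mem_range_of_ad_X K fun i => ?_
    have : ad K (ofPoly K (MvPolynomial.X i)) d = 0 :=
      toEnd_injective K (by rw [toEnd_ad, mem_zero.1 hd, map_zero])
    rw [this]
    exact zero_mem _
  | succ N ih =>
    intro d hd
    refine mem_range_of_ad_X K fun i => ih _ ?_
    rw [toEnd_ad]
    exact mem_succ.1 hd _

/-- Induction over the elements `∂^[β] h`. -/
theorem dop_mul_induction {C : DPn K n → Prop} (h0 : C 0) (hadd : ∀ a b, C a → C b → C (a + b))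
    (hd : ∀ β h, C (dop K β * ofPoly K h)) (d : DPn K n) : C d := by
  obtain ⟨f, rfl⟩ := lsum_dopMulPoly_surjective K d
  rw [Finsupp.lsum_apply]
  exact Finset.sum_induction _ C hadd h0 fun β _ => hd β (f β)

/-! ### The subalgebras generated by the variables and bounded divided powers -/

variable (p : ℕ) [Fact p.Prime] [CharP K p] (k : Fin n → ℕ)

/-- The subalgebra generated by the `x_i` and the `∂_i^[j]` with `j < p ^ k i`. -/
def boxAlg : Subalgebra K (DPn K n) :=
  Algebra.adjoin K ({a | ∃ i, a = ofPoly K (MvPolynomial.X i)} ∪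
    {a | ∃ i j, j < p ^ k i ∧ a = dop K (Finsupp.single i j)})

omit [Fact p.Prime] [CharP K p] in
theorem ofPoly_mem_boxAlg (h : Pn K n) : ofPoly K h ∈ boxAlg K p k := by
  induction h using MvPolynomial.induction_on with
  | C c =>
    rw [← MvPolynomial.algebraMap_eq, ← ofPolyHom_apply, AlgHom.commutes]
    exact Subalgebra.algebraMap_mem _ c
  | add a b ha hb => rw [ofPoly_add]; exact add_mem ha hb
  | mul_X a i ha =>
    rw [ofPoly_mul]
    exact mul_mem ha (Algebra.subset_adjoin (Or.inl ⟨i, rfl⟩))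

theorem dop_mem_boxAlg {γ : Fin n →₀ ℕ} (hγ : ∀ i, γ i < p ^ k i) : dop K γ ∈ boxAlg K p k := by
  induction γ using Finsupp.induction with
  | zero => rw [dop_zero]; exact one_mem _
  | single_add i b f hi hb ih =>
    have hfi : f i = 0 := by simpa using hi
    rw [← dop_mul_of_disjoint]
    · refine mul_mem (Algebra.subset_adjoin (Or.inr ⟨i, b, ?_, rfl⟩)) (ih fun j => ?_)
      · simpa [hfi] using hγ i
      · exact lt_of_le_of_lt (by simp) (hγ j)
    · intro j
      by_cases hj : j = i
      · subst hj; exact Or.inr hfi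
      · left; simp [Ne.symm hj]

theorem ofPoly_X_mul_dop (i : Fin n) (β : Fin n →₀ ℕ) :
    ofPoly K (MvPolynomial.X i) * dop K β = dop K β * ofPoly K (MvPolynomial.X i) ∨
    (β i ≠ 0 ∧ ofPoly K (MvPolynomial.X i) * dop K β =
      dop K β * ofPoly K (MvPolynomial.X i) - dop K (β - Finsupp.single i 1)) := by
  by_cases h : β i = 0
  · left
    have := ad_X_dop_zero K i β h
    rw [ad_apply, sub_eq_zero] at this
    exact this.symm
  · right
    refine ⟨h, ?_⟩
    have := ad_X_dop_add K i (β - Finsupp.single i 1)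
    rw [sub_single_add_single (Nat.one_le_iff_ne_zero.2 h), ad_apply] at this
    rw [← this, sub_sub_cancel]

/-- `∂_i^[j] ∂^[γ]` is a multiple of `∂^[γ + j e_i]`, which vanishes if this leaves the box. -/
theorem dop_single_mul_dop_box {i : Fin n} {j : ℕ} (hj : j < p ^ k i) {γ : Fin n →₀ ℕ}
    (hγ : ∀ i, γ i < p ^ k i) :
    ∃ c : K, dop K (Finsupp.single i j) * dop K γ = c • dop K (γ + Finsupp.single i j) ∧
      (p ^ k i ≤ γ i + j → c = 0) := by
  refine ⟨_, by rw [dop_mul, add_comm], fun h => ?_⟩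
  rw [CharP.cast_eq_zero_iff K p]
  refine Dvd.dvd.trans ?_ (Finset.dvd_prod_of_mem _ (Finset.mem_univ i))
  rw [Finsupp.single_eq_same]
  exact dvd_choose_add_of_lt p (k i) _ _ hj (hγ i) (by omega)

/-- The elements of the subalgebra are the combinations of the `∂^[γ] h` with `γ` in the box. -/
theorem boxAlg_le_span : (boxAlg K p k).toSubmodule ≤
    Submodule.span K {d | ∃ (γ : Fin n →₀ ℕ) (h : Pn K n),
      (∀ i, γ i < p ^ k i) ∧ d = dop K γ * ofPoly K h} := by
  set S := Submodule.span K {d | ∃ (γ : Fin n →₀ ℕ) (h : Pn K n),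
      (∀ i, γ i < p ^ k i) ∧ d = dop K γ * ofPoly K h} with hS
  have hpos : ∀ i, 0 < p ^ k i := fun i => pow_pos (Fact.out : p.Prime).pos _
  -- The span contains 1, so stability under left multiplication by the generators suffices.
  -- Products that leave the box have coefficient zero.
  have key : ∀ a ∈ boxAlg K p k, ∀ s ∈ S, a * s ∈ S := by
    intro a ha
    induction ha using Algebra.adjoin_induction with
    | mem a ha =>
      intro s hs
      induction hs using Submodule.span_induction with
      | mem s hs =>
        obtain ⟨γ, h, hγ, rfl⟩ := hs
        rcases ha with ⟨i, rfl⟩ | ⟨i, j, hj, rfl⟩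
        · rw [← mul_assoc]
          rcases ofPoly_X_mul_dop K i γ with h1 | ⟨h0, h1⟩
          · rw [h1, mul_assoc, ← ofPoly_mul]
            exact Submodule.subset_span ⟨γ, _, hγ, rfl⟩
          · rw [h1, sub_mul, mul_assoc, ← ofPoly_mul]
            refine sub_mem (Submodule.subset_span ⟨γ, _, hγ, rfl⟩)
              (Submodule.subset_span ⟨_, _, fun l => ?_, rfl⟩)
            exact lt_of_le_of_lt (by simp) (hγ l)
        · rw [← mul_assoc]
          obtain ⟨c, h1, h2⟩ := dop_single_mul_dop_box K p k hj hγ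
          rw [h1, smul_mul_assoc]
          by_cases hlt : γ i + j < p ^ k i
          · refine Submodule.smul_mem _ _ (Submodule.subset_span ⟨_, _, fun l => ?_, rfl⟩)
            by_cases hl : l = i
            · subst hl; simpa using hlt
            · simpa [Ne.symm hl] using hγ l
          · rw [h2 (by omega), zero_smul]
            exact zero_mem _
      | zero => rw [mul_zero]; exact zero_mem _
      | add x y _ _ hx hy => rw [mul_add]; exact add_mem hx hy
      | smul c x _ hx => rw [mul_smul_comm]; exact Submodule.smul_mem _ _ hx
    | algebraMap c =>
      intro s hs
      rw [← Algebra.smul_def]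
      exact Submodule.smul_mem _ _ hs
    | add x y _ _ hx hy => intro s hs; rw [add_mul]; exact add_mem (hx s hs) (hy s hs)
    | mul x y _ _ hx hy => intro s hs; rw [mul_assoc]; exact hx _ (hy s hs)
  intro a ha
  have := key a ha 1 (Submodule.subset_span ⟨0, 1, by simpa using hpos, by
    rw [dop_zero, ofPoly_one, one_mul]⟩)
  rwa [mul_one] at this

/-- The endomorphism of `P_n` with `x_i ↦ x_i ^ p ^ k i`. -/
def frob : Pn K n →ₐ[K] Pn K n := MvPolynomial.aeval fun i => MvPolynomial.X i ^ p ^ k i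

omit [Fact p.Prime] [CharP K p] in
theorem frob_X (i : Fin n) : frob K p k (MvPolynomial.X i) = MvPolynomial.X i ^ p ^ k i := by
  simp [frob]

/-- `K[x_1 ^ p ^ k_1, …]` is central in the subalgebra. -/
theorem boxAlg_commute {a : DPn K n} (ha : a ∈ boxAlg K p k) (h : Pn K n) :
    a * ofPoly K (frob K p k h) = ofPoly K (frob K p k h) * a := by
  have key : ∀ i, a * ofPoly K (MvPolynomial.X i ^ p ^ k i) =
      ofPoly K (MvPolynomial.X i ^ p ^ k i) * a := by
    intro i
    induction ha using Algebra.adjoin_induction with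
    | mem a ha =>
      rcases ha with ⟨l, rfl⟩ | ⟨l, j, hj, rfl⟩
      · exact ofPoly_commute K _ _
      · rw [← sub_eq_zero, ← ad_apply]
        refine ad_X_pow_dop_zero K p i _ _ ?_
        by_cases hl : l = i
        · subst hl; simpa using hj
        · simpa [hl] using pow_pos (Fact.out : p.Prime).pos _
    | algebraMap c => exact Algebra.commutes c _
    | add x y _ _ hx hy => rw [add_mul, mul_add, hx, hy]
    | mul x y _ _ hx hy => rw [mul_assoc, hy, ← mul_assoc, hx, mul_assoc]
  induction h using MvPolynomial.induction_on with
  | C c =>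
    rw [← MvPolynomial.algebraMap_eq, AlgHom.commutes, ← ofPolyHom_apply, AlgHom.commutes]
    exact (Algebra.commutes c a).symm
  | add x y hx hy => rw [map_add, ofPoly_add, add_mul, mul_add, hx, hy]
  | mul_X x i hx =>
    rw [map_mul, ofPoly_mul, frob_X, ← mul_assoc, hx, mul_assoc, key, mul_assoc]

/-! ### The decomposition `D(P_n) = ⊕ ∂^[β p ^ k] A` -/

/-- The multi-index `(β_1 p ^ k_1, …, β_n p ^ k_n)`. -/
def scale (β : Fin n →₀ ℕ) : Fin n →₀ ℕ := Finsupp.equivFunOnFinite.symm fun i => β i * p ^ k i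

omit [Fact p.Prime] in
@[simp] theorem scale_apply (β : Fin n →₀ ℕ) (i : Fin n) : scale p k β i = β i * p ^ k i := rfl

omit [Fact p.Prime] in
theorem scale_zero : scale p k 0 = 0 := by ext; simp

omit [Fact p.Prime] in
theorem scale_add_single (β : Fin n →₀ ℕ) (i : Fin n) :
    scale p k (β + Finsupp.single i 1) = scale p k β + Finsupp.single i (p ^ k i) := by
  ext j
  by_cases hj : j = i
  · subst hj; simp [add_mul]
  · simp [Ne.symm hj]

/-- The binomial factors are 1 modulo p by `choose_mul_pow_add_modEq_one`. So every divided power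
splits as a multiple-of-p^k part times a part in the box algebra. -/
theorem dop_scale_mul_dop (β : Fin n →₀ ℕ) {γ : Fin n →₀ ℕ} (hγ : ∀ i, γ i < p ^ k i) :
    dop K (scale p k β) * dop K γ = dop K (scale p k β + γ) := by
  rw [dop_mul]
  have : ((∏ i, (scale p k β i + γ i).choose (scale p k β i) : ℕ) : K) = 1 := by
    rw [Nat.cast_prod]
    refine Finset.prod_eq_one fun i _ => ?_
    have := (CharP.natCast_eq_natCast K p).2 (choose_mul_pow_add_modEq_one p (k i) (β i) (γ i) (hγ i))
    rw [scale_apply, this, Nat.cast_one]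
  rw [this, one_smul]

/-- Division with remainder of multi-indices. -/
theorem exists_scale_add (β : Fin n →₀ ℕ) :
    ∃ β' γ : Fin n →₀ ℕ, (∀ i, γ i < p ^ k i) ∧ β = scale p k β' + γ := by
  refine ⟨Finsupp.equivFunOnFinite.symm fun i => β i / p ^ k i,
    Finsupp.equivFunOnFinite.symm fun i => β i % p ^ k i, fun i => ?_, ?_⟩
  · exact Nat.mod_lt _ (pow_pos (Fact.out : p.Prime).pos _)
  · ext i
    simp [Nat.div_add_mod']

theorem ad_frob_X_scale_add (i : Fin n) (β : Fin n →₀ ℕ) :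
    ad K (ofPoly K (frob K p k (MvPolynomial.X i))) (dop K (scale p k (β + Finsupp.single i 1))) =
      dop K (scale p k β) := by
  rw [frob_X, scale_add_single, ad_X_pow_dop_add]

theorem ad_frob_X_scale_zero (i : Fin n) (β : Fin n →₀ ℕ) (h : β i = 0) :
    ad K (ofPoly K (frob K p k (MvPolynomial.X i))) (dop K (scale p k β)) = 0 := by
  rw [frob_X, ad_X_pow_dop_zero]
  simpa [h] using pow_pos (Fact.out : p.Prime).pos _

/-- The map `a ↦ ∂^[β p ^ k] a` on the subalgebra. -/
def dopMulBox (β : Fin n →₀ ℕ) : boxAlg K p k →ₗ[K] DPn K n :=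
  LinearMap.mulLeft K (dop K (scale p k β)) ∘ₗ (boxAlg K p k).val.toLinearMap

omit [Fact p.Prime] [CharP K p] in
theorem dopMulBox_apply (β : Fin n →₀ ℕ) (a : boxAlg K p k) :
    dopMulBox K p k β a = dop K (scale p k β) * a := rfl

/-- The x_i^(p^k_i) are central in the box algebra, so their commutators act only on the left factor
∂^[β p^k]. -/
theorem isLowering_dopMulBox :
    IsLowering (dopMulBox K p k) fun i => ad K (ofPoly K (frob K p k (MvPolynomial.X i))) where
  succ i β a := by
    rw [dopMulBox_apply, ad_mul, ad_frob_X_scale_add, ad_apply, boxAlg_commute K p k a.2, sub_self,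
      mul_zero, zero_add, dopMulBox_apply]
  zero i β a h0 := by
    rw [dopMulBox_apply, ad_mul, ad_frob_X_scale_zero K p k i β h0, ad_apply,
      boxAlg_commute K p k a.2, sub_self, mul_zero, zero_add, zero_mul]

theorem lsum_dopMulBox_bijective : Function.Bijective (Finsupp.lsum K (dopMulBox K p k)) := by
  constructor
  · refine (isLowering_dopMulBox K p k).injective fun a b h => ?_
    rw [dopMulBox_apply, dopMulBox_apply, scale_zero, dop_zero, one_mul, one_mul] at h
    exact Subtype.ext h
  · intro d
    change d ∈ LinearMap.range _
    induction d using dop_mul_induction K with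
    | h0 => exact zero_mem _
    | hadd a b ha hb => exact add_mem ha hb
    | hd β h =>
      obtain ⟨β', γ, hγ, rfl⟩ := exists_scale_add p k β
      refine ⟨Finsupp.single β' ⟨dop K γ * ofPoly K h,
        mul_mem (dop_mem_boxAlg K p k hγ) (ofPoly_mem_boxAlg K p k h)⟩, ?_⟩
      rw [Finsupp.lsum_single, dopMulBox_apply, ← mul_assoc, dop_scale_mul_dop K p k _ hγ]

/-- The coordinates of an operator with respect to the basis `∂^[β p ^ k]` of the right module
`D(P_n)` over the subalgebra. -/
def boxCoord : DPn K n ≃ₗ[K] ((Fin n →₀ ℕ) →₀ boxAlg K p k) :=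
  (LinearEquiv.ofBijective _ (lsum_dopMulBox_bijective K p k)).symm

theorem boxCoord_dop_mul (β : Fin n →₀ ℕ) (a : boxAlg K p k) :
    boxCoord K p k (dop K (scale p k β) * a) = Finsupp.single β a := by
  rw [boxCoord, LinearEquiv.symm_apply_eq, LinearEquiv.ofBijective_apply, Finsupp.lsum_single,
    dopMulBox_apply]

theorem boxCoord_coe (a : boxAlg K p k) : boxCoord K p k a = Finsupp.single 0 a := by
  rw [← boxCoord_dop_mul, scale_zero, dop_zero, one_mul]

theorem box_induction {C : DPn K n → Prop} (h0 : C 0) (hadd : ∀ a b, C a → C b → C (a + b))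
    (hd : ∀ β (a : boxAlg K p k), C (dop K (scale p k β) * a)) (d : DPn K n) : C d := by
  obtain ⟨f, rfl⟩ := (lsum_dopMulBox_bijective K p k).2 d
  rw [Finsupp.lsum_apply]
  exact Finset.sum_induction _ C hadd h0 fun β _ => hd β (f β)

/-- The coordinates are linear over the right action of the box algebra. The coordinate at 0 is the
retraction that embeds V(m) in U(m) and keeps extended left ideals proper. -/
theorem boxCoord_mul (d : DPn K n) (a : boxAlg K p k) (β : Fin n →₀ ℕ) :
    boxCoord K p k (d * a) β = boxCoord K p k d β * a := by
  induction d using box_induction K p k with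
  | h0 => simp
  | hadd x y hx hy => rw [add_mul, map_add, map_add, Finsupp.add_apply, Finsupp.add_apply, hx, hy,
      add_mul]
  | hd γ b =>
    rw [mul_assoc, ← Subalgebra.coe_mul, boxCoord_dop_mul, boxCoord_dop_mul,
      Finsupp.single_apply, Finsupp.single_apply]
    split_ifs <;> simp

end Structure


/-! ### The Frobenius-type endomorphism -/

section Frob

variable (K : Type u) [Field K] {n : ℕ} (p : ℕ) [Fact p.Prime] [CharP K p] (k : Fin n → ℕ)

/-- The set of multi-indices `γ` with `γ_i < p ^ k_i`. -/
abbrev Box : Type := (i : Fin n) → Fin (p ^ k i)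

variable {p k} in
/-- An element of the box as a multi-index. -/
def Box.toIdx (b : Box p k) : Fin n →₀ ℕ := Finsupp.equivFunOnFinite.symm fun i => (b i : ℕ)

omit [Fact p.Prime] in
theorem Box.toIdx_lt (b : Box p k) (i : Fin n) : b.toIdx i < p ^ k i := (b i).2

omit [Fact p.Prime] in
theorem Box.toIdx_injective : Function.Injective (Box.toIdx (p := p) (k := k)) := by
  intro a b h
  funext i
  exact Fin.ext (DFunLike.congr_fun h i)

omit [Fact p.Prime] in
theorem Box.exists_toIdx {γ : Fin n →₀ ℕ} (h : ∀ i, γ i < p ^ k i) : ∃ b : Box p k, b.toIdx = γ :=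
  ⟨fun i => ⟨γ i, h i⟩, by ext i; rfl⟩

theorem Box.card : Fintype.card (Box p k) = p ^ ∑ i, k i := by
  simp [Finset.prod_pow_eq_pow_sum]

theorem frob_monomial (α : Fin n →₀ ℕ) (c : K) :
    frob K p k (MvPolynomial.monomial α c) = MvPolynomial.monomial (scale p k α) c := by
  rw [frob, MvPolynomial.aeval_monomial, MvPolynomial.monomial_eq, Finsupp.prod_fintype _ _ (by simp),
    Finsupp.prod_fintype _ _ (by simp), MvPolynomial.algebraMap_eq]
  congr 1
  refine Finset.prod_congr rfl fun i _ => ?_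
  rw [scale_apply, ← pow_mul, mul_comm]

/-- `P_n` is spanned over the image of the Frobenius-type endomorphism by the monomials of the
box. -/
theorem exists_box_sum (h : Pn K n) : ∃ c : Box p k → Pn K n,
    h = ∑ b, MvPolynomial.monomial b.toIdx 1 * frob K p k (c b) := by
  classical
  induction h using MvPolynomial.induction_on' with
  | monomial α a =>
    obtain ⟨β, γ, hγ, rfl⟩ := exists_scale_add p k α
    obtain ⟨b, rfl⟩ := Box.exists_toIdx p k hγ
    refine ⟨Pi.single b (MvPolynomial.monomial β a), ?_⟩
    rw [Finset.sum_eq_single b]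
    · rw [Pi.single_eq_same, frob_monomial, MvPolynomial.monomial_mul, one_mul, add_comm]
    · intro b' _ hb'
      rw [Pi.single_eq_of_ne hb', map_zero, mul_zero]
    · simp
  | add x y hx hy =>
    obtain ⟨c, rfl⟩ := hx
    obtain ⟨d, rfl⟩ := hy
    refine ⟨c + d, ?_⟩
    simp only [Pi.add_apply, map_add, mul_add, Finset.sum_add_distrib]

/-- Centrality of the image of `frob`, read on `P_n`: the box algebra acts by operators linear over
that image. -/
theorem toEnd_box_mul_frob {a : DPn K n} (ha : a ∈ boxAlg K p k) (h g : Pn K n) :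
    toEnd K a (h * frob K p k g) = toEnd K a h * frob K p k g := by
  have := congrArg (fun d => toEnd K d h) (boxAlg_commute K p k ha g)
  simp only [map_mul, Module.End.mul_apply, toEnd_ofPoly_apply] at this
  rw [mul_comm h, this, mul_comm]

theorem toEnd_dop_monomial_eq_zero {γ δ : Fin n →₀ ℕ} (h : ∑ i, δ i ≤ ∑ i, γ i) (hne : δ ≠ γ) :
    toEnd K (dop K γ) (MvPolynomial.monomial δ 1) = 0 := by
  rw [toEnd_dop, hasse_monomial]
  obtain ⟨i, hi⟩ : ∃ i, δ i < γ i := by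
    by_contra! hc
    refine hne (Finsupp.ext fun i => ?_)
    exact ((Finset.sum_eq_sum_iff_of_le fun i _ => hc i).1
      (le_antisymm (Finset.sum_le_sum fun i _ => hc i) h) i (Finset.mem_univ i)).symm
  rw [Finset.prod_eq_zero (Finset.mem_univ i) (by rw [Nat.choose_eq_zero_of_lt hi, Nat.cast_zero]),
    mul_zero, map_zero]

theorem toEnd_dop_monomial_self (γ : Fin n →₀ ℕ) :
    toEnd K (dop K γ) (MvPolynomial.monomial γ 1) = 1 := by
  rw [toEnd_dop, hasse_monomial]
  simp

/-- Applying `∂^[γ]` to `∑ x^δ c_δ` extracts the coefficient `c_γ` if `γ` is of top degree. -/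
theorem toEnd_dop_box_sum (c : Box p k → Pn K n) (b₀ : Box p k)
    (h : ∀ b, c b ≠ 0 → ∑ i, b.toIdx i ≤ ∑ i, b₀.toIdx i) :
    toEnd K (dop K b₀.toIdx) (∑ b, MvPolynomial.monomial b.toIdx 1 * frob K p k (c b)) =
      frob K p k (c b₀) := by
  have hm := dop_mem_boxAlg K p k (Box.toIdx_lt p k b₀)
  rw [map_sum, Finset.sum_eq_single b₀]
  · rw [toEnd_box_mul_frob K p k hm, toEnd_dop_monomial_self, one_mul]
  · intro b _ hb
    rw [toEnd_box_mul_frob K p k hm]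
    by_cases h0 : c b = 0
    · rw [h0, map_zero, mul_zero]
    · rw [toEnd_dop_monomial_eq_zero K (h b h0) fun e => hb (Box.toIdx_injective p k e), zero_mul]
  · simp

/-- Each variable has a power in the image. Integrality transfers maximality of ideals in both
directions along `frob`. -/
theorem frob_isIntegral : (frob K p k).toRingHom.IsIntegral := by
  intro h
  induction h using MvPolynomial.induction_on with
  | C c =>
    have := RingHom.isIntegralElem_map (frob K p k).toRingHom (x := MvPolynomial.C c)
    rwa [AlgHom.toRingHom_eq_coe, RingHom.coe_coe, ← MvPolynomial.algebraMap_eq, AlgHom.commutes]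
      at this
  | add a b ha hb => exact RingHom.IsIntegralElem.add _ ha hb
  | mul_X a i ha =>
    refine RingHom.IsIntegralElem.mul _ ha ?_
    letI := (frob K p k).toRingHom.toAlgebra
    refine IsIntegral.of_pow (R := Pn K n) (pow_pos (Fact.out : p.Prime).pos (k i)) ?_
    rw [← frob_X]
    exact RingHom.isIntegralElem_map (frob K p k).toRingHom

end Frob

/-! ### The maximal ideal of the central polynomials below m, and vectors killed by divided powers
-/

section ModV

variable (K : Type u) [Field K] {n : ℕ} (p : ℕ) [Fact p.Prime] [CharP K p]
  (m : MaximalSpectrum (Pn K n))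

/-- The ideal of the polynomials `h` with `h(x_1 ^ p ^ k_1, …)` in `m`. -/
def zIdeal : Ideal (Pn K n) := m.asIdeal.comap (frob K p (kExp K p m))

omit [Fact p.Prime] [CharP K p] in
theorem mem_zIdeal {h : Pn K n} : h ∈ zIdeal K p m ↔ frob K p (kExp K p m) h ∈ m.asIdeal := Iff.rfl

instance : (zIdeal K p m).IsMaximal :=
  haveI := m.isMaximal
  Ideal.isMaximal_comap_of_isIntegral_of_isMaximal' _ (frob_isIntegral K p _) m.asIdeal

omit [Fact p.Prime] [CharP K p] in
theorem mem_centralKer {h : Pn K n} :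
    h ∈ centralKer K p m ↔ ∃ g ∈ zIdeal K p m, h = frob K p (kExp K p m) g := by
  have h1 : {a : Pn K n | ∃ i, a = (MvPolynomial.X i : Pn K n) ^ p ^ kExp K p m i} =
      Set.range fun i => (MvPolynomial.X i : Pn K n) ^ p ^ kExp K p m i := by
    ext a; simp [eq_comm]
  rw [centralKer, Set.mem_ofPred_eq, h1, Algebra.adjoin_range_eq_range_aeval]
  constructor
  · rintro ⟨hm, g, rfl⟩
    exact ⟨g, hm, rfl⟩
  · rintro ⟨g, hg, rfl⟩
    exact ⟨hg, g, rfl⟩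

/-- The inclusion of `P_n` in `A(m)`. -/
def polyA : Pn K n →ₐ[K] algA K p m :=
  (ofPolyHom K).codRestrict (algA K p m) (ofPoly_mem_boxAlg K p (kExp K p m))

omit [Fact p.Prime] [CharP K p] in
@[simp] theorem coe_polyA (h : Pn K n) : (polyA K p m h : DPn K n) = ofPoly K h := rfl

omit [Fact p.Prime] [CharP K p] in
theorem eq_polyA {a : algA K p m} {h : Pn K n} (e : (a : DPn K n) = ofPoly K h) :
    a = polyA K p m h := Subtype.ext e

/-- The element `∂^[γ]` of `A(m)`. -/
def dopA (γ : Fin n →₀ ℕ) (hγ : ∀ i, γ i < p ^ kExp K p m i) : algA K p m :=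
  ⟨dop K γ, dop_mem_boxAlg K p _ hγ⟩

theorem polyA_frob_commute (a : algA K p m) (g : Pn K n) :
    a * polyA K p m (frob K p (kExp K p m) g) = polyA K p m (frob K p (kExp K p m) g) * a :=
  Subtype.ext (boxAlg_commute K p (kExp K p m) a.2 g)

section Killed

variable {W : Type*} [AddCommGroup W] [Module (algA K p m) W]

/-- The vectors annihilated by all `∂_i^[j]` with `0 < j < p ^ k_i`. -/
def IsKilled (w : W) : Prop :=
  ∀ i j, 0 < j → j < p ^ kExp K p m i → ∀ a : algA K p m,
    (a : DPn K n) = dop K (Finsupp.single i j) → a • w = 0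

/-- Among the ∂^[γ], γ in the box, that do not kill `w`, take one of greatest degree. Composing with
a further ∂_i^[j] either raises the degree within the box or leaves the box and gives zero. -/
theorem exists_isKilled {w : W} (hw : w ≠ 0) :
    ∃ a : algA K p m, a • w ≠ 0 ∧ IsKilled K p m (a • w) := by
  classical
  set k := kExp K p m
  obtain ⟨b₀, h1, h2⟩ := Finset.exists_max_image
    (Finset.univ.filter fun b : Box p k => dopA K p m b.toIdx (Box.toIdx_lt p k b) • w ≠ 0)
    (fun b => ∑ i, b.toIdx i) (by
      obtain ⟨b, hb⟩ := Box.exists_toIdx (n := n) p k (γ := 0)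
        (fun i => pow_pos (Fact.out : p.Prime).pos _)
      refine ⟨b, Finset.mem_filter.2 ⟨Finset.mem_univ _, ?_⟩⟩
      have : dopA K p m b.toIdx (Box.toIdx_lt p k b) = 1 := Subtype.ext (by
        change dop K b.toIdx = 1
        rw [hb, dop_zero])
      rwa [this, one_smul])
  refine ⟨_, (Finset.mem_filter.1 h1).2, ?_⟩
  rintro i j hj0 hj a ha
  rw [smul_smul]
  obtain ⟨c, hc1, hc2⟩ := dop_single_mul_dop_box K p k hj (Box.toIdx_lt p k b₀)
  by_cases hlt : b₀.toIdx i + j < p ^ k i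
  · have hbox : ∀ l, (b₀.toIdx + Finsupp.single i j : Fin n →₀ ℕ) l < p ^ k l := by
      intro l
      by_cases hl : l = i
      · subst hl; simpa using hlt
      · simpa [Ne.symm hl] using Box.toIdx_lt p k b₀ l
    obtain ⟨b, hb⟩ := Box.exists_toIdx p k hbox
    have e : a * dopA K p m b₀.toIdx (Box.toIdx_lt p k b₀) =
        algebraMap K _ c * dopA K p m b.toIdx (Box.toIdx_lt p k b) := Subtype.ext (by
      change (a : DPn K n) * dop K b₀.toIdx = algebraMap K (DPn K n) c * dop K b.toIdx
      rw [ha, hc1, hb, Algebra.smul_def])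
    rw [e, mul_smul]
    by_contra hne
    have h3 : dopA K p m b.toIdx (Box.toIdx_lt p k b) • w ≠ 0 := fun h0 => hne (by
      rw [h0, smul_zero])
    have h4 := h2 b (Finset.mem_filter.2 ⟨Finset.mem_univ _, h3⟩)
    rw [hb] at h4
    simp [Finset.sum_add_distrib, Finsupp.single_apply] at h4
    omega
  · have e : a * dopA K p m b₀.toIdx (Box.toIdx_lt p k b₀) = 0 := Subtype.ext (by
      change (a : DPn K n) * dop K b₀.toIdx = 0
      rw [ha, hc1, hc2 (by omega), zero_smul])
    rw [e, zero_smul]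

omit [Fact p.Prime] [CharP K p] in
theorem hasse_single_C (i : Fin n) {j : ℕ} (hj : j ≠ 0) (c : K) :
    hasse K (Finsupp.single i j) (MvPolynomial.C c : Pn K n) = 0 := by
  rw [← MvPolynomial.monomial_zero', hasse_monomial,
    Finset.prod_eq_zero (Finset.mem_univ i), mul_zero, map_zero]
  simp [Nat.choose_eq_zero_of_lt (Nat.pos_of_ne_zero hj)]

/-- On the `P_n`-submodule generated by a vector killed by the divided powers, `A(m)` acts
as on `P_n`. -/
theorem IsKilled.smul_polyA {w : W} (hw : IsKilled K p m w) (a : algA K p m) :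
    ∀ h : Pn K n, a • polyA K p m h • w = polyA K p m (toEnd K a h) • w := by
  -- Induction on the polynomial with `j` left free: moving ∂_i^[j] past x_i produces an extra
  -- ∂_i^[j-1].
  have gen : ∀ (i : Fin n) (h : Pn K n) (j : ℕ) (hj : j < p ^ kExp K p m i) (a : algA K p m),
      (a : DPn K n) = dop K (Finsupp.single i j) →
      a • polyA K p m h • w = polyA K p m (toEnd K a h) • w := by
    intro i h
    induction h using MvPolynomial.induction_on with
    | C c =>
      intro j hj a ha
      rw [← MvPolynomial.algebraMap_eq, AlgHom.commutes, smul_smul, ← Algebra.commutes, mul_smul]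
      by_cases h0 : j = 0
      · subst h0
        obtain rfl : a = 1 := Subtype.ext (by rw [ha, Finsupp.single_zero, dop_zero]; rfl)
        rw [one_smul, OneMemClass.coe_one, map_one, Module.End.one_apply, AlgHom.commutes]
      · rw [hw i j (Nat.pos_of_ne_zero h0) hj a ha, smul_zero, ha, toEnd_dop,
          MvPolynomial.algebraMap_eq, hasse_single_C K i h0, map_zero, zero_smul]
    | add x y hx hy =>
      intro j hj a ha
      rw [map_add, add_smul, smul_add, hx j hj a ha, hy j hj a ha, map_add, map_add, add_smul]
    | mul_X x l hx =>
      intro j hj a ha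
      have hX : ∀ b : algA K p m, toEnd K (b : DPn K n) (x * MvPolynomial.X l) =
          toEnd K ((b : DPn K n) * ofPoly K (MvPolynomial.X l)) x := by
        intro b
        rw [map_mul (toEnd K), Module.End.mul_apply, toEnd_ofPoly_apply, mul_comm]
      rw [hX, mul_comm x, map_mul, smul_smul, ← mul_assoc]
      rcases ofPoly_X_mul_dop K l (Finsupp.single i j) with h1 | ⟨h0, h1⟩
      · have e : a * polyA K p m (MvPolynomial.X l) = polyA K p m (MvPolynomial.X l) * a :=
          Subtype.ext (by
            change (a : DPn K n) * ofPoly K _ = ofPoly K _ * (a : DPn K n)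
            rw [ha, h1])
        rw [e, mul_assoc, mul_smul, mul_smul, hx j hj a ha, ha, ← h1, map_mul, Module.End.mul_apply,
          toEnd_ofPoly_apply, map_mul, mul_smul]
      · have hli : l = i := by
          by_contra hne
          simp [Ne.symm hne] at h0
        subst hli
        have hs : Finsupp.single l j - Finsupp.single l 1 = Finsupp.single l (j - 1) := by
          rw [Finsupp.single_tsub]
        have hj' : j - 1 < p ^ kExp K p m l := by omega
        have hb : ∀ i', (Finsupp.single l (j - 1) : Fin n →₀ ℕ) i' < p ^ kExp K p m i' := by
          intro i'
          by_cases hl : i' = l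
          · subst hl; simpa using hj'
          · simpa [Ne.symm hl] using pow_pos (Fact.out : p.Prime).pos _
        rw [hs] at h1
        have h1' := (sub_eq_iff_eq_add.1 h1.symm)
        have e : a * polyA K p m (MvPolynomial.X l) =
            polyA K p m (MvPolynomial.X l) * a + dopA K p m _ hb :=
          Subtype.ext (by
            change (a : DPn K n) * ofPoly K _ = ofPoly K _ * (a : DPn K n) + dop K _
            rw [ha, h1'])
        have h3 := hx (j - 1) hj' (dopA K p m _ hb) rfl
        rw [e, add_mul, add_smul, mul_assoc, mul_smul, mul_smul, hx j hj a ha, mul_smul, h3, ha, h1',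
          map_add, map_mul, LinearMap.add_apply, Module.End.mul_apply, toEnd_ofPoly_apply, map_add,
          map_mul, add_smul, mul_smul]
        rfl
  obtain ⟨a, ha⟩ := a
  induction ha using Algebra.adjoin_induction with
  | mem a ha =>
    intro h
    rcases ha with ⟨i, rfl⟩ | ⟨i, j, hj, rfl⟩
    · rw [smul_smul]
      change _ = polyA K p m (toEnd K (ofPoly K _) h) • w
      rw [toEnd_ofPoly_apply, map_mul]
      rfl
    · exact gen i h j hj _ rfl
  | algebraMap c =>
    intro h
    change (algebraMap K (algA K p m) c) • _ = polyA K p m (toEnd K (algebraMap K (DPn K n) c) h) • w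
    rw [AlgHom.commutes, Module.algebraMap_end_apply, map_smul, smul_smul, Algebra.smul_def]
  | add x y hx hy hx' hy' =>
    intro h
    have e1 := hx' h
    have e2 := hy' h
    change (⟨x, hx⟩ + ⟨y, hy⟩ : algA K p m) • _ = polyA K p m (toEnd K (x + y) h) • w
    rw [add_smul, e1, e2, map_add, LinearMap.add_apply, map_add, add_smul]
  | mul x y hx hy hx' hy' =>
    intro h
    have e1 := hy' h
    have e2 := hx' (toEnd K y h)
    change (⟨x, hx⟩ * ⟨y, hy⟩ : algA K p m) • _ = polyA K p m (toEnd K (x * y) h) • w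
    rw [mul_smul, e1, e2, map_mul, Module.End.mul_apply]

theorem IsKilled.smul_eq {w : W} (hw : IsKilled K p m w) (a : algA K p m) :
    a • w = polyA K p m (toEnd K a 1) • w := by
  have := hw.smul_polyA K p m a 1
  rwa [map_one, one_smul] at this

theorem IsKilled.dop_smul_eq_zero {w : W} (hw : IsKilled K p m w) {γ : Fin n →₀ ℕ}
    (hγ : ∀ i, γ i < p ^ kExp K p m i) (h0 : γ ≠ 0) : dopA K p m γ hγ • w = 0 := by
  rw [hw.smul_eq]
  have : toEnd K (dop K γ) (1 : Pn K n) = 0 := by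
    refine toEnd_dop_monomial_eq_zero (n := n) K (δ := 0) (by simp) (Ne.symm h0)
  change polyA K p m (toEnd K (dop K γ) 1) • w = 0
  rw [this, map_zero, zero_smul]

/-- The homomorphism from `V(m)` defined by a vector that is annihilated by the generators of the
left ideal. -/
def liftV (w : W) (hw : IsKilled K p m w)
    (hz : ∀ g ∈ zIdeal K p m, polyA K p m (frob K p (kExp K p m) g) • w = 0) :
    modV K p m →ₗ[algA K p m] W :=
  (leftIdealJ K p m).liftQ (LinearMap.toSpanSingleton (algA K p m) W w) (by
    rw [leftIdealJ, Submodule.span_le]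
    rintro a (⟨h, hh, ha⟩ | ⟨i, j, hj0, hj, ha⟩)
    · obtain ⟨g, hg, rfl⟩ := (mem_centralKer K p m).1 hh
      rw [SetLike.mem_coe, LinearMap.mem_ker, LinearMap.toSpanSingleton_apply, eq_polyA K p m ha,
        hz g hg]
    · exact hw i j hj0 hj a ha)

end Killed

/-! ### The module `V(m)` -/

/-- The map `h ↦ h 1` from `P_n` to `V(m)`. -/
def polyV : Pn K n →ₗ[K] modV K p m :=
  ((leftIdealJ K p m).mkQ.restrictScalars K) ∘ₗ (polyA K p m).toLinearMap

omit [Fact p.Prime] [CharP K p] in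
theorem polyV_apply (h : Pn K n) : polyV K p m h = (leftIdealJ K p m).mkQ (polyA K p m h) := rfl

omit [Fact p.Prime] [CharP K p] in
theorem polyA_smul_polyV (g h : Pn K n) :
    polyA K p m g • polyV K p m h = polyV K p m (g * h) := by
  rw [polyV_apply, polyV_apply, ← map_smul, map_mul, smul_eq_mul]

omit [Fact p.Prime] [CharP K p] in
theorem polyV_eq_smul (h : Pn K n) : polyV K p m h = polyA K p m h • polyV K p m 1 := by
  rw [polyA_smul_polyV, mul_one]

omit [Fact p.Prime] [CharP K p] in
theorem isKilled_one : IsKilled K p m (polyV K p m 1) := by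
  intro i j hj0 hj a ha
  rw [polyV_apply, ← map_smul, map_one, smul_eq_mul, mul_one, Submodule.mkQ_apply,
    Submodule.Quotient.mk_eq_zero]
  exact Submodule.subset_span (Or.inr ⟨i, j, hj0, hj, ha⟩)

theorem smul_polyV (a : algA K p m) (h : Pn K n) :
    a • polyV K p m h = polyV K p m (toEnd K a h) := by
  rw [polyV_eq_smul, (isKilled_one K p m).smul_polyA K p m a h, ← polyV_eq_smul]

theorem mkQ_eq_polyV (a : algA K p m) :
    (leftIdealJ K p m).mkQ a = polyV K p m (toEnd K a 1) := by
  rw [← smul_polyV, polyV_apply, ← map_smul, map_one, smul_eq_mul, mul_one]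

theorem polyV_surjective : Function.Surjective (polyV K p m) := by
  intro v
  obtain ⟨a, rfl⟩ := (leftIdealJ K p m).mkQ_surjective v
  exact ⟨_, (mkQ_eq_polyV K p m a).symm⟩

/-- This identifies V(m) with `P_n` modulo the extension of z. Evaluation at 1 carries the left
ideal into that extension, which is stable under A(m) because A(m) is linear over the image of
`frob`. -/
theorem polyV_eq_zero_iff (h : Pn K n) :
    polyV K p m h = 0 ↔ h ∈ (zIdeal K p m).map (frob K p (kExp K p m)) := by
  set I := (zIdeal K p m).map (frob K p (kExp K p m)) with hI
  have hgen : ∀ g ∈ zIdeal K p m, frob K p (kExp K p m) g ∈ I := fun g hg =>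
    Ideal.mem_map_of_mem _ hg
  constructor
  · intro h0
    rw [polyV_apply, Submodule.mkQ_apply, Submodule.Quotient.mk_eq_zero] at h0
    have key : ∀ a ∈ leftIdealJ K p m, toEnd K (a : DPn K n) 1 ∈ I := by
      intro a ha
      induction ha using Submodule.span_induction with
      | mem a ha =>
        rcases ha with ⟨h, hh, ha⟩ | ⟨i, j, hj0, hj, ha⟩
        · obtain ⟨g, hg, rfl⟩ := (mem_centralKer K p m).1 hh
          rw [ha, toEnd_ofPoly_apply, mul_one]
          exact hgen g hg
        · rw [ha, toEnd_dop, ← map_one MvPolynomial.C, hasse_single_C K i hj0.ne']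
          exact zero_mem _
      | zero => rw [ZeroMemClass.coe_zero, map_zero]; exact zero_mem _
      | add x y _ _ hx hy =>
        rw [AddMemClass.coe_add, map_add]; exact add_mem hx hy
      | smul b x _ hx =>
        rw [smul_eq_mul, MulMemClass.coe_mul, map_mul, Module.End.mul_apply]
        generalize toEnd K (x : DPn K n) 1 = y at hx
        induction hx using Submodule.span_induction with
        | mem y hy =>
          obtain ⟨g, hg, rfl⟩ := hy
          have := toEnd_box_mul_frob K p (kExp K p m) b.2 1 g
          rw [one_mul] at this
          change toEnd K (b : DPn K n) (frob K p (kExp K p m) g) ∈ I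
          rw [this]
          exact I.mul_mem_left _ (hgen g hg)
        | zero => rw [map_zero]; exact zero_mem _
        | add x y _ _ hx hy => rw [map_add]; exact add_mem hx hy
        | smul c y hy hy' =>
          -- The operator `b` is not linear over a general multiplier `c`, so the induction over the
          -- span is rerun with `c` arbitrary.
          have hy2 : ∀ c : Pn K n, toEnd K (b : DPn K n) (c • y) ∈ I := by
            intro c
            clear hy'
            induction hy using Submodule.span_induction generalizing c with
            | mem y hy =>
              obtain ⟨g, hg, rfl⟩ := hy
              have := toEnd_box_mul_frob K p (kExp K p m) b.2 c g
              change toEnd K (b : DPn K n) (c * frob K p (kExp K p m) g) ∈ I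
              rw [this]
              exact I.mul_mem_left _ (hgen g hg)
            | zero => rw [smul_zero, map_zero]; exact zero_mem _
            | add x y _ _ hx hy => rw [smul_add, map_add]; exact add_mem (hx c) (hy c)
            | smul c' y _ hy => rw [smul_smul]; exact hy _
          exact hy2 c
    have := key _ h0
    rwa [coe_polyA, toEnd_ofPoly_apply, mul_one] at this
  · intro hh
    induction hh using Submodule.span_induction with
    | mem y hy =>
      obtain ⟨g, hg, rfl⟩ := hy
      rw [polyV_apply, Submodule.mkQ_apply, Submodule.Quotient.mk_eq_zero]
      exact Submodule.subset_span (Or.inl ⟨_, (mem_centralKer K p m).2 ⟨g, hg, rfl⟩, rfl⟩)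
    | zero => exact map_zero _
    | add x y _ _ hx hy => rw [map_add, hx, hy, add_zero]
    | smul c y _ hy => rw [smul_eq_mul, ← polyA_smul_polyV, hy, smul_zero]

omit [CharP K p] [Fact p.Prime] in
theorem map_zIdeal_le : (zIdeal K p m).map (frob K p (kExp K p m)) ≤ m.asIdeal :=
  Ideal.map_comap_le

theorem polyV_frob_eq_zero_iff (g : Pn K n) :
    polyV K p m (frob K p (kExp K p m) g) = 0 ↔ g ∈ zIdeal K p m := by
  rw [polyV_eq_zero_iff]
  exact ⟨fun h => map_zIdeal_le K p m h, fun h => Ideal.mem_map_of_mem _ h⟩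

theorem polyA_frob_smul_eq_zero {g : Pn K n} (hg : g ∈ zIdeal K p m) (v : modV K p m) :
    polyA K p m (frob K p (kExp K p m) g) • v = 0 := by
  obtain ⟨h, rfl⟩ := polyV_surjective K p m v
  rw [polyA_smul_polyV, polyV_eq_zero_iff]
  exact Ideal.mul_mem_right _ _ (Ideal.mem_map_of_mem _ hg)

theorem polyV_one_ne_zero : polyV K p m 1 ≠ 0 := by
  rw [← map_one (frob K p (kExp K p m)), Ne, polyV_frob_eq_zero_iff]
  exact (Ideal.ne_top_iff_one _).1 (Ideal.IsMaximal.ne_top inferInstance)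

/-- The map `(c_γ) ↦ ∑ x^γ c_γ(x^(p^k)) 1`. -/
theorem polyV_box_sum_eq_zero_iff (c : Box p (kExp K p m) → Pn K n) :
    polyV K p m (∑ b, MvPolynomial.monomial b.toIdx 1 * frob K p (kExp K p m) (c b)) = 0 ↔
      ∀ b, c b ∈ zIdeal K p m := by
  constructor
  swap
  · intro h
    rw [map_sum]
    refine Finset.sum_eq_zero fun b _ => ?_
    rw [← polyA_smul_polyV, (polyV_frob_eq_zero_iff K p m _).2 (h b), smul_zero]
  · classical
    intro h0
    by_contra! hc
    obtain ⟨b₁, hb₁⟩ := hc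
    obtain ⟨b₀, h1, h2⟩ := Finset.exists_max_image
      (Finset.univ.filter fun b => c b ∉ zIdeal K p m) (fun b => ∑ i, b.toIdx i)
      ⟨b₁, by simpa using hb₁⟩
    rw [Finset.mem_filter] at h1
    -- Dropping the coefficients in z does not change the image in V(m), and makes the top degree
    -- occur at a coefficient outside z, which ∂^[b₀] then extracts.
    set c' : Box p (kExp K p m) → Pn K n := fun b => if c b ∈ zIdeal K p m then 0 else c b with hc'
    have e : polyV K p m (∑ b, MvPolynomial.monomial b.toIdx 1 * frob K p (kExp K p m) (c' b)) =
        0 := by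
      rw [← h0, map_sum, map_sum]
      refine Finset.sum_congr rfl fun b _ => ?_
      by_cases hb : c b ∈ zIdeal K p m
      · rw [← polyA_smul_polyV, ← polyA_smul_polyV, (polyV_frob_eq_zero_iff K p m _).2 hb]
        simp [hc', hb]
      · simp [hc', hb]
    have e2 := congrArg (fun v => dopA K p m b₀.toIdx (Box.toIdx_lt p _ b₀) • v) e
    simp only [smul_zero, smul_polyV] at e2
    change polyV K p m (toEnd K (dop K b₀.toIdx) _) = 0 at e2
    rw [toEnd_dop_box_sum K p _ c' b₀, polyV_frob_eq_zero_iff] at e2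
    · simp only [hc', if_neg h1.2] at e2
      exact h1.2 e2
    · intro b hb
      refine h2 b ?_
      rw [Finset.mem_filter]
      refine ⟨Finset.mem_univ _, fun h => hb ?_⟩
      simp [hc', h]

/-- The killed vectors are Γ(m)·1: if the top-degree index of a normalised representative were
nonzero, its divided power would extract a coefficient outside z instead of giving zero. -/
theorem exists_of_isKilled {v : modV K p m} (hv : IsKilled K p m v) :
    ∃ g, v = polyV K p m (frob K p (kExp K p m) g) := by
  classical
  obtain ⟨h, rfl⟩ := polyV_surjective K p m v
  obtain ⟨c, rfl⟩ := exists_box_sum K p (kExp K p m) h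
  set c' : Box p (kExp K p m) → Pn K n := fun b => if c b ∈ zIdeal K p m then 0 else c b with hc'
  have e : polyV K p m (∑ b, MvPolynomial.monomial b.toIdx 1 * frob K p (kExp K p m) (c b)) =
      polyV K p m (∑ b, MvPolynomial.monomial b.toIdx 1 * frob K p (kExp K p m) (c' b)) := by
    rw [← sub_eq_zero, ← map_sub, ← Finset.sum_sub_distrib]
    simp only [← mul_sub, ← map_sub]
    rw [polyV_box_sum_eq_zero_iff]
    intro b
    by_cases hb : c b ∈ zIdeal K p m <;> simp [hc', hb]
  rw [e] at hv ⊢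
  -- Once the top index is zero, ∂^[0] = 1, so the extraction formula shows that the whole sum is
  -- its constant coefficient.
  by_cases hne : ∃ b, c' b ≠ 0
  · obtain ⟨b₁, hb₁⟩ := hne
    obtain ⟨b₀, h1, h2⟩ := Finset.exists_max_image
      (Finset.univ.filter fun b => c' b ≠ 0) (fun b => ∑ i, b.toIdx i) ⟨b₁, by simpa using hb₁⟩
    have h1' : c' b₀ ≠ 0 := (Finset.mem_filter.1 h1).2
    have h1'' : c b₀ ∉ zIdeal K p m := fun h => h1' (by simp [hc', h])
    have h2' : ∀ b, c' b ≠ 0 → ∑ i, b.toIdx i ≤ ∑ i, b₀.toIdx i := fun b hb =>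
      h2 b (by simpa using hb)
    have e3 := toEnd_dop_box_sum K p _ c' b₀ h2'
    have h00 : b₀.toIdx = 0 := by
      by_contra h0
      have e2 := hv.dop_smul_eq_zero K p m (Box.toIdx_lt p _ b₀) h0
      rw [smul_polyV] at e2
      change polyV K p m (toEnd K (dop K b₀.toIdx) _) = 0 at e2
      rw [e3, polyV_frob_eq_zero_iff] at e2
      simp only [hc', if_neg h1''] at e2
      exact h1'' e2
    refine ⟨c' b₀, ?_⟩
    rw [← e3, h00, dop_zero, map_one, Module.End.one_apply]
  · push Not at hne
    exact ⟨0, by simp [hne]⟩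

theorem exists_inverse_mod {g : Pn K n} (hg : g ∉ zIdeal K p m) :
    ∃ g', g' * g - 1 ∈ zIdeal K p m := by
  obtain ⟨y, i, hi, h⟩ := Ideal.IsMaximal.exists_inv (I := zIdeal K p m) inferInstance hg
  refine ⟨y, ?_⟩
  rw [← h]
  simpa using hi

/-- A nonzero submodule of `V(m)` contains the generator. -/
theorem one_mem_of_mem (S : Submodule (algA K p m) (modV K p m)) {v : modV K p m} (hv : v ∈ S)
    (h0 : v ≠ 0) : polyV K p m 1 ∈ S := by
  obtain ⟨a, ha, hk⟩ := exists_isKilled K p m h0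
  obtain ⟨g, hg⟩ := exists_of_isKilled K p m hk
  have haS : a • v ∈ S := S.smul_mem a hv
  rw [hg] at ha haS
  rw [Ne, polyV_frob_eq_zero_iff] at ha
  obtain ⟨g', hg'⟩ := exists_inverse_mod K p m ha
  have h1 := S.smul_mem (polyA K p m (frob K p (kExp K p m) g')) haS
  rw [polyA_smul_polyV, ← map_mul] at h1
  have h2 := (polyV_frob_eq_zero_iff K p m _).2 hg'
  rw [map_sub, map_sub, sub_eq_zero, map_one] at h2
  rwa [h2] at h1

theorem span_one_eq_top (S : Submodule (algA K p m) (modV K p m)) (h : polyV K p m 1 ∈ S) :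
    S = ⊤ := by
  rw [eq_top_iff]
  rintro v -
  obtain ⟨h', rfl⟩ := polyV_surjective K p m v
  rw [polyV_eq_smul]
  exact S.smul_mem _ h

theorem isSimpleModule_modV : IsSimpleModule (algA K p m) (modV K p m) where
  exists_pair_ne := by
    refine ⟨⊥, ⊤, fun h => polyV_one_ne_zero K p m ?_⟩
    have : polyV K p m 1 ∈ (⊤ : Submodule (algA K p m) (modV K p m)) := trivial
    rwa [← h, Submodule.mem_bot] at this
  eq_bot_or_eq_top S := by
    by_cases h : S = ⊥
    · exact Or.inl h
    · obtain ⟨v, hv, h0⟩ := (Submodule.ne_bot_iff S).1 h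
      exact Or.inr (span_one_eq_top K p m S (one_mem_of_mem K p m S hv h0))

theorem liftV_one {W : Type*} [AddCommGroup W] [Module (algA K p m) W] (w : W)
    (hw : IsKilled K p m w)
    (hz : ∀ g ∈ zIdeal K p m, polyA K p m (frob K p (kExp K p m) g) • w = 0) :
    liftV K p m w hw hz (polyV K p m 1) = w := by
  rw [polyV_apply, map_one, liftV, Submodule.mkQ_apply, Submodule.liftQ_apply,
    LinearMap.toSpanSingleton_apply, one_smul]

/-- A simple `A(m)`-module annihilated by the kernel is isomorphic to `V(m)`. -/
theorem nonempty_equiv_modV (W : Type*) [AddCommGroup W] [Module (algA K p m) W]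
    (hW : IsSimpleModule (algA K p m) W)
    (hz : ∀ h ∈ centralKer K p m, ∀ a : algA K p m, (a : DPn K n) = ofPoly K h →
      ∀ w : W, a • w = 0) : Nonempty (W ≃ₗ[algA K p m] modV K p m) := by
  have := isSimpleModule_modV K p m
  have : Nontrivial W := IsSimpleModule.nontrivial (algA K p m) W
  obtain ⟨w, hw⟩ := exists_ne (0 : W)
  obtain ⟨a, ha, hk⟩ := exists_isKilled K p m hw
  have hz' : ∀ g ∈ zIdeal K p m, polyA K p m (frob K p (kExp K p m) g) • a • w = 0 :=
    fun g hg => hz _ ((mem_centralKer K p m).2 ⟨g, hg, rfl⟩) _ rfl _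
  have hne : liftV K p m (a • w) hk hz' ≠ 0 := by
    intro h0
    have := liftV_one K p m (a • w) hk hz'
    rw [h0, LinearMap.zero_apply] at this
    exact ha this.symm
  exact ⟨(LinearEquiv.ofBijective _ (LinearMap.bijective_of_ne_zero hne)).symm⟩

/-- `V(m)` as a vector space: one copy of `Γ(m)` for each monomial in the box. -/
def boxEquivModV :
    (Box p (kExp K p m) → Pn K n ⧸ zIdeal K p m) ≃ₗ[K] modV K p m := by
  let Φ : (Box p (kExp K p m) → Pn K n) →ₗ[K] modV K p m :=
    polyV K p m ∘ₗ ∑ b, LinearMap.mulLeft K (MvPolynomial.monomial b.toIdx (1 : K)) ∘ₗ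
      (frob K p (kExp K p m)).toLinearMap ∘ₗ LinearMap.proj b
  let Ψ : (Box p (kExp K p m) → Pn K n) →ₗ[K] (Box p (kExp K p m) → Pn K n ⧸ zIdeal K p m) :=
    LinearMap.pi fun b => (Ideal.Quotient.mkₐ K (zIdeal K p m)).toLinearMap ∘ₗ LinearMap.proj b
  have hΦ : ∀ c, Φ c =
      polyV K p m (∑ b, MvPolynomial.monomial b.toIdx 1 * frob K p (kExp K p m) (c b)) := by
    intro c
    simp [Φ]
  -- Both maps kill exactly the families with all coefficients in z, so the two quotients of the
  -- space of families agree.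
  have hker : LinearMap.ker Ψ = LinearMap.ker Φ := by
    ext c
    rw [LinearMap.mem_ker, LinearMap.mem_ker, hΦ, polyV_box_sum_eq_zero_iff, funext_iff]
    exact forall_congr' fun b => Ideal.Quotient.eq_zero_iff_mem
  have hΨs : Function.Surjective Ψ := by
    intro c
    choose d hd using fun b => Ideal.Quotient.mk_surjective (c b)
    exact ⟨d, funext hd⟩
  have hΦs : Function.Surjective Φ := by
    intro v
    obtain ⟨h, rfl⟩ := polyV_surjective K p m v
    obtain ⟨c, rfl⟩ := exists_box_sum K p (kExp K p m) h
    exact ⟨c, hΦ c⟩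
  exact (Ψ.quotKerEquivOfSurjective hΨs).symm ≪≫ₗ Submodule.quotEquivOfEq _ _ hker ≪≫ₗ
    Φ.quotKerEquivOfSurjective hΦs

instance : FiniteDimensional K (Pn K n ⧸ zIdeal K p m) :=
  letI := Ideal.Quotient.field (zIdeal K p m)
  finite_of_finite_type_of_isJacobsonRing K _

instance : FiniteDimensional K (modV K p m) :=
  Module.Finite.equiv (boxEquivModV K p m)

theorem finrank_modV : Module.finrank K (modV K p m) =
    p ^ (∑ i, kExp K p m i) * Module.finrank K (Pn K n ⧸ zIdeal K p m) := by
  rw [← (boxEquivModV K p m).finrank_eq, Module.finrank_pi_fintype, Finset.sum_const,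
    Finset.card_univ, Box.card, smul_eq_mul]

end ModV


/-! ### The separable part of the residue field -/

section Residue

/-- For separable `t` one has K(t) = K(t^(p^s)), and K(t^(p^s)) consists of polynomials in t^(p^s)
by algebraicity. -/
theorem exists_aeval_pow_of_isSeparable {K L : Type*} [Field K] [Field L] [Algebra K L] (p : ℕ)
    [Fact p.Prime] [CharP K p] {t : L} (ht : IsSeparable K t) (s : ℕ) :
    ∃ r : Polynomial K, Polynomial.aeval (t ^ p ^ s) r = t := by
  have : ExpChar K p := ExpChar.prime Fact.out
  have h1 := IntermediateField.adjoin_simple_eq_adjoin_pow_expChar_pow_of_isSeparable K L ht p s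
  have h2 : t ∈ IntermediateField.adjoin K {t ^ p ^ s} := by
    rw [← h1]; exact IntermediateField.mem_adjoin_simple_self K t
  rw [← IntermediateField.mem_toSubalgebra,
    IntermediateField.adjoin_simple_toSubalgebra_of_isAlgebraic (ht.isIntegral.pow _).isAlgebraic,
    Algebra.adjoin_singleton_eq_range_aeval] at h2
  exact h2

variable (K : Type u) [Field K] {n : ℕ} (p : ℕ) [Fact p.Prime] [CharP K p]

/-- The p^s-th power map is additive and turns x_i into a power of x_i^(p^k_i) as soon as s ≥ k_i;
constants lie in the image of `frob` anyway. -/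
theorem exists_pow_eq_frob (k : Fin n → ℕ) (s : ℕ) (hs : ∀ i, k i ≤ s) (h : Pn K n) :
    ∃ g, h ^ p ^ s = frob K p k g := by
  induction h using MvPolynomial.induction_on with
  | C c =>
    refine ⟨MvPolynomial.C (c ^ p ^ s), ?_⟩
    rw [← map_pow, ← MvPolynomial.algebraMap_eq, AlgHom.commutes]
  | add a b ha hb =>
    obtain ⟨g, hg⟩ := ha
    obtain ⟨g', hg'⟩ := hb
    exact ⟨g + g', by rw [add_pow_char_pow, hg, hg', map_add]⟩
  | mul_X a i ha =>
    obtain ⟨g, hg⟩ := ha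
    refine ⟨g * MvPolynomial.X i ^ p ^ (s - k i), ?_⟩
    rw [mul_pow, hg, map_mul, map_pow, frob_X, ← pow_mul, ← pow_add, Nat.add_sub_cancel' (hs i)]

variable (m : MaximalSpectrum (Pn K n))

/-- The evaluation of `h(x_1 ^ p ^ k_1, …)` in the residue field. -/
def residueFrob : Pn K n →ₐ[K] Pn K n ⧸ m.asIdeal :=
  (Ideal.Quotient.mkₐ K m.asIdeal).comp (frob K p (kExp K p m))

theorem gPoly_kExp (i : Fin n) : ∃ f : Polynomial K, f.Separable ∧
    gPoly K m i = Polynomial.expand K (p ^ kExp K p m i) f := by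
  letI := Ideal.Quotient.field m.asIdeal
  have : FiniteDimensional K (Pn K n ⧸ m.asIdeal) := finite_of_finite_type_of_isJacobsonRing K _
  have : ExpChar K p := ExpChar.prime Fact.out
  have h1 : Irreducible (gPoly K m i) := minpoly.irreducible (Algebra.IsIntegral.isIntegral _)
  obtain ⟨f, hf, s, hs⟩ := h1.hasSeparableContraction p
  exact Nat.sInf_mem (s := {k | ∃ f : Polynomial K, f.Separable ∧
    gPoly K m i = Polynomial.expand K (p ^ k) f}) ⟨s, f, hf, hs.symm⟩

/-- The class of x_i^(p^k_i) is a root of the separable polynomial f_i. -/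
theorem isSeparable_residueFrob_X (i : Fin n) :
    IsSeparable K (residueFrob K p m (MvPolynomial.X i)) := by
  obtain ⟨f, hf, he⟩ := gPoly_kExp K p m i
  refine hf.of_dvd (minpoly.dvd _ _ ?_)
  have h1 := minpoly.aeval K (Ideal.Quotient.mk m.asIdeal (MvPolynomial.X i))
  change Polynomial.aeval _ (gPoly K m i) = 0 at h1
  rw [he, Polynomial.expand_aeval] at h1
  rw [residueFrob, AlgHom.comp_apply, frob_X, map_pow]
  exact h1

theorem residueFrob_eq_zero_iff (h : Pn K n) : residueFrob K p m h = 0 ↔ h ∈ zIdeal K p m :=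
  Ideal.Quotient.eq_zero_iff_mem

/-- The generators of the range are separable. Conversely a separable y is a polynomial in y^(p^s),
and for s at least all k_i this power is in the range by `exists_pow_eq_frob`. -/
theorem residueFrob_range : (residueFrob K p m).range = residueSep K m := by
  letI := Ideal.Quotient.field m.asIdeal
  apply le_antisymm
  · rintro _ ⟨h, rfl⟩
    change residueFrob K p m h ∈ residueSep K m
    induction h using MvPolynomial.induction_on with
    | C c => rw [← MvPolynomial.algebraMap_eq, AlgHom.commutes]; exact Subalgebra.algebraMap_mem _ c
    | add a b ha hb => rw [map_add]; exact add_mem ha hb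
    | mul_X a i ha =>
      rw [map_mul]
      refine mul_mem ha ?_
      exact mem_separableClosure_iff.2 (isSeparable_residueFrob_X K p m i)
  · intro y hy
    have hy' : IsSeparable K y := mem_separableClosure_iff.1 hy
    set s := Finset.univ.sup (kExp K p m)
    obtain ⟨r, hr⟩ := exists_aeval_pow_of_isSeparable p hy' s
    obtain ⟨h, rfl⟩ := Ideal.Quotient.mk_surjective y
    obtain ⟨g, hg⟩ := exists_pow_eq_frob K p (kExp K p m) s
      (fun i => Finset.le_sup (Finset.mem_univ i)) h
    rw [← hr, ← map_pow, hg]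
    refine ⟨Polynomial.aeval g r, ?_⟩
    change residueFrob K p m _ = _
    rw [← Polynomial.aeval_algHom_apply]
    rfl

/-- `Γ(m)` is the separable part of the residue field. -/
def residueSepEquiv : (Pn K n ⧸ zIdeal K p m) ≃ₐ[K] residueSep K m :=
  (Ideal.quotientEquivAlgOfEq K (Ideal.ext fun h =>
    (residueFrob_eq_zero_iff K p m h).symm.trans RingHom.mem_ker.symm)).trans <|
    (Ideal.quotientKerEquivRange (residueFrob K p m)).trans <|
      Subalgebra.equivOfEq _ _ (residueFrob_range K p m)

/-- Separability in Γ(m): the generator y_i can be recovered from y_i^(p^s) for every s. This is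
what turns right multiplications locally into left ones. -/
theorem exists_X_sub_aeval_mem (i : Fin n) (s : ℕ) :
    ∃ r : Polynomial K, MvPolynomial.X i - Polynomial.aeval (MvPolynomial.X i ^ p ^ s) r ∈
      zIdeal K p m := by
  letI := Ideal.Quotient.field m.asIdeal
  obtain ⟨r, hr⟩ := exists_aeval_pow_of_isSeparable p (isSeparable_residueFrob_X K p m i) s
  refine ⟨r, (residueFrob_eq_zero_iff K p m _).1 ?_⟩
  rw [map_sub, ← Polynomial.aeval_algHom_apply, map_pow, sub_eq_zero]
  exact hr.symm

theorem finrank_quotient_zIdeal :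
    Module.finrank K (Pn K n ⧸ zIdeal K p m) = Module.finrank K (residueSep K m) :=
  (residueSepEquiv K p m).toLinearEquiv.finrank_eq

instance : FiniteDimensional K (residueSep K m) :=
  letI := Ideal.Quotient.field m.asIdeal
  have : FiniteDimensional K (Pn K n ⧸ m.asIdeal) := finite_of_finite_type_of_isJacobsonRing K _
  FiniteDimensional.finiteDimensional_subalgebra _

end Residue


/-! ### Induced modules -/

section InducedLemmas

variable {K : Type u} [Field K] {D : Type*} [Ring D] [Algebra K D] (A : Subalgebra K D)
  (V : Type*) [AddCommGroup V] [Module K V] [Module A V]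

theorem Induced.tmul_mul_smul (d : D) (a : A) (v : V) :
    Induced.tmul A V (d * a) v = Induced.tmul A V d (a • v) := by
  rw [← sub_eq_zero]
  exact (Submodule.Quotient.mk_eq_zero _).2 (Submodule.subset_span ⟨d, a, v, rfl⟩)

theorem Induced.smul_tmul (d d' : D) (v : V) :
    d • Induced.tmul A V d' v = Induced.tmul A V (d * d') v := rfl

theorem Induced.tmul_eq_smul (d : D) (v : V) :
    Induced.tmul A V d v = d • Induced.tmul A V 1 v := by
  rw [Induced.smul_tmul, mul_one]

variable {A V}

theorem Induced.induction {C : Induced A V → Prop} (h0 : C 0)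
    (hadd : ∀ x y, C x → C y → C (x + y)) (ht : ∀ d v, C (Induced.tmul A V d v))
    (x : Induced A V) : C x := by
  obtain ⟨t, rfl⟩ := Submodule.Quotient.mk_surjective _ x
  induction t using TensorProduct.induction_on with
  | zero => exact h0
  | tmul d v => exact ht d v
  | add x y hx hy => exact hadd _ _ hx hy

/-- The universal property of the induced module. -/
def Induced.lift {M : Type*} [AddCommGroup M] [Module K M] [Module D M] [IsScalarTower K D M]
    (ψ : V →ₗ[K] M) (hψ : ∀ (a : A) v, ψ (a • v) = (a : D) • ψ v) : Induced A V →ₗ[D] M :=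
  (balancing A V).liftQ
    (TensorProduct.AlgebraTensorModule.lift (LinearMap.toSpanSingleton D (V →ₗ[K] M) ψ)) (by
      rw [balancing, Submodule.span_le]
      rintro _ ⟨d, a, v, rfl⟩
      simp [hψ, mul_smul])

theorem Induced.lift_tmul {M : Type*} [AddCommGroup M] [Module K M] [Module D M]
    [IsScalarTower K D M] (ψ : V →ₗ[K] M) (hψ : ∀ (a : A) v, ψ (a • v) = (a : D) • ψ v)
    (d : D) (v : V) : Induced.lift ψ hψ (Induced.tmul A V d v) = d • ψ v := by
  change TensorProduct.AlgebraTensorModule.lift (LinearMap.toSpanSingleton D (V →ₗ[K] M) ψ)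
    (d ⊗ₜ[K] v) = _
  simp

theorem Induced.hom_ext {M : Type*} [AddCommGroup M] [Module D M] {f g : Induced A V →ₗ[D] M}
    (h : ∀ v, f (Induced.tmul A V 1 v) = g (Induced.tmul A V 1 v)) : f = g := by
  refine LinearMap.ext fun x => ?_
  induction x using Induced.induction with
  | h0 => rw [map_zero, map_zero]
  | hadd x y hx hy => rw [map_add, map_add, hx, hy]
  | ht d v => rw [Induced.tmul_eq_smul, map_smul, map_smul, h]

/-- A retraction of `D` onto `A` as a right `A`-module makes `V` a subspace of `D ⊗_A V`. -/
theorem Induced.tmul_one_injective (c : D →ₗ[K] A) (hc : ∀ d (a : A), c (d * a) = c d * a)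
    (hc1 : c 1 = 1) [IsScalarTower K A V] : Function.Injective (Induced.tmul A V 1) := by
  let F : D ⊗[K] V →ₗ[K] V := TensorProduct.lift ((Algebra.lsmul K K V).toLinearMap ∘ₗ c)
  have hF : ∀ d v, F (d ⊗ₜ v) = c d • v := fun d v => by simp [F]
  -- `F` is not `D`-linear, so the claim is made for all left multiples of `t` to survive the
  -- `D`-span.
  have key : ∀ t ∈ balancing A V, ∀ d : D, F (d • t) = 0 := by
    intro t ht
    induction ht using Submodule.span_induction with
    | mem t ht =>
      obtain ⟨d, a, v, rfl⟩ := ht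
      intro d'
      rw [smul_sub, map_sub, TensorProduct.smul_tmul', TensorProduct.smul_tmul', hF, hF, smul_eq_mul,
        smul_eq_mul, ← mul_assoc, hc, mul_smul, sub_self]
    | zero => intro d; rw [smul_zero, map_zero]
    | add x y _ _ hx hy => intro d; rw [smul_add, map_add, hx, hy, add_zero]
    | smul d' x _ hx => intro d; rw [smul_smul]; exact hx _
  rw [injective_iff_map_eq_zero]
  intro v hv
  have h1 : (1 : D) ⊗ₜ[K] v ∈ balancing A V := (Submodule.Quotient.mk_eq_zero _).1 hv
  have h2 := key _ h1 1
  rwa [one_smul, hF, hc1, one_smul] at h2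

end InducedLemmas

/-! Shortcuts for instance resolution. -/

local instance {K : Type u} [Field K] {n : ℕ} (p : ℕ) (m : MaximalSpectrum (Pn K n)) :
    AddCommGroup (modU K p m) := inferInstance

local instance {K : Type u} [Field K] {n : ℕ} (p : ℕ) (m : MaximalSpectrum (Pn K n)) :
    AddCommMonoid (modU K p m) := inferInstance

local instance {K : Type u} [Field K] {n : ℕ} (p : ℕ) (m : MaximalSpectrum (Pn K n)) :
    Module (DPn K n) (modU K p m) := inferInstance

local instance {K : Type u} [Field K] {n : ℕ} (p : ℕ) (m : MaximalSpectrum (Pn K n)) :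
    Module K (modU K p m) := inferInstance

local instance {K : Type u} [Field K] {n : ℕ} (p : ℕ) (m : MaximalSpectrum (Pn K n)) :
    IsScalarTower K (DPn K n) (modU K p m) := inferInstance

/-! ### The generator of U(m) and right multiplication by central elements -/

section ModU

variable (K : Type u) [Field K] {n : ℕ} (p : ℕ) [Fact p.Prime] [CharP K p]
  (m : MaximalSpectrum (Pn K n))

/-- The element `d ⊗ v` of `U(m)`. -/
abbrev tmulU : DPn K n →ₗ[K] modV K p m →ₗ[K] modU K p m := Induced.tmul (algA K p m) (modV K p m)

/-- The retraction of `D(P_n)` onto `A(m)` that extracts the coefficient of `1`. -/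
def retractA : DPn K n →ₗ[K] algA K p m :=
  (Finsupp.lapply 0 : ((Fin n →₀ ℕ) →₀ boxAlg K p (kExp K p m)) →ₗ[K] _) ∘ₗ
    (boxCoord K p (kExp K p m)).toLinearMap

theorem retractA_one : retractA K p m 1 = 1 := by
  change boxCoord K p (kExp K p m) 1 0 = (1 : boxAlg K p (kExp K p m))
  have := boxCoord_coe K p (kExp K p m) 1
  rw [OneMemClass.coe_one] at this
  rw [this, Finsupp.single_eq_same]

theorem tmulU_one_injective : Function.Injective (tmulU K p m 1) :=
  Induced.tmul_one_injective (retractA K p m)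
    (fun d a => boxCoord_mul K p (kExp K p m) d a 0) (retractA_one K p m)

theorem coe_smul_tmulU_one (a : algA K p m) (v : modV K p m) :
    (a : DPn K n) • tmulU K p m 1 v = tmulU K p m 1 (a • v) := by
  rw [← Induced.tmul_eq_smul, ← Induced.tmul_mul_smul, one_mul]

theorem tmulU_mul (d : DPn K n) (a : algA K p m) (v : modV K p m) :
    tmulU K p m (d * a) v = tmulU K p m d (a • v) := Induced.tmul_mul_smul _ _ d a v

/-- The generator of `U(m)`. -/
def oneU : modU K p m := tmulU K p m 1 (polyV K p m 1)

theorem oneU_ne_zero : oneU K p m ≠ 0 := fun h =>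
  polyV_one_ne_zero K p m (tmulU_one_injective K p m (h.trans (map_zero _).symm))

theorem tmulU_eq_smul_oneU (d : DPn K n) (a : algA K p m) :
    tmulU K p m d (a • polyV K p m 1) = (d * a) • oneU K p m := by
  rw [← tmulU_mul, oneU, Induced.tmul_eq_smul]

theorem exists_smul_oneU (u : modU K p m) : ∃ d : DPn K n, u = d • oneU K p m := by
  induction u using Induced.induction with
  | h0 => exact ⟨0, (zero_smul _ _).symm⟩
  | hadd x y hx hy =>
    obtain ⟨d, rfl⟩ := hx
    obtain ⟨e, rfl⟩ := hy
    exact ⟨d + e, (add_smul _ _ _).symm⟩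
  | ht d v =>
    obtain ⟨h, rfl⟩ := polyV_surjective K p m v
    rw [polyV_eq_smul]
    exact ⟨_, tmulU_eq_smul_oneU K p m d _⟩

/-- The right multiplication by `h(x_1 ^ p ^ k_1, …)`, an endomorphism of `U(m)`. -/
def rightMul (h : Pn K n) : Module.End (DPn K n) (modU K p m) :=
  Induced.lift
    (tmulU K p m 1 ∘ₗ Algebra.lsmul K K (modV K p m) (polyA K p m (frob K p (kExp K p m) h)))
    (by
      intro a v
      change tmulU K p m 1 (polyA K p m _ • a • v) = (a : DPn K n) • tmulU K p m 1 (polyA K p m _ • v)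
      rw [coe_smul_tmulU_one, smul_smul, smul_smul, polyA_frob_commute])

theorem rightMul_tmul (h : Pn K n) (d : DPn K n) (v : modV K p m) :
    rightMul K p m h (tmulU K p m d v) =
      tmulU K p m d (polyA K p m (frob K p (kExp K p m) h) • v) := by
  rw [rightMul, Induced.lift_tmul, LinearMap.comp_apply, Algebra.lsmul_coe, ← Induced.tmul_eq_smul]

end ModU


/-! ### Right multiplications as an algebra action, and the structure of U(m) -/

section ModU

variable (K : Type u) [Field K] {n : ℕ} (p : ℕ) [Fact p.Prime] [CharP K p]
  (m : MaximalSpectrum (Pn K n))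

theorem polyA_frob_algebraMap_smul (c : K) (v : modV K p m) :
    polyA K p m (frob K p (kExp K p m) (algebraMap K _ c)) • v = c • v := by
  have : polyA K p m (frob K p (kExp K p m) (algebraMap K _ c)) = algebraMap K (algA K p m) c := by
    rw [AlgHom.commutes (frob K p _), AlgHom.commutes (polyA K p m)]
  rw [this]
  exact algebraMap_smul (algA K p m) c v

theorem rightMul_algebraMap (c : K) :
    rightMul K p m (algebraMap K _ c) = algebraMap K (Module.End (DPn K n) (modU K p m)) c := by
  refine Induced.hom_ext fun v => ?_
  refine (rightMul_tmul K p m _ 1 v).trans ?_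
  refine (congrArg (tmulU K p m 1) (polyA_frob_algebraMap_smul K p m c v)).trans ?_
  refine (LinearMap.map_smul (tmulU K p m 1) c v).trans ?_
  exact (Module.algebraMap_end_apply (R := K) (S := DPn K n) (M := modU K p m) c _).symm


theorem rightMul_mul (a b : Pn K n) :
    rightMul K p m (a * b) = rightMul K p m a * rightMul K p m b := Induced.hom_ext fun v => by
  refine (rightMul_tmul K p m _ 1 v).trans ?_
  refine Eq.trans ?_ (congrArg (rightMul K p m a) (rightMul_tmul K p m b 1 v)).symm
  rw [rightMul_tmul, map_mul (frob K p _), map_mul (polyA K p m), mul_smul]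

theorem rightMul_add (a b : Pn K n) :
    rightMul K p m (a + b) = rightMul K p m a + rightMul K p m b := Induced.hom_ext fun v => by
  refine (rightMul_tmul K p m _ 1 v).trans ?_
  refine Eq.trans ?_ (congrArg₂ (· + ·) (rightMul_tmul K p m a 1 v) (rightMul_tmul K p m b 1 v)).symm
  rw [map_add (frob K p _), map_add (polyA K p m), add_smul, map_add (tmulU K p m 1)]

/-- The action of `P_n` on `U(m)` by right multiplications. -/
def rightMulLin : Pn K n →ₗ[K] Module.End (DPn K n) (modU K p m) where
  toFun := rightMul K p m
  map_add' := rightMul_add K p m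
  map_smul' c h := by
    rw [Algebra.smul_def, rightMul_mul, rightMul_algebraMap, RingHom.id_apply, Algebra.smul_def]

/-- The action of `P_n` on `U(m)` by right multiplications. -/
def rightMulHom : Pn K n →ₐ[K] Module.End (DPn K n) (modU K p m) :=
  AlgHom.ofLinearMap (rightMulLin K p m)
    ((rightMul_algebraMap K p m 1).trans (map_one (algebraMap K _))) (rightMul_mul K p m)

theorem rightMulHom_tmul (h : Pn K n) (d : DPn K n) (v : modV K p m) :
    rightMulHom K p m h (tmulU K p m d v) =
      tmulU K p m d (polyA K p m (frob K p (kExp K p m) h) • v) := rightMul_tmul K p m h d v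

/-- V(m) embeds as 1 ⊗ V(m), so the action is tested on the generator; there only z acts by zero. -/
theorem rightMulHom_eq_zero_iff (h : Pn K n) : rightMulHom K p m h = 0 ↔ h ∈ zIdeal K p m := by
  constructor
  · intro h0
    have h1 := LinearMap.congr_fun h0 (tmulU K p m 1 (polyV K p m 1))
    rw [rightMulHom_tmul, polyA_smul_polyV, mul_one, LinearMap.zero_apply,
      ← map_zero (tmulU K p m 1)] at h1
    exact (polyV_frob_eq_zero_iff K p m h).1 (tmulU_one_injective K p m h1)
  · intro hh
    refine Induced.hom_ext fun v => ?_
    rw [rightMulHom_tmul, polyA_frob_smul_eq_zero K p m hh, map_zero, LinearMap.zero_apply]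

/-! ### Lowering operators on `U(m)` -/

/-- The map `v ↦ ∂^[β p ^ k] ⊗ v`. -/
def dopTmul (β : Fin n →₀ ℕ) : modV K p m →ₗ[K] modU K p m :=
  tmulU K p m (dop K (scale p (kExp K p m) β))

theorem expandU_eq : expandU K p m = Finsupp.lsum K (dopTmul K p m) := rfl

/-- The right multiplication by `y = g(x_1 ^ p ^ k_1, …)` minus the left one. -/
def lowerU (g : Pn K n) : modU K p m →ₗ[K] modU K p m :=
  (rightMulHom K p m g).restrictScalars K -
    Algebra.lsmul K K (modU K p m) (ofPoly K (frob K p (kExp K p m) g))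

theorem lowerU_apply (g : Pn K n) (u : modU K p m) :
    lowerU K p m g u = rightMulHom K p m g u - ofPoly K (frob K p (kExp K p m) g) • u := rfl

/-- A central element can be moved across the tensor sign, so right minus left multiplication is the
commutator in the first factor. -/
theorem lowerU_tmul (g : Pn K n) (d : DPn K n) (v : modV K p m) :
    lowerU K p m g (tmulU K p m d v) =
      tmulU K p m (ad K (ofPoly K (frob K p (kExp K p m) g)) d) v := by
  rw [lowerU_apply, rightMulHom_tmul, ← tmulU_mul, Induced.smul_tmul, ad_apply,
    map_sub (tmulU K p m), LinearMap.sub_apply, coe_polyA]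

theorem isLowering_dopTmul :
    IsLowering (dopTmul K p m) fun i => lowerU K p m (MvPolynomial.X i) where
  succ i β v := by
    rw [dopTmul, lowerU_tmul, ad_frob_X_scale_add]
    rfl
  zero i β v h0 := by
    rw [dopTmul, lowerU_tmul, ad_frob_X_scale_zero K p _ i β h0, map_zero, LinearMap.zero_apply]

theorem dopTmul_zero : dopTmul K p m 0 = tmulU K p m 1 := by
  rw [dopTmul, scale_zero, dop_zero]

/-- Injectivity is the lowering argument. For surjectivity, expand the first factor over A(m) and
move the coefficients into V(m). -/
theorem expandU_bijective : Function.Bijective (expandU K p m) := by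
  constructor
  · rw [expandU_eq]
    refine (isLowering_dopTmul K p m).injective ?_
    rw [dopTmul_zero]
    exact tmulU_one_injective K p m
  · intro u
    change u ∈ LinearMap.range _
    induction u using Induced.induction with
    | h0 => exact zero_mem _
    | hadd x y hx hy => exact add_mem hx hy
    | ht d v =>
      induction d using box_induction K p (kExp K p m) with
      | h0 => rw [map_zero, LinearMap.zero_apply]; exact zero_mem _
      | hadd x y hx hy => rw [map_add, LinearMap.add_apply]; exact add_mem hx hy
      | hd β a =>
        refine ⟨Finsupp.single β ((show algA K p m from a) • v), ?_⟩
        rw [expandU_eq, Finsupp.lsum_single]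
        exact (tmulU_mul K p m _ _ v).symm

/-- Local nilpotency: each application lowers the i-th index by one, and an element involves
finitely many indices. -/
theorem exists_lowerU_pow_eq_zero (i : Fin n) (u : modU K p m) :
    ∃ N, ∀ N' ≥ N, (lowerU K p m (MvPolynomial.X i) ^ N') u = 0 := by
  have h := isLowering_dopTmul K p m
  have key : ∀ (N : ℕ) (β : Fin n →₀ ℕ) v, β i < N →
      (lowerU K p m (MvPolynomial.X i) ^ N) (dopTmul K p m β v) = 0 := by
    intro N
    induction N with
    | zero => intro β v h; omega
    | succ N ih =>
      intro β v hβ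
      rw [pow_succ, Module.End.mul_apply]
      by_cases h0 : β i = 0
      · rw [h.zero i β v h0, map_zero]
      · have h1 := h.succ i (β - Finsupp.single i 1) v
        rw [sub_single_add_single (Nat.one_le_iff_ne_zero.2 h0)] at h1
        rw [h1]
        refine ih _ _ ?_
        simp
        omega
  obtain ⟨f, rfl⟩ := (expandU_bijective K p m).2 u
  rw [expandU_eq, Finsupp.lsum_apply]
  refine Finset.sum_induction _ (fun u => ∃ N, ∀ N' ≥ N,
    (lowerU K p m (MvPolynomial.X i) ^ N') u = 0) ?_ ⟨0, fun _ _ => map_zero _⟩ ?_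
  · rintro x y ⟨N, hx⟩ ⟨M, hy⟩
    refine ⟨max N M, fun N' hN' => ?_⟩
    rw [map_add, hx N' (le_trans (le_max_left _ _) hN'), hy N' (le_trans (le_max_right _ _) hN'),
      add_zero]
  · intro β _
    exact ⟨β i + 1, fun N' hN' => key N' β (f β) (by omega)⟩

/-- Commuting operators that agree on one vector have powers that agree on it; the vector need not
be an eigenvector. -/
theorem aeval_apply_eq_of_apply_eq {W : Type*} [AddCommGroup W] [Module K W] {A B : Module.End K W}
    (hAB : Commute A B) {w : W} (h : A w = B w) (r : Polynomial K) :
    Polynomial.aeval A r w = Polynomial.aeval B r w := by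
  have hpow : ∀ j, (A ^ j) w = (B ^ j) w := by
    intro j
    induction j with
    | zero => simp
    | succ j ih =>
      rw [pow_succ', Module.End.mul_apply, ih, ← Module.End.mul_apply, (hAB.pow_right j).eq,
        Module.End.mul_apply, h, ← Module.End.mul_apply, ← pow_succ]
  induction r using Polynomial.induction_on' with
  | add a b ha hb => rw [map_add, map_add, LinearMap.add_apply, LinearMap.add_apply, ha, hb]
  | monomial j c =>
    rw [Polynomial.aeval_monomial, Polynomial.aeval_monomial, Module.End.mul_apply,
      Module.End.mul_apply, hpow]

/-- Locally, the right multiplications by the `x_i ^ p ^ k_i` are left multiplications by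
polynomials. -/
theorem exists_rightMul_eq_smul (i : Fin n) (s : ℕ) : ∃ h : Pn K n, ∀ u : modU K p m,
    (lowerU K p m (MvPolynomial.X i) ^ p ^ s) u = 0 →
      rightMulHom K p m (MvPolynomial.X i) u = ofPoly K h • u := by
  obtain ⟨r, hr⟩ := exists_X_sub_aeval_mem K p m i s
  set Y : Pn K n := frob K p (kExp K p m) (MvPolynomial.X i)
  refine ⟨Polynomial.aeval (Y ^ p ^ s) r, fun u hu => ?_⟩
  let R : Module.End (DPn K n) (modU K p m) →ₐ[K] Module.End K (modU K p m) :=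
    { toFun := fun f => f.restrictScalars K
      map_one' := rfl
      map_mul' := fun _ _ => rfl
      map_zero' := rfl
      map_add' := fun _ _ => rfl
      commutes' := fun _ => rfl }
  let L : DPn K n →ₐ[K] Module.End K (modU K p m) := Algebra.lsmul K K (modU K p m)
  have hcomm : ∀ f d, Commute (R f) (L d) := by
    intro f d
    refine LinearMap.ext fun x => ?_
    change f (d • x) = d • f x
    rw [map_smul]
  set θ := R (rightMulHom K p m (MvPolynomial.X i)) with hθ
  have : CharP (Module.End K (modU K p m)) p := by
    have : Nontrivial (modU K p m) := ⟨⟨_, _, oneU_ne_zero K p m⟩⟩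
    exact charP_of_injective_algebraMap (algebraMap K (Module.End K (modU K p m))).injective p
  -- Here θ is right multiplication by y_i. The Frobenius identity turns the vanishing of the p^s-th
  -- power of a difference into equality of the p^s-th powers on `u`.
  have h1 : (θ ^ p ^ s) u = (L (ofPoly K Y) ^ p ^ s) u := by
    change ((θ - L (ofPoly K Y)) ^ p ^ s) u = 0 at hu
    rwa [sub_pow_char_pow_of_commute p s (hcomm _ _), LinearMap.sub_apply, sub_eq_zero] at hu
  have h2 := aeval_apply_eq_of_apply_eq K (((hcomm (rightMulHom K p m (MvPolynomial.X i))
    (ofPoly K Y)).pow_pow (p ^ s) (p ^ s))) h1 r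
  -- Right multiplications factor through Γ(m), where y_i = r(y_i^(p^s)) holds.
  have h3 : Polynomial.aeval (θ ^ p ^ s) r = θ := by
    have := (rightMulHom_eq_zero_iff K p m _).2 hr
    rw [map_sub, sub_eq_zero, ← Polynomial.aeval_algHom_apply, map_pow] at this
    rw [hθ, ← map_pow, Polynomial.aeval_algHom_apply, ← this]
  have h4 : Polynomial.aeval (L (ofPoly K Y) ^ p ^ s) r =
      L (ofPoly K (Polynomial.aeval (Y ^ p ^ s) r)) := by
    rw [← map_pow, Polynomial.aeval_algHom_apply, ← ofPolyHom_apply K Y, ← map_pow,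
      Polynomial.aeval_algHom_apply, ofPolyHom_apply]
  rw [h3, h4] at h2
  exact h2

/-- Choosing s beyond the nilpotency index at `u` expresses lowering by a polynomial in D. The
polynomial depends on `u`, which is enough for stability of submodules. -/
theorem exists_lowerU_eq_smul (i : Fin n) (u : modU K p m) :
    ∃ h : Pn K n, lowerU K p m (MvPolynomial.X i) u = ofPoly K h • u := by
  obtain ⟨N, hN⟩ := exists_lowerU_pow_eq_zero K p m i u
  obtain ⟨h, hh⟩ := exists_rightMul_eq_smul K p m i N
  refine ⟨h - frob K p (kExp K p m) (MvPolynomial.X i), ?_⟩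
  rw [lowerU_apply, hh u (hN _ (Nat.lt_pow_self (Fact.out : p.Prime).one_lt).le), ← sub_smul]
  congr 1
  exact (map_sub (ofPolyHom K) _ _).symm

/-- A nonzero `A(m)`-submodule of `U(m)` contains `1 ⊗ V(m)`. -/
theorem tmulU_one_mem (S : Submodule K (modU K p m))
    (hS : ∀ a : algA K p m, ∀ u ∈ S, (a : DPn K n) • u ∈ S) {u : modU K p m} (hu : u ∈ S)
    (h0 : u ≠ 0) (v : modV K p m) : tmulU K p m 1 v ∈ S := by
  obtain ⟨f, rfl⟩ := (expandU_bijective K p m).2 u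
  -- Lowering pushes a nonzero element of `S` into 1 ⊗ V(m), and there simplicity of V(m) finishes.
  obtain ⟨w, hw0, hw⟩ := (isLowering_dopTmul K p m).exists_mem_of_ne_zero S
    (fun i u hu => by
      obtain ⟨h, hh⟩ := exists_lowerU_eq_smul K p m i u
      rw [hh]
      exact hS (polyA K p m h) u hu) f (by rintro rfl; exact h0 (map_zero _)) hu
  rw [dopTmul_zero] at hw
  let T : Submodule (algA K p m) (modV K p m) :=
    { carrier := {v | tmulU K p m 1 v ∈ S}
      add_mem' := fun {a b} ha hb => by
        rw [Set.mem_ofPred_eq, map_add]; exact add_mem ha hb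
      zero_mem' := by rw [Set.mem_ofPred_eq, map_zero]; exact zero_mem _
      smul_mem' := fun a v hv => by
        rw [Set.mem_ofPred_eq, ← coe_smul_tmulU_one]
        exact hS a _ hv }
  have hT : T = ⊤ := span_one_eq_top K p m T (one_mem_of_mem K p m T (v := w) hw hw0)
  have : v ∈ T := by rw [hT]; trivial
  exact this

theorem isSimpleModule_modU : IsSimpleModule (DPn K n) (modU K p m) where
  exists_pair_ne := by
    refine ⟨⊥, ⊤, fun h => oneU_ne_zero K p m ?_⟩
    have : oneU K p m ∈ (⊤ : Submodule (DPn K n) (modU K p m)) := trivial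
    rwa [← h, Submodule.mem_bot] at this
  eq_bot_or_eq_top S := by
    by_cases h : S = ⊥
    · exact Or.inl h
    · obtain ⟨u, hu, h0⟩ := (Submodule.ne_bot_iff S).1 h
      have h1 : oneU K p m ∈ S := tmulU_one_mem K p m (S.restrictScalars K)
        (fun a u hu => S.smul_mem _ hu) hu h0 _
      refine Or.inr (eq_top_iff.2 ?_)
      rintro x -
      obtain ⟨d, rfl⟩ := exists_smul_oneU K p m x
      exact S.smul_mem d h1

/-! ### Endomorphisms of `U(m)` -/

/-- One exponent s serves both `u` and `φ u`, so the same left polynomial represents right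
multiplication on both, and φ commutes with left polynomials. -/
theorem lowerU_comm_end (φ : Module.End (DPn K n) (modU K p m)) (i : Fin n) (u : modU K p m) :
    φ (lowerU K p m (MvPolynomial.X i) u) = lowerU K p m (MvPolynomial.X i) (φ u) := by
  obtain ⟨N, hN⟩ := exists_lowerU_pow_eq_zero K p m i u
  obtain ⟨M, hM⟩ := exists_lowerU_pow_eq_zero K p m i (φ u)
  obtain ⟨h, hh⟩ := exists_rightMul_eq_smul K p m i (max N M)
  have hlt : max N M ≤ p ^ max N M := (Nat.lt_pow_self (Fact.out : p.Prime).one_lt).le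
  rw [lowerU_apply, lowerU_apply, hh u (hN _ ((le_max_left _ _).trans hlt)),
    hh (φ u) (hM _ ((le_max_right _ _).trans hlt)), map_sub, map_smul, map_smul]

/-- The generator is annihilated by all lowering operators, hence so is its image, which must be 1 ⊗
v. The vector v is also killed by the divided powers, so it is in Γ(m)·1, and φ is right
multiplication by the corresponding element. -/
theorem rightMulHom_surjective : Function.Surjective (rightMulHom K p m) := by
  intro φ
  obtain ⟨f, hf⟩ := (expandU_bijective K p m).2 (φ (oneU K p m))
  have hinj : Function.Injective (dopTmul K p m 0) := by
    rw [dopTmul_zero]; exact tmulU_one_injective K p m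
  have h1 := (isLowering_dopTmul K p m).eq_single_of_forall_eq_zero hinj f (fun i => by
    rw [← expandU_eq, hf, ← lowerU_comm_end, oneU, ← dopTmul_zero,
      (isLowering_dopTmul K p m).zero i 0 _ rfl, map_zero])
  have h2 : φ (oneU K p m) = tmulU K p m 1 (f 0) := by
    rw [← hf, h1, expandU_eq, Finsupp.lsum_single, dopTmul_zero]
    simp
  have hk : IsKilled K p m (f 0) := by
    intro i j hj0 hj a ha
    refine tmulU_one_injective K p m ?_
    rw [← coe_smul_tmulU_one, ← h2, ← map_smul, oneU, coe_smul_tmulU_one,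
      isKilled_one K p m i j hj0 hj a ha, map_zero, map_zero]
  obtain ⟨g, hg⟩ := exists_of_isKilled K p m hk
  refine ⟨g, LinearMap.ext fun u => ?_⟩
  obtain ⟨d, rfl⟩ := exists_smul_oneU K p m u
  rw [map_smul, map_smul, h2, oneU, rightMulHom_tmul, polyA_smul_polyV, mul_one, hg]

/-- The endomorphism algebra of `U(m)`. -/
def endEquiv : Module.End (DPn K n) (modU K p m) ≃ₐ[K] residueSep K m :=
  (Ideal.quotientKerAlgEquivOfSurjective (rightMulHom_surjective K p m)).symm.trans <|
    (Ideal.quotientEquivAlgOfEq K (Ideal.ext fun h =>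
      RingHom.mem_ker.trans (rightMulHom_eq_zero_iff K p m h))).trans (residueSepEquiv K p m)

/-! ### Homomorphisms from `U(m)` and finite presentation -/

/-- The homomorphism from `U(m)` defined by a vector annihilated by the generators of the left
ideal. -/
theorem exists_hom_modU {M : Type*} [AddCommGroup M] [Module (DPn K n) M] (w : M)
    (hw : ∀ i j, 0 < j → j < p ^ kExp K p m i → dop K (Finsupp.single i j) • w = 0)
    (hz : ∀ g ∈ zIdeal K p m, ofPoly K (frob K p (kExp K p m) g) • w = 0) :
    ∃ φ : modU K p m →ₗ[DPn K n] M, φ (oneU K p m) = w := by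
  -- The universal property of the induced module needs a K-structure on `M`, taken here from the
  -- action of D.
  letI : Module K M := Module.compHom M (algebraMap K (DPn K n))
  have : IsScalarTower K (DPn K n) M := IsScalarTower.of_algebraMap_smul fun _ _ => rfl
  have hw' : IsKilled K p m w := fun i j h0 h1 a ha => by
    change (a : DPn K n) • w = 0
    rw [ha, hw i j h0 h1]
  let ψ := liftV K p m w hw' hz
  have : IsScalarTower K (algA K p m) M := IsScalarTower.of_algebraMap_smul fun _ _ => rfl
  refine ⟨Induced.lift (ψ.restrictScalars K) (fun a v => ?_), ?_⟩
  · exact map_smul ψ a v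
  · exact (Induced.lift_tmul _ _ _ _).trans ((one_smul _ _).trans (liftV_one K p m w hw' hz))

theorem dop_single_smul_oneU (i : Fin n) (j : ℕ) (h0 : 0 < j) (hj : j < p ^ kExp K p m i) :
    dop K (Finsupp.single i j) • oneU K p m = 0 := by
  have hγ : ∀ l, (Finsupp.single i j : Fin n →₀ ℕ) l < p ^ kExp K p m l := by
    intro l
    by_cases hl : l = i
    · subst hl; simpa using hj
    · simpa [Ne.symm hl] using pow_pos (Fact.out : p.Prime).pos _
  have := coe_smul_tmulU_one K p m (dopA K p m _ hγ) (polyV K p m 1)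
  rw [isKilled_one K p m i j h0 hj _ rfl, map_zero] at this
  exact this

theorem ofPoly_frob_smul_oneU (g : Pn K n) (hg : g ∈ zIdeal K p m) :
    ofPoly K (frob K p (kExp K p m) g) • oneU K p m = 0 := by
  have := coe_smul_tmulU_one K p m (polyA K p m (frob K p (kExp K p m) g)) (polyV K p m 1)
  rw [polyA_frob_smul_eq_zero K p m hg, map_zero] at this
  exact this

/-- The annihilator of the generator is generated by finitely many generators of z and the finitely
many ∂_i^[j] with 0 < j < p^k_i. -/
theorem finitePresentation_modU : Module.FinitePresentation (DPn K n) (modU K p m) := by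
  have hs : Function.Surjective (LinearMap.toSpanSingleton (DPn K n) _ (oneU K p m)) := fun u => by
    obtain ⟨d, rfl⟩ := exists_smul_oneU K p m u
    exact ⟨d, rfl⟩
  refine Module.finitePresentation_of_surjective _ hs ?_
  obtain ⟨s, hs⟩ := (isNoetherianRing_iff_ideal_fg _).1
    (inferInstance : IsNoetherianRing (Pn K n)) (zIdeal K p m)
  let G : Set (DPn K n) := (fun g => ofPoly K (frob K p (kExp K p m) g)) '' (s : Set (Pn K n)) ∪
    (⋃ i, (fun j => dop K (Finsupp.single i j)) '' Set.Ioo 0 (p ^ kExp K p m i))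
  have hG : G.Finite := (s.finite_toSet.image _).union
    (Set.finite_iUnion fun i => (Set.finite_Ioo _ _).image _)
  have hker : LinearMap.ker (LinearMap.toSpanSingleton (DPn K n) _ (oneU K p m)) =
      Submodule.span (DPn K n) G := by
    apply le_antisymm
    · intro d hd
      -- U(m) maps to D modulo the candidate relations, generator to class of 1. Anything killing
      -- the generator kills this class, hence is a consequence of the relations.
      obtain ⟨φ, hφ⟩ := exists_hom_modU K p m
        ((Submodule.span (DPn K n) G).mkQ (1 : DPn K n)) (fun i j h0 h1 => by
          rw [← map_smul, smul_eq_mul, mul_one, Submodule.mkQ_apply, Submodule.Quotient.mk_eq_zero]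
          exact Submodule.subset_span (Or.inr (Set.mem_iUnion.2 ⟨i, j, ⟨h0, h1⟩, rfl⟩)))
        (fun g hg => by
          rw [← map_smul, smul_eq_mul, mul_one, Submodule.mkQ_apply, Submodule.Quotient.mk_eq_zero]
          rw [← hs] at hg
          induction hg using Submodule.span_induction with
          | mem g hg => exact Submodule.subset_span (Or.inl ⟨g, hg, rfl⟩)
          | zero =>
            rw [map_zero, ← ofPolyHom_apply, map_zero]; exact zero_mem _
          | add x y _ _ hx hy => rw [map_add, ofPoly_add]; exact add_mem hx hy
          | smul c x _ hx =>
            rw [smul_eq_mul, map_mul, ofPoly_mul]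
            exact Submodule.smul_mem _ _ hx)
      have h1 : d • oneU K p m = 0 := hd
      have h2 := congrArg φ h1
      rw [map_smul, hφ, map_zero, ← map_smul, smul_eq_mul, mul_one, Submodule.mkQ_apply,
        Submodule.Quotient.mk_eq_zero] at h2
      exact h2
    · rw [Submodule.span_le]
      rintro d (⟨g, hg, rfl⟩ | hd)
      · refine ofPoly_frob_smul_oneU K p m g ?_
        rw [← hs]
        exact Submodule.subset_span hg
      · obtain ⟨i, j, hj, rfl⟩ := Set.mem_iUnion.1 hd
        exact dop_single_smul_oneU K p m i j hj.1 hj.2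
  rw [hker]
  exact Submodule.fg_def.2 ⟨G, hG, rfl⟩

/-! ### Associated primes -/

omit [Fact p.Prime] [CharP K p] in
/-- Above the annihilator of a nonzero vector there is an associated prime. -/
theorem exists_mem_assP {M : Type*} [AddCommGroup M] [Module (DPn K n) M] {u : M} (hu : u ≠ 0) :
    ∃ I ∈ assP K n M, ∀ h, ofPoly K h • u = 0 → h ∈ I := by
  letI : Module (Pn K n) M := Module.compHom M (ofPolyHom K).toRingHom
  obtain ⟨I, hI, hle⟩ := exists_le_isAssociatedPrime_of_isNoetherianRing (Pn K n) u hu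
  obtain ⟨hp, x, hx⟩ := isAssociatedPrime_iff.1 hI
  refine ⟨I, ⟨hp, x, fun h => ?_⟩, fun h hh => hle ?_⟩
  · rw [hx, Submodule.mem_colon_singleton, Submodule.mem_bot]
    rfl
  · rw [Submodule.mem_colon_singleton, Submodule.mem_bot]
    exact hh

/-- Large p-powers of polynomials commute with any given ∂^[γ], so they can be moved onto V(m),
where p-powers of elements of m lie in the image of z and act by zero. -/
theorem exists_pow_smul_eq_zero (u : modU K p m) :
    ∃ s, ∀ s' ≥ s, ∀ h : Pn K n, h ∈ m.asIdeal → ofPoly K (h ^ p ^ s') • u = 0 := by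
  obtain ⟨f, rfl⟩ := (expandU_bijective K p m).2 u
  rw [expandU_eq, Finsupp.lsum_apply]
  refine Finset.sum_induction _ (fun u : modU K p m => ∃ s, ∀ s' ≥ s, ∀ h : Pn K n, h ∈ m.asIdeal →
    ofPoly K (h ^ p ^ s') • u = 0) ?_ ⟨0, fun _ _ h _ => smul_zero (ofPoly K (h ^ p ^ _))⟩ ?_
  · rintro x y ⟨s, hx⟩ ⟨t, hy⟩
    refine ⟨max s t, fun s' hs' h hh => ?_⟩
    rw [smul_add, hx s' (le_trans (le_max_left _ _) hs') h hh,
      hy s' (le_trans (le_max_right _ _) hs') h hh, add_zero]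
  · intro β _
    set γ := scale p (kExp K p m) β with hγ
    -- One bound for two needs: s' ≥ k_i puts h^(p^s') in the image of `frob`, and s' ≥ γ_i gives
    -- γ_i < p^s', so ∂^[γ] commutes with it.
    refine ⟨Finset.univ.sup (kExp K p m) + ∑ i, γ i, fun s' hs' h hh => ?_⟩
    obtain ⟨g, hg⟩ := exists_pow_eq_frob K p (fun _ : Fin n => s') s' (fun _ => le_rfl) h
    obtain ⟨g', hg'⟩ := exists_pow_eq_frob K p (kExp K p m) s' (fun i =>
      (Finset.le_sup (Finset.mem_univ i)).trans (le_of_add_le_left hs')) h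
    have hmem : dop K γ ∈ boxAlg K p (fun _ : Fin n => s') := dop_mem_boxAlg K p _ fun i =>
      lt_of_le_of_lt ((Finset.single_le_sum (f := fun i => γ i) (fun _ _ => Nat.zero_le _)
        (Finset.mem_univ i)).trans (le_of_add_le_right hs'))
        (Nat.lt_pow_self (Fact.out : p.Prime).one_lt)
    have hgz : g' ∈ zIdeal K p m := by
      rw [mem_zIdeal, ← hg']
      exact Ideal.pow_mem_of_mem _ hh _ (pow_pos (Fact.out : p.Prime).pos _)
    change _ • tmulU K p m (dop K γ) (f β) = 0
    rw [Induced.smul_tmul, hg, ← boxAlg_commute K p _ hmem, ← hg, hg']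
    have := tmulU_mul K p m (dop K γ) (polyA K p m (frob K p (kExp K p m) g')) (f β)
    rw [polyA_frob_smul_eq_zero K p m hgz, map_zero] at this
    exact this

/-- An associated prime contains a power of every element of m, hence equals m. Existence comes from
noetherianity of `P_n`. -/
theorem assP_modU : assP K n (modU K p m) = {m.asIdeal} := by
  have key : ∀ I ∈ assP K n (modU K p m), I = m.asIdeal := by
    rintro I ⟨hI, u, hu⟩
    have hle : m.asIdeal ≤ I := by
      intro h hh
      obtain ⟨s, hs⟩ := exists_pow_smul_eq_zero K p m u
      exact hI.mem_of_pow_mem _ ((hu _).2 (hs s le_rfl h hh))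
    exact (m.isMaximal.eq_of_le hI.ne_top hle).symm
  ext I
  refine ⟨key I, ?_⟩
  rintro rfl
  obtain ⟨I, hI, -⟩ := exists_mem_assP (n := n) K (oneU_ne_zero K p m)
  rwa [key I hI] at hI

end ModU


/-! ### Simple finitely presented modules -/

/-- Take the annihilator of a simple quotient; it is maximal because the ring is commutative. -/
theorem exists_isMaximal_smul_top_ne_top {R N : Type*} [CommRing R] [AddCommGroup N] [Module R N]
    [Module.Finite R N] [Nontrivial N] :
    ∃ I : Ideal R, I.IsMaximal ∧ I • (⊤ : Submodule R N) ≠ ⊤ := by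
  obtain ⟨S, hS, -⟩ := (eq_top_or_exists_le_coatom (⊥ : Submodule R N)).resolve_left bot_ne_top
  have : IsSimpleModule R (N ⧸ S) := isSimpleModule_iff_isCoatom.2 hS
  refine ⟨Module.annihilator R (N ⧸ S), IsSimpleModule.annihilator_isMaximal, fun h => hS.1 ?_⟩
  rw [eq_top_iff, ← h, Submodule.smul_le]
  intro r hr x _
  have := Module.mem_annihilator.1 hr (S.mkQ x)
  rwa [← map_smul, Submodule.mkQ_apply, Submodule.Quotient.mk_eq_zero] at this

/-- If a ring is finite over a central subring, then a proper left ideal lies in a proper left ideal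
that contains a maximal ideal of the subring. -/
theorem exists_le_of_one_notMem {R B : Type*} [CommRing R] [Ring B] (ι : R →+* B)
    (hcomm : ∀ (a : B) z, a * ι z = ι z * a) (G : Finset B)
    (hG : ∀ a : B, ∃ c : B → R, a = ∑ g ∈ G, ι (c g) * g) (I : Submodule B B) (hI : (1 : B) ∉ I) :
    ∃ (𝔫 : Ideal R) (J : Submodule B B), 𝔫.IsMaximal ∧ I ≤ J ∧ (1 : B) ∉ J ∧
      ∀ z ∈ 𝔫, ι z ∈ J := by
  letI : Module R (B ⧸ I) := Module.compHom (B ⧸ I) ι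
  have hsm : ∀ (z : R) (x : B ⧸ I), z • x = ι z • x := fun _ _ => rfl
  have hNt : Nontrivial (B ⧸ I) := by
    refine ⟨⟨I.mkQ 1, 0, fun h => hI ?_⟩⟩
    rwa [Submodule.mkQ_apply, Submodule.Quotient.mk_eq_zero] at h
  have hfin : Module.Finite R (B ⧸ I) := by
    classical
    refine ⟨⟨G.image I.mkQ, ?_⟩⟩
    rw [eq_top_iff]
    rintro x -
    obtain ⟨a, rfl⟩ := I.mkQ_surjective x
    obtain ⟨c, hc⟩ := hG a
    rw [hc, map_sum]
    refine Submodule.sum_mem _ fun g hg => ?_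
    rw [← smul_eq_mul, map_smul, ← hsm]
    exact Submodule.smul_mem _ _ (Submodule.subset_span (by
      rw [Finset.coe_image]; exact Set.mem_image_of_mem _ hg))
  obtain ⟨𝔫, hmax, hne⟩ := exists_isMaximal_smul_top_ne_top (R := R) (N := B ⧸ I)
  let L : B → (B ⧸ I) →ₗ[R] (B ⧸ I) := fun a =>
    { toFun := fun x => a • x
      map_add' := smul_add a
      map_smul' := fun z x => by
        rw [RingHom.id_apply, hsm, hsm, smul_smul, smul_smul, hcomm] }
  -- Centrality makes left multiplications `R`-linear, so 𝔫(B/I) is a left `B`-submodule; `J` is its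
  -- preimage.
  have hstable : ∀ a : B, ∀ x ∈ 𝔫 • (⊤ : Submodule R (B ⧸ I)),
      a • x ∈ 𝔫 • (⊤ : Submodule R (B ⧸ I)) := by
    intro a x hx
    have h1 : L a x ∈ (𝔫 • (⊤ : Submodule R (B ⧸ I))).map (L a) := Submodule.mem_map_of_mem hx
    rw [Submodule.map_smul''] at h1
    exact Submodule.smul_mono le_rfl le_top h1
  let J : Submodule B B :=
    { carrier := {a | I.mkQ a ∈ 𝔫 • (⊤ : Submodule R (B ⧸ I))}
      add_mem' := fun {a b} ha hb => by
        rw [Set.mem_ofPred_eq, map_add]; exact add_mem ha hb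
      zero_mem' := by rw [Set.mem_ofPred_eq, map_zero]; exact zero_mem _
      smul_mem' := fun a b hb => by
        rw [Set.mem_ofPred_eq, map_smul]; exact hstable a _ hb }
  refine ⟨𝔫, J, hmax, fun a ha => ?_, fun h1 => hne ?_, fun z hz => ?_⟩
  · change I.mkQ a ∈ 𝔫 • (⊤ : Submodule R (B ⧸ I))
    rw [Submodule.mkQ_apply, (Submodule.Quotient.mk_eq_zero I).2 ha]
    exact zero_mem _
  · rw [eq_top_iff]
    rintro x -
    obtain ⟨a, rfl⟩ := I.mkQ_surjective x
    have := hstable a _ h1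
    rwa [← map_smul, smul_eq_mul, mul_one] at this
  · change I.mkQ (ι z) ∈ 𝔫 • (⊤ : Submodule R (B ⧸ I))
    rw [← mul_one (ι z), ← smul_eq_mul, map_smul, ← hsm]
    exact Submodule.smul_mem_smul hz trivial

/-! ### Descent to algebras finite over their centers, and the classification -/

section Classification

variable (K : Type u) [Field K] {n : ℕ} (p : ℕ) [Fact p.Prime] [CharP K p]

theorem exists_mem_boxAlg (d : DPn K n) :
    ∃ k : ℕ, ∀ k' ≥ k, d ∈ boxAlg K p (fun _ : Fin n => k') := by
  induction d using dop_mul_induction K with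
  | h0 => exact ⟨0, fun _ _ => zero_mem _⟩
  | hadd a b ha hb =>
    obtain ⟨k, hk⟩ := ha
    obtain ⟨l, hl⟩ := hb
    exact ⟨max k l, fun k' hk' => add_mem (hk k' ((le_max_left _ _).trans hk'))
      (hl k' ((le_max_right _ _).trans hk'))⟩
  | hd β h =>
    refine ⟨∑ i, β i, fun k' hk' => mul_mem (dop_mem_boxAlg K p _ fun i => ?_)
      (ofPoly_mem_boxAlg K p _ h)⟩
    exact lt_of_le_of_lt ((Finset.single_le_sum (f := fun i => β i) (fun _ _ => Nat.zero_le _)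
        (Finset.mem_univ i)).trans hk') (Nat.lt_pow_self (Fact.out : p.Prime).one_lt)

theorem exists_subset_boxAlg (S : Finset (DPn K n)) :
    ∃ k : ℕ, ∀ d ∈ S, d ∈ boxAlg K p (fun _ : Fin n => k) := by
  choose k hk using exists_mem_boxAlg K p (n := n)
  exact ⟨S.sup k, fun d hd => hk d _ (Finset.le_sup hd)⟩

/-- The subalgebra is finite over its center. -/
theorem exists_finset_boxAlg (k : Fin n → ℕ) : ∃ G : Finset (boxAlg K p k), ∀ a : boxAlg K p k,
    ∃ c : boxAlg K p k → Pn K n, (a : DPn K n) =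
      ∑ g ∈ G, ofPoly K (frob K p k (c g)) * (g : DPn K n) := by
  classical
  let e : Box p k × Box p k → boxAlg K p k := fun b =>
    ⟨dop K b.1.toIdx * ofPoly K (MvPolynomial.monomial b.2.toIdx 1),
      mul_mem (dop_mem_boxAlg K p k (Box.toIdx_lt p k b.1)) (ofPoly_mem_boxAlg K p k _)⟩
  let G := Finset.univ.image e
  refine ⟨G, fun a => ?_⟩
  have hadd : ∀ x y : DPn K n,
      (∃ c : boxAlg K p k → Pn K n, x = ∑ g ∈ G, ofPoly K (frob K p k (c g)) * (g : DPn K n)) →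
      (∃ c : boxAlg K p k → Pn K n, y = ∑ g ∈ G, ofPoly K (frob K p k (c g)) * (g : DPn K n)) →
      ∃ c : boxAlg K p k → Pn K n,
        x + y = ∑ g ∈ G, ofPoly K (frob K p k (c g)) * (g : DPn K n) := by
    rintro x y ⟨c, rfl⟩ ⟨d, rfl⟩
    refine ⟨c + d, ?_⟩
    rw [← Finset.sum_add_distrib]
    refine Finset.sum_congr rfl fun g _ => ?_
    rw [Pi.add_apply, map_add, ofPoly_add, add_mul]
  have hzero : ∃ c : boxAlg K p k → Pn K n,
      (0 : DPn K n) = ∑ g ∈ G, ofPoly K (frob K p k (c g)) * (g : DPn K n) := by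
    refine ⟨0, (Finset.sum_eq_zero fun g _ => ?_).symm⟩
    rw [Pi.zero_apply, map_zero, ← ofPolyHom_apply, map_zero, zero_mul]
  have ha := boxAlg_le_span K p k a.2
  generalize (a : DPn K n) = d at ha
  induction ha using Submodule.span_induction with
  | mem d hd =>
    obtain ⟨γ, h, hγ, rfl⟩ := hd
    obtain ⟨b, rfl⟩ := Box.exists_toIdx p k hγ
    obtain ⟨c, rfl⟩ := exists_box_sum K p k h
    rw [← ofPolyHom_apply, map_sum, Finset.mul_sum]
    refine Finset.sum_induction _ _ hadd hzero fun b' _ => ?_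
    -- The map `e` need not be checked to be injective: each summand is written separately with one
    -- nonzero coefficient, and the representations are added.
    refine ⟨Pi.single (e (b, b')) (c b'), ?_⟩
    rw [Finset.sum_eq_single (e (b, b'))]
    · rw [Pi.single_eq_same, map_mul, ← boxAlg_commute K p k (e (b, b')).2, ← mul_assoc]
      rfl
    · intro g _ hg
      rw [Pi.single_eq_of_ne hg, map_zero, ← ofPolyHom_apply, map_zero, zero_mul]
    · intro h
      exact absurd (Finset.mem_image_of_mem e (Finset.mem_univ _)) h
  | zero => exact hzero
  | add x y _ _ hx hy => exact hadd x y hx hy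
  | smul r x _ hx =>
    obtain ⟨c, rfl⟩ := hx
    refine ⟨fun g => r • c g, ?_⟩
    rw [Finset.smul_sum]
    refine Finset.sum_congr rfl fun g _ => ?_
    rw [map_smul, ← ofPolyHom_apply, ← ofPolyHom_apply, map_smul, smul_mul_assoc]

/-- The left ideal of `D(P_n)` generated by a proper left ideal of the subalgebra is proper. -/
theorem one_notMem_span (k : Fin n → ℕ) (J : Submodule (boxAlg K p k) (boxAlg K p k))
    (hJ : (1 : boxAlg K p k) ∉ J) :
    (1 : DPn K n) ∉ Submodule.span (DPn K n) ((fun a : boxAlg K p k => (a : DPn K n)) '' J) := by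
  intro h
  -- The coordinate at 0 sends the extended left ideal into `J`; quantifying over left multiples
  -- makes the induction go through.
  have key : ∀ x ∈ Submodule.span (DPn K n) ((fun a : boxAlg K p k => (a : DPn K n)) '' J),
      ∀ d, boxCoord K p k (d * x) 0 ∈ J := by
    intro x hx
    induction hx using Submodule.span_induction with
    | mem x hx =>
      obtain ⟨a, ha, rfl⟩ := hx
      intro d
      rw [boxCoord_mul]
      exact J.smul_mem _ ha
    | zero => intro d; rw [mul_zero, map_zero (boxCoord K p k)]; exact zero_mem _
    | add x y _ _ hx hy =>
      intro d
      rw [mul_add, map_add, Finsupp.add_apply]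
      exact add_mem (hx d) (hy d)
    | smul e x _ hx => intro d; rw [smul_eq_mul, ← mul_assoc]; exact hx _
  have h1 := key 1 h 1
  have h2 := boxCoord_coe K p k 1
  rw [OneMemClass.coe_one] at h2
  rw [mul_one, h2, Finsupp.single_eq_same] at h1
  exact hJ h1

/-- A simple finitely presented module has a maximal ideal of `P_n` as an associated prime. -/
theorem exists_isMaximal_mem_assP (p : ℕ) [Fact p.Prime] [CharP K p] (M : Type*) [AddCommGroup M] [Module (DPn K n) M]
    (hM : IsSimpleModule (DPn K n) M) (hfp : Module.FinitePresentation (DPn K n) M) :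
    ∃ m : MaximalSpectrum (Pn K n), m.asIdeal ∈ assP K n M := by
  have : Nontrivial M := IsSimpleModule.nontrivial (DPn K n) M
  obtain ⟨w, hw⟩ := exists_ne (0 : M)
  have hs : Function.Surjective (LinearMap.toSpanSingleton (DPn K n) M w) :=
    IsSimpleModule.toSpanSingleton_surjective (DPn K n) hw
  obtain ⟨S, hS⟩ := Module.FinitePresentation.fg_ker _ hs
  set I := LinearMap.ker (LinearMap.toSpanSingleton (DPn K n) M w) with hI
  have hIm : ∀ d, d ∈ I ↔ d • w = 0 := fun d => Iff.rfl
  obtain ⟨k, hk⟩ := exists_subset_boxAlg K p S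
  let B := boxAlg K p (fun _ : Fin n => k)
  let Ik : Submodule B B :=
    { carrier := {a | (a : DPn K n) ∈ I}
      add_mem' := fun {a b} ha hb => I.add_mem (x := (a : DPn K n)) (y := b) ha hb
      zero_mem' := zero_mem I
      smul_mem' := fun a b hb => I.smul_mem (a : DPn K n) hb }
  have h1 : (1 : B) ∉ Ik := by
    intro h
    have : (1 : DPn K n) • w = 0 := h
    rw [one_smul] at this
    exact hw this
  let ι : Pn K n →+* B :=
    (((ofPolyHom K).codRestrict B (ofPoly_mem_boxAlg K p _)).comp (frob K p fun _ => k)).toRingHom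
  obtain ⟨G, hG⟩ := exists_finset_boxAlg K p (fun _ : Fin n => k)
  obtain ⟨𝔫, J, hmax, hIJ, hJ1, hJz⟩ := exists_le_of_one_notMem ι
    (fun a z => Subtype.ext (boxAlg_commute K p _ a.2 z)) G (fun a => by
      obtain ⟨c, hc⟩ := hG a
      refine ⟨c, Subtype.ext ?_⟩
      rw [hc, AddSubmonoidClass.coe_finsetSum]
      rfl) Ik h1
  set DJ := Submodule.span (DPn K n) ((fun a : B => (a : DPn K n)) '' J) with hDJ
  -- Finite presentation is used here: the generators of `I` lie at level k, so the larger left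
  -- ideal `J` of that level already accounts for all of `I`.
  have hle : I ≤ DJ := by
    rw [← hS, Submodule.span_le]
    intro d hd
    refine Submodule.subset_span ⟨⟨d, hk d hd⟩, hIJ ?_, rfl⟩
    change d ∈ I
    rw [← hS]
    exact Submodule.subset_span hd
  -- Maximality of `I`, via simplicity: an element of `DJ` outside `I` would put 1 in `DJ`, contrary
  -- to freeness of D over level k.
  have hge : DJ ≤ I := by
    intro d hd
    by_contra hne
    rw [hIm] at hne
    obtain ⟨e, he⟩ := IsSimpleModule.toSpanSingleton_surjective (DPn K n) hne w
    rw [LinearMap.toSpanSingleton_apply, smul_smul] at he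
    have h2 : 1 - e * d ∈ DJ := hle (by rw [hIm, sub_smul, he, one_smul, sub_self])
    have h3 : (1 : DPn K n) ∈ DJ := by
      rw [← sub_add_cancel 1 (e * d)]
      exact add_mem h2 (DJ.smul_mem e hd)
    exact one_notMem_span K p _ J hJ1 h3
  have hz : ∀ z ∈ 𝔫, ofPoly K (frob K p (fun _ => k) z) • w = 0 := fun z hz =>
    (hIm _).1 (hge (Submodule.subset_span
      ⟨ι z, hJz z hz, rfl⟩))
  obtain ⟨Q, hQ, hQw⟩ := exists_mem_assP (n := n) K hw
  have hQp : Q.IsPrime := hQ.1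
  -- The prime lies over the maximal ideal 𝔫 of the center, and `P_n` is integral over the central
  -- polynomials; so `Q` is maximal.
  have hcomap : Q.comap (frob K p (fun _ => k)).toRingHom = 𝔫 :=
    (hmax.eq_of_le (Ideal.comap_ne_top _ hQp.ne_top) fun z hz' => hQw _ (hz z hz')).symm
  have hQm : Q.IsMaximal := Ideal.isMaximal_of_isIntegral_of_isMaximal_comap' _
    (frob_isIntegral K p (fun _ => k)) Q (by rw [hcomap]; exact hmax)
  exact ⟨⟨Q, hQm⟩, hQ⟩

/-- A simple module with the associated prime `m` is isomorphic to `U(m)`. -/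
theorem nonempty_equiv_modU {M : Type*} [AddCommGroup M] [Module (DPn K n) M]
    (hM : IsSimpleModule (DPn K n) M) (m : MaximalSpectrum (Pn K n))
    (hm : m.asIdeal ∈ assP K n M) : Nonempty (M ≃ₗ[DPn K n] modU K p m) := by
  obtain ⟨-, u, hu⟩ := hm
  have hu0 : u ≠ 0 := by
    rintro rfl
    exact m.isMaximal.ne_top ((Ideal.eq_top_iff_one _).2 ((hu 1).2 (smul_zero _)))
  -- Passing from `u` to `a • u` gains annihilation by the divided powers; annihilation by the
  -- central elements from z persists because they commute with `a`.
  obtain ⟨a, ha, hk⟩ := exists_isKilled K p m hu0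
  have hγ : ∀ i j, j < p ^ kExp K p m i → ∀ l, (Finsupp.single i j : Fin n →₀ ℕ) l <
      p ^ kExp K p m l := by
    intro i j hj l
    by_cases hl : l = i
    · subst hl; simpa using hj
    · simpa [Ne.symm hl] using pow_pos (Fact.out : p.Prime).pos _
  obtain ⟨φ, hφ⟩ := exists_hom_modU K p m (a • u)
    (fun i j h0 hj => hk i j h0 hj (dopA K p m _ (hγ i j hj)) rfl) (fun g hg => by
      change ofPoly K (frob K p (kExp K p m) g) • (a : DPn K n) • u = 0
      rw [smul_smul, ← boxAlg_commute K p _ a.2, mul_smul, (hu _).1 hg, smul_zero])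
  have := isSimpleModule_modU K p m
  have hne : φ ≠ 0 := by
    rintro rfl
    exact ha hφ.symm
  exact ⟨(LinearEquiv.ofBijective φ (LinearMap.bijective_of_ne_zero hne)).symm⟩

end Classification


/-! ### Counting functions and almost polynomials -/

section Counting

variable {n : ℕ} (a : Fin n → ℕ)

/-- The multi-indices `β` supported in `s` with `∑ β_j a_j ≤ i` (if all `a_j` are positive). -/
def idxLE (s : Finset (Fin n)) (i : ℕ) : Finset (Fin n →₀ ℕ) :=
  (Finset.Icc 0 (Finsupp.equivFunOnFinite.symm fun _ => i)).filter
    fun β => β.support ⊆ s ∧ ∑ j, β j * a j ≤ i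

variable {a} in
theorem mem_idxLE (ha : ∀ j, 0 < a j) {s : Finset (Fin n)} {i : ℕ} {β : Fin n →₀ ℕ} :
    β ∈ idxLE a s i ↔ β.support ⊆ s ∧ ∑ j, β j * a j ≤ i := by
  rw [idxLE, Finset.mem_filter, and_iff_right_iff_imp]
  rintro ⟨-, h⟩
  refine Finset.mem_Icc.2 ⟨zero_le, fun j => ?_⟩
  calc β j ≤ β j * a j := Nat.le_mul_of_pos_right _ (ha j)
    _ ≤ ∑ j, β j * a j := Finset.single_le_sum (f := fun j => β j * a j)
        (fun _ _ => Nat.zero_le _) (Finset.mem_univ j)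
    _ ≤ i := h

/-- The sum of `φ (i - ∑ β_j a_j)` over the multi-indices supported in `s`. -/
def countSum (φ : ℕ → ℕ) (s : Finset (Fin n)) (i : ℕ) : ℕ :=
  ∑ β ∈ idxLE a s i, φ (i - ∑ j, β j * a j)

theorem sum_add_single_mul (β : Fin n →₀ ℕ) (j : Fin n) :
    ∑ l, (β + Finsupp.single j 1 : Fin n →₀ ℕ) l * a l = ∑ l, β l * a l + a j := by
  simp [add_mul, Finset.sum_add_distrib, Finsupp.single_apply]

variable {a}

/-- Either the j-th index is 0, or one can be subtracted from it at the cost of `a j`. As generating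
functions, this is multiplication by 1/(1 − X^(a j)). -/
theorem countSum_insert (ha : ∀ j, 0 < a j) (φ : ℕ → ℕ) {s : Finset (Fin n)} {j : Fin n}
    (hj : j ∉ s) (i : ℕ) : countSum a φ (insert j s) i =
      countSum a φ s i + if a j ≤ i then countSum a φ (insert j s) (i - a j) else 0 := by
  classical
  rw [countSum, ← Finset.sum_filter_add_sum_filter_not _ fun β => β j = 0]
  congr 1
  · refine Finset.sum_congr ?_ fun _ _ => rfl
    ext β
    rw [Finset.mem_filter, mem_idxLE ha, mem_idxLE ha]
    constructor
    · rintro ⟨⟨h1, h2⟩, h3⟩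
      refine ⟨fun l hl => (Finset.mem_insert.1 (h1 hl)).resolve_left ?_, h2⟩
      rintro rfl
      exact (Finsupp.mem_support_iff.1 hl) h3
    · rintro ⟨h1, h2⟩
      refine ⟨⟨h1.trans (Finset.subset_insert _ _), h2⟩, ?_⟩
      by_contra h
      exact hj (h1 (Finsupp.mem_support_iff.2 h))
  · split_ifs with h
    · symm
      refine Finset.sum_bij (fun β _ => β + Finsupp.single j 1) ?_ ?_ ?_ ?_
      · intro β hβ
        rw [mem_idxLE ha] at hβ
        rw [Finset.mem_filter, mem_idxLE ha, sum_add_single_mul]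
        refine ⟨⟨fun l hl => ?_, by omega⟩, by simp⟩
        by_cases hl' : l = j
        · exact hl' ▸ Finset.mem_insert_self _ _
        · refine hβ.1 (Finsupp.mem_support_iff.2 ?_)
          rw [Finsupp.mem_support_iff, Finsupp.add_apply, Finsupp.single_eq_of_ne hl'] at hl
          simpa using hl
      · intro β _ γ _ h
        exact add_left_injective _ h
      · intro β hβ
        rw [Finset.mem_filter, mem_idxLE ha] at hβ
        have e := sub_single_add_single (Nat.one_le_iff_ne_zero.2 hβ.2)
        have h2 := hβ.1.2
        rw [← e, sum_add_single_mul] at h2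
        refine ⟨β - Finsupp.single j 1, ?_, e⟩
        rw [mem_idxLE ha]
        refine ⟨fun l hl => hβ.1.1 ?_, by omega⟩
        rw [Finsupp.mem_support_iff] at hl ⊢
        intro h0
        simp [h0] at hl
      · intro β hβ
        rw [sum_add_single_mul, Nat.sub_sub, add_comm (a j)]
    · refine Finset.sum_eq_zero fun β hβ => ?_
      rw [Finset.mem_filter, mem_idxLE ha] at hβ
      have e := sub_single_add_single (Nat.one_le_iff_ne_zero.2 hβ.2)
      have h2 := hβ.1.2
      rw [← e, sum_add_single_mul] at h2
      omega

theorem countSum_empty (ha : ∀ j, 0 < a j) (φ : ℕ → ℕ) (i : ℕ) : countSum a φ ∅ i = φ i := by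
  rw [countSum, Finset.sum_eq_single 0]
  · simp
  · intro β hβ h0
    rw [mem_idxLE ha, Finset.subset_empty, Finsupp.support_eq_empty] at hβ
    exact absurd hβ.1 h0
  · intro h
    rw [mem_idxLE ha] at h
    simp at h

/-- The generating function of the counting function. -/
theorem mk_countSum_mul (ha : ∀ j, 0 < a j) (φ : ℕ → ℕ) (s : Finset (Fin n)) :
    PowerSeries.mk (fun i => (countSum a φ s i : ℚ)) * ∏ j ∈ s, (1 - PowerSeries.X ^ a j) =
      PowerSeries.mk fun i => (φ i : ℚ) := by
  classical
  induction s using Finset.induction_on with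
  | empty =>
    rw [Finset.prod_empty, mul_one]
    simp only [countSum_empty ha]
  | insert j s hj ih =>
    rw [Finset.prod_insert hj, ← mul_assoc, ← ih]
    congr 1
    ext i
    rw [mul_sub, mul_one, map_sub, PowerSeries.coeff_mul_X_pow', PowerSeries.coeff_mk,
      PowerSeries.coeff_mk, PowerSeries.coeff_mk, countSum_insert ha φ hj i]
    push_cast
    split_ifs <;> simp

/-- The step-P difference operator lowers the degree by one, so the top term is matched and the rest
handled by induction. -/
theorem exists_discrete_antiderivative {P : ℕ} (hP : 0 < P) (d : ℕ) :
    ∀ q : Polynomial ℚ, q.natDegree ≤ d → ∃ Q : Polynomial ℚ, Q.natDegree ≤ d + 1 ∧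
      Q.coeff (d + 1) = q.coeff d / ((d + 1) * P) ∧
      Q.comp (Polynomial.X + Polynomial.C (P : ℚ)) - Q = q := by
  have hP' : (P : ℚ) ≠ 0 := by exact_mod_cast hP.ne'
  induction d with
  | zero =>
    intro q hq
    refine ⟨Polynomial.C (q.coeff 0 / P) * Polynomial.X, ?_, ?_, ?_⟩
    · simpa using Polynomial.natDegree_C_mul_X_pow_le (q.coeff 0 / (P : ℚ)) 1
    · simp
    · conv_rhs => rw [Polynomial.eq_C_of_natDegree_le_zero hq]
      simp only [Polynomial.mul_comp, Polynomial.C_comp, Polynomial.X_comp]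
      rw [mul_add, add_sub_cancel_left, ← Polynomial.C_mul, div_mul_cancel₀ _ hP']
  | succ d ih =>
    intro q hq
    have hd : ((d : ℚ) + 1 + 1) ≠ 0 := by positivity
    -- The difference of X^(d+2) has leading term (d+2) P X^(d+1), so `b` cancels the top
    -- coefficient of `q`.
    set b := q.coeff (d + 1) / (((d + 1 : ℕ) + 1) * (P : ℚ)) with hb
    set Q₀ := Polynomial.C b * Polynomial.X ^ (d + 2) with hQ₀
    set Δ := Q₀.comp (Polynomial.X + Polynomial.C (P : ℚ)) - Q₀ with hΔ
    have hc : ∀ l, Δ.coeff l =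
        b * ((P : ℚ) ^ (d + 2 - l) * ((d + 2).choose l : ℚ)) - b * if l = d + 2 then 1 else 0 := by
      intro l
      rw [hΔ, hQ₀, Polynomial.mul_comp, Polynomial.C_comp, Polynomial.pow_comp, Polynomial.X_comp,
        Polynomial.coeff_sub, Polynomial.coeff_C_mul, Polynomial.coeff_X_add_C_pow,
        Polynomial.coeff_C_mul, Polynomial.coeff_X_pow]
    obtain ⟨Q₁, h1, -, h3⟩ := ih (q - Δ) (by
      rw [Polynomial.natDegree_le_iff_coeff_eq_zero]
      intro l hl
      rw [Polynomial.coeff_sub, hc]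
      rcases Nat.lt_trichotomy l (d + 2) with h | h | h
      · obtain rfl : l = d + 1 := by omega
        rw [if_neg (by omega), show d + 2 - (d + 1) = 1 by omega, Nat.choose_succ_self_right, hb]
        push_cast
        field_simp
        ring
      · subst h
        rw [Polynomial.coeff_eq_zero_of_natDegree_lt (by omega)]
        simp
      · rw [Polynomial.coeff_eq_zero_of_natDegree_lt (by omega), Nat.choose_eq_zero_of_lt h,
          if_neg (by omega)]
        simp)
    refine ⟨Q₀ + Q₁, ?_, ?_, ?_⟩
    · refine Polynomial.natDegree_add_le_of_degree_le ?_ (h1.trans (by omega))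
      exact Polynomial.natDegree_C_mul_X_pow_le _ _
    · rw [Polynomial.coeff_add, Polynomial.coeff_eq_zero_of_natDegree_lt (p := Q₁) (by omega),
        hQ₀, Polynomial.coeff_C_mul, Polynomial.coeff_X_pow, if_pos rfl, hb, mul_one, add_zero]
    · rw [Polynomial.add_comp, add_sub_add_comm, h3, ← hΔ]
      abel

/-- Summation raises the degree of an almost polynomial by one. -/
theorem IsAlmostPolynomial.sum {f g : ℕ → ℕ} {P d : ℕ} {c : ℚ} (hg : IsAlmostPolynomial g P d c)
    (hf : ∀ i, f (i + P) = g (i + P) + f i) :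
    IsAlmostPolynomial f P (d + 1) (c / ((d + 1) * P)) := by
  obtain ⟨hP, q, hq, he⟩ := hg
  have : NeZero P := ⟨hP.ne'⟩
  obtain ⟨i₀, hi₀⟩ := Filter.eventually_atTop.1 he
  have hP' : (P : ℚ) ≠ 0 := by exact_mod_cast hP.ne'
  have hnd : ∀ s, (q s).natDegree = d := fun s => Polynomial.natDegree_eq_of_degree_eq_some (hq s).1
  have hlc : ∀ s, (q s).coeff d = c := fun s => by
    rw [← (hq s).2, Polynomial.leadingCoeff, hnd]
  choose Q hQ1 hQ2 hQ3 using fun s => exists_discrete_antiderivative hP d (q s) (hnd s).le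
  let r : ZMod P → ℕ := fun s => i₀ * P + s.val
  let E : ZMod P → ℚ := fun s => f (r s) - (Q s + q s).eval (r s : ℚ)
  let R : ZMod P → Polynomial ℚ := fun s => Q s + q s + Polynomial.C (E s)
  have hc0 : c ≠ 0 := by
    rw [← (hq 0).2, Ne, Polynomial.leadingCoeff_eq_zero]
    intro h
    have := (hq 0).1
    rw [h, Polynomial.degree_zero] at this
    exact WithBot.bot_ne_coe this
  have hRc : ∀ s, (R s).coeff (d + 1) = c / ((d + 1) * P) := by
    intro s
    simp only [R, Polynomial.coeff_add, hQ2, hlc, Polynomial.coeff_C_succ]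
    rw [Polynomial.coeff_eq_zero_of_natDegree_lt (p := q s) (by rw [hnd]; omega)]
    simp
  have hRd : ∀ s, (R s).natDegree = d + 1 := by
    intro s
    refine Polynomial.natDegree_eq_of_le_of_coeff_ne_zero ?_ ?_
    · refine Polynomial.natDegree_add_le_of_degree_le (Polynomial.natDegree_add_le_of_degree_le
        (hQ1 s) ((hnd s).le.trans (by omega))) ?_
      simp
    · rw [hRc]
      have : (d : ℚ) + 1 ≠ 0 := by positivity
      exact div_ne_zero hc0 (mul_ne_zero this hP')
  refine ⟨hP, R, fun s => ⟨?_, ?_⟩, ?_⟩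
  · have hne : R s ≠ 0 := by
      intro h0
      have := hRd s
      rw [h0, Polynomial.natDegree_zero] at this
      omega
    rw [Polynomial.degree_eq_natDegree hne, hRd]
  · rw [Polynomial.leadingCoeff, hRd, hRc]
  · have key : ∀ (t : ℕ) (s : ZMod P),
        (f (r s + P * t) : ℚ) = (R s).eval ((r s + P * t : ℕ) : ℚ) := by
      intro t s
      induction t with
      | zero => simp [R, E]
      | succ t ih =>
        have h1 : r s + P * (t + 1) = r s + P * t + P := by ring
        have h2 : i₀ ≤ r s + P * t + P := by
          have : i₀ ≤ i₀ * P := Nat.le_mul_of_pos_right _ hP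
          simp only [r]
          omega
        have h3 := hi₀ _ h2
        have h4 : ((r s + P * t + P : ℕ) : ZMod P) = s := by
          simp [r]
        rw [h4] at h3
        rw [h1, hf, Nat.cast_add, h3, ih]
        have h5 := congrArg (Polynomial.eval ((r s + P * t : ℕ) : ℚ)) (hQ3 s)
        rw [Polynomial.eval_sub, Polynomial.eval_comp, Polynomial.eval_add, Polynomial.eval_X,
          Polynomial.eval_C, ← Nat.cast_add] at h5
        simp only [R, Polynomial.eval_add, Polynomial.eval_C]
        linear_combination h5 * (-1)
    refine Filter.eventually_atTop.2 ⟨i₀ * P, fun i hi => ?_⟩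
    have h1 : i₀ ≤ i / P := (Nat.le_div_iff_mul_le hP).2 hi
    obtain ⟨t, ht⟩ := Nat.exists_eq_add_of_le h1
    have h2 : r (i : ZMod P) + P * t = i := by
      simp only [r, ZMod.val_natCast]
      have h3 := Nat.div_add_mod i P
      rw [ht, mul_add] at h3
      rw [mul_comm i₀ P]
      omega
    have := key t (i : ZMod P)
    rwa [h2] at this

theorem isAlmostPolynomial_const {φ : ℕ → ℕ} {P c : ℕ} (hP : 0 < P) (hc : c ≠ 0)
    (h : ∀ᶠ i in Filter.atTop, φ i = c) : IsAlmostPolynomial φ P 0 c := by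
  have hc' : (c : ℚ) ≠ 0 := by exact_mod_cast hc
  refine ⟨hP, fun _ => Polynomial.C (c : ℚ), fun _ => ⟨?_, ?_⟩, ?_⟩
  · rw [Polynomial.degree_C hc']; rfl
  · exact Polynomial.leadingCoeff_C _
  · filter_upwards [h] with i hi
    rw [hi, Polynomial.eval_C]

/-- Each variable is one summation with step P. Equal steps suffice: the layers of U(m) below
replace the different p^k_i by one p^k. -/
theorem isAlmostPolynomial_countSum {φ : ℕ → ℕ} {P c : ℕ} (hP : 0 < P) (hc : c ≠ 0)
    (h : ∀ᶠ i in Filter.atTop, φ i = c) (s : Finset (Fin n)) :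
    IsAlmostPolynomial (countSum (fun _ : Fin n => P) φ s) P s.card
      (c / (P ^ s.card * s.card.factorial)) := by
  classical
  induction s using Finset.induction_on with
  | empty =>
    have h0 : countSum (fun _ : Fin n => P) φ ∅ = φ := funext (countSum_empty (fun _ => hP) φ)
    rw [h0]
    simpa using isAlmostPolynomial_const hP hc h
  | insert j s hj ih =>
    have := ih.sum (f := countSum (fun _ : Fin n => P) φ (insert j s)) fun i => by
      rw [countSum_insert (fun _ => hP) φ hj, if_pos (Nat.le_add_left _ _), Nat.add_sub_cancel]
    rw [Finset.card_insert_of_notMem hj]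
    convert this using 1
    rw [div_div, Nat.factorial_succ, pow_succ]
    push_cast
    congr 1
    ring

end Counting


/-! ### The canonical filtration -/

theorem multiIndex_induction {n : ℕ} {C : (Fin n →₀ ℕ) → Prop} (h0 : C 0)
    (hs : ∀ β i, C β → C (β + Finsupp.single i 1)) (β : Fin n →₀ ℕ) : C β := by
  obtain ⟨N, hN⟩ : ∃ N, ∑ j, β j = N := ⟨_, rfl⟩
  induction N generalizing β with
  | zero =>
    have : β = 0 := by
      ext j
      simpa using (Finset.sum_eq_zero_iff.1 hN) j (Finset.mem_univ j)
    rwa [this]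
  | succ N ih =>
    obtain ⟨i, hi⟩ : ∃ i, β i ≠ 0 := by
      by_contra! hc
      simp [hc] at hN
    have h1 := Nat.one_le_iff_ne_zero.2 hi
    rw [← sub_single_add_single h1]
    refine hs _ _ (ih _ ?_)
    have := sum_sub_single h1
    omega

section FilMul

variable {K : Type u} [Field K] {D : Type v} [Ring D] [Algebra K D] {M : Type*} [AddCommGroup M]
  [Module K M] [Module D M]

theorem smul_mem_filMul {G : ℕ → Submodule K D} {M₀ : Submodule K M} {i : ℕ} {g : D} (hg : g ∈ G i)
    {x : M} (hx : x ∈ M₀) : g • x ∈ filMul G M₀ i :=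
  Submodule.subset_span ⟨g, hg, x, hx, rfl⟩

theorem filMul_le_of_span [IsScalarTower K D M] {G : ℕ → Submodule K D} {M₀ : Submodule K M} {i : ℕ}
    {X : Set D} (hX : G i = Submodule.span K X) {S : Submodule K M}
    (h : ∀ g ∈ X, ∀ x ∈ M₀, g • x ∈ S) : filMul G M₀ i ≤ S := by
  rw [filMul, Submodule.span_le]
  rintro _ ⟨g, hg, x, hx, rfl⟩
  rw [hX] at hg
  induction hg using Submodule.span_induction with
  | mem g hg => exact h g hg x hx
  | zero => rw [zero_smul]; exact zero_mem _
  | add a b _ _ ha hb => rw [add_smul]; exact add_mem ha hb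
  | smul c a _ ha => rw [smul_assoc]; exact Submodule.smul_mem _ _ ha

end FilMul

section Filtration

variable (K : Type u) [Field K] {n : ℕ}

theorem canonicalFil_mono : Monotone (canonicalFil K n) := by
  intro i j hij
  refine Submodule.span_mono ?_
  rintro _ ⟨α, β, h, rfl⟩
  exact ⟨α, β, h.trans hij, rfl⟩

theorem monomial_mul_dop_mem {α β : Fin n →₀ ℕ} {i : ℕ} (h : ∑ j, α j + ∑ j, β j ≤ i) :
    ofPoly K (MvPolynomial.monomial α 1) * dop K β ∈ canonicalFil K n i :=
  Submodule.subset_span ⟨α, β, h, rfl⟩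

theorem ofPoly_monomial_zero : ofPoly K (MvPolynomial.monomial (0 : Fin n →₀ ℕ) 1) = 1 := by
  rw [← MvPolynomial.C_apply, MvPolynomial.C_1, ofPoly_one]

theorem ofPoly_monomial_add_single (α : Fin n →₀ ℕ) (l : Fin n) :
    ofPoly K (MvPolynomial.monomial (α + Finsupp.single l 1) 1) =
      ofPoly K (MvPolynomial.monomial α 1) * ofPoly K (MvPolynomial.X l) := by
  rw [← ofPoly_mul, MvPolynomial.X, MvPolynomial.monomial_mul, one_mul]

theorem sum_add_single (β : Fin n →₀ ℕ) (j : Fin n) (q : ℕ) :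
    ∑ l, (β + Finsupp.single j q : Fin n →₀ ℕ) l = ∑ l, β l + q := by
  simp [Finset.sum_add_distrib, Finsupp.single_apply]

/-- Reordering ∂^[β] x_l costs only the term ∂^[β - e_l], of smaller total degree. -/
theorem canonicalFil_mul_X {i : ℕ} {d : DPn K n} (hd : d ∈ canonicalFil K n i) (l : Fin n) :
    d * ofPoly K (MvPolynomial.X l) ∈ canonicalFil K n (i + 1) := by
  induction hd using Submodule.span_induction with
  | mem d hd =>
    obtain ⟨α, β, h, rfl⟩ := hd
    have h1 : ofPoly K (MvPolynomial.monomial α 1) *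
        (ofPoly K (MvPolynomial.X l) * dop K β) ∈ canonicalFil K n (i + 1) := by
      rw [← mul_assoc, ← ofPoly_monomial_add_single]
      refine monomial_mul_dop_mem K ?_
      rw [sum_add_single]
      omega
    rw [mul_assoc]
    rcases ofPoly_X_mul_dop K l β with h2 | ⟨h0, h2⟩
    · rwa [← h2]
    · rw [← sub_add_cancel (dop K β * _) (dop K (β - Finsupp.single l 1)), ← h2, mul_add]
      refine add_mem h1 (monomial_mul_dop_mem K ?_)
      have := sum_sub_single (Nat.one_le_iff_ne_zero.2 h0)
      omega
  | zero => rw [zero_mul]; exact zero_mem _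
  | add x y _ _ hx hy => rw [add_mul]; exact add_mem hx hy
  | smul c x _ hx => rw [smul_mul_assoc]; exact Submodule.smul_mem _ _ hx

theorem canonicalFil_mul_monomial {i : ℕ} {d : DPn K n} (hd : d ∈ canonicalFil K n i)
    (α : Fin n →₀ ℕ) :
    d * ofPoly K (MvPolynomial.monomial α 1) ∈ canonicalFil K n (i + ∑ j, α j) := by
  induction α using multiIndex_induction with
  | h0 => rw [ofPoly_monomial_zero, mul_one]; exact canonicalFil_mono K (Nat.le_add_right _ _) hd
  | hs α l ih =>
    rw [ofPoly_monomial_add_single, ← mul_assoc, sum_add_single, ← add_assoc]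
    exact canonicalFil_mul_X K ih l

theorem canonicalFil_mul_dop {i : ℕ} {d : DPn K n} (hd : d ∈ canonicalFil K n i)
    (γ : Fin n →₀ ℕ) : d * dop K γ ∈ canonicalFil K n (i + ∑ j, γ j) := by
  induction hd using Submodule.span_induction with
  | mem d hd =>
    obtain ⟨α, β, h, rfl⟩ := hd
    rw [mul_assoc, dop_mul, mul_smul_comm]
    refine Submodule.smul_mem _ _ (monomial_mul_dop_mem K ?_)
    simp only [Finsupp.add_apply, Finset.sum_add_distrib]
    omega
  | zero => rw [zero_mul]; exact zero_mem _
  | add x y _ _ hx hy => rw [add_mul]; exact add_mem hx hy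
  | smul c x _ hx => rw [smul_mul_assoc]; exact Submodule.smul_mem _ _ hx

theorem canonicalFil_mul (i j : ℕ) (a b : DPn K n) (ha : a ∈ canonicalFil K n i)
    (hb : b ∈ canonicalFil K n j) : a * b ∈ canonicalFil K n (i + j) := by
  induction hb using Submodule.span_induction with
  | mem b hb =>
    obtain ⟨α, β, h, rfl⟩ := hb
    rw [← mul_assoc]
    exact canonicalFil_mono K (by omega)
      (canonicalFil_mul_dop K (canonicalFil_mul_monomial K ha α) β)
  | zero => rw [mul_zero]; exact zero_mem _
  | add x y _ _ hx hy => rw [mul_add]; exact add_mem hx hy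
  | smul c x _ hx => rw [mul_smul_comm]; exact Submodule.smul_mem _ _ hx

theorem dop_mem_canonicalFil {β : Fin n →₀ ℕ} {i : ℕ} (h : ∑ j, β j ≤ i) :
    dop K β ∈ canonicalFil K n i := by
  have := monomial_mul_dop_mem K (α := 0) (β := β) (i := i) (by simpa using h)
  rwa [ofPoly_monomial_zero, one_mul] at this

theorem dop_mul_monomial_mem {α β : Fin n →₀ ℕ} {i : ℕ} (h : ∑ j, β j + ∑ j, α j ≤ i) :
    dop K β * ofPoly K (MvPolynomial.monomial α 1) ∈ canonicalFil K n i :=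
  canonicalFil_mono K h (canonicalFil_mul_monomial K (dop_mem_canonicalFil K le_rfl) α)

/-- The canonical filtration is also spanned by the `∂^[β] x^α`. -/
theorem canonicalFil_eq_span (i : ℕ) : canonicalFil K n i =
    Submodule.span K {a | ∃ α β : Fin n →₀ ℕ, ∑ j, β j + ∑ j, α j ≤ i ∧
      a = dop K β * ofPoly K (MvPolynomial.monomial α 1)} := by
  set R : ℕ → Submodule K (DPn K n) := fun i =>
    Submodule.span K {a | ∃ α β : Fin n →₀ ℕ, ∑ j, β j + ∑ j, α j ≤ i ∧
      a = dop K β * ofPoly K (MvPolynomial.monomial α 1)} with hR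
  have hX : ∀ {i : ℕ} {d : DPn K n} (l : Fin n), d ∈ R i →
      ofPoly K (MvPolynomial.X l) * d ∈ R (i + 1) := by
    intro i d l hd
    induction hd using Submodule.span_induction with
    | mem d hd =>
      obtain ⟨α, β, h, rfl⟩ := hd
      have h1 : dop K β * ofPoly K (MvPolynomial.X l) * ofPoly K (MvPolynomial.monomial α 1) ∈
          R (i + 1) := by
        rw [mul_assoc, ofPoly_commute, ← ofPoly_monomial_add_single]
        refine Submodule.subset_span ⟨_, _, ?_, rfl⟩
        rw [sum_add_single]
        omega
      rw [← mul_assoc]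
      rcases ofPoly_X_mul_dop K l β with h2 | ⟨h0, h2⟩
      · rwa [h2]
      · rw [h2, sub_mul]
        refine sub_mem h1 (Submodule.subset_span ⟨_, _, ?_, rfl⟩)
        have := sum_sub_single (Nat.one_le_iff_ne_zero.2 h0)
        omega
    | zero => rw [mul_zero]; exact zero_mem _
    | add x y _ _ hx hy => rw [mul_add]; exact add_mem hx hy
    | smul c x _ hx => rw [mul_smul_comm]; exact Submodule.smul_mem _ _ hx
  have hmono : ∀ α β : Fin n →₀ ℕ,
      ofPoly K (MvPolynomial.monomial α 1) * dop K β ∈ R (∑ j, β j + ∑ j, α j) := by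
    intro α β
    induction α using multiIndex_induction with
    | h0 =>
      refine Submodule.subset_span ⟨0, β, le_rfl, ?_⟩
      rw [ofPoly_monomial_zero, one_mul, mul_one]
    | hs α l ih =>
      rw [ofPoly_monomial_add_single, ofPoly_commute, mul_assoc, sum_add_single, ← add_assoc]
      exact hX l ih
  apply le_antisymm
  · rw [canonicalFil, Submodule.span_le]
    rintro _ ⟨α, β, h, rfl⟩
    refine Submodule.span_mono ?_ (hmono α β)
    rintro _ ⟨α', β', h', rfl⟩
    exact ⟨α', β', by omega, rfl⟩
  · rw [Submodule.span_le]
    rintro _ ⟨α, β, h, rfl⟩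
    exact dop_mul_monomial_mem K h

theorem finite_sum_le (n i : ℕ) : {β : Fin n →₀ ℕ | ∑ j, β j ≤ i}.Finite := by
  refine (idxLE (fun _ => 1) Finset.univ i).finite_toSet.subset fun β hβ => ?_
  rw [Finset.mem_coe, mem_idxLE (fun _ => one_pos)]
  exact ⟨Finset.subset_univ _, by simpa using hβ⟩

theorem isFinFiltration_canonicalFil : IsFinFiltration (canonicalFil K n) where
  mono := canonicalFil_mono K
  exhaust a := by
    have hadd : ∀ a b : DPn K n, (∃ i, a ∈ canonicalFil K n i) → (∃ i, b ∈ canonicalFil K n i) →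
        ∃ i, a + b ∈ canonicalFil K n i := by
      rintro a b ⟨i, hi⟩ ⟨j, hj⟩
      exact ⟨max i j, add_mem (canonicalFil_mono K (le_max_left i j) hi)
        (canonicalFil_mono K (le_max_right i j) hj)⟩
    induction a using dop_mul_induction K with
    | h0 => exact ⟨0, zero_mem _⟩
    | hadd a b ha hb => exact hadd a b ha hb
    | hd β h =>
      induction h using MvPolynomial.induction_on' with
      | monomial α c =>
        refine ⟨∑ j, β j + ∑ j, α j, ?_⟩
        have : dop K β * ofPoly K (MvPolynomial.monomial α c) =
            c • (dop K β * ofPoly K (MvPolynomial.monomial α 1)) := by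
          rw [← mul_smul_comm, ← ofPolyHom_apply, ← ofPolyHom_apply, ← map_smul,
            MvPolynomial.smul_monomial, smul_eq_mul, mul_one]
        rw [this]
        exact Submodule.smul_mem _ _ (dop_mul_monomial_mem K le_rfl)
      | add x y hx hy => rw [ofPoly_add, mul_add]; exact hadd _ _ hx hy
  one_mem := by
    have := dop_mem_canonicalFil K (n := n) (β := 0) (i := 0) (by simp)
    rwa [dop_zero] at this
  mul_mem i j a ha b hb := canonicalFil_mul K i j a b ha hb
  finite i := by
    refine FiniteDimensional.span_of_finite K (Set.Finite.subset
      (((finite_sum_le n i).prod (finite_sum_le n i)).image fun x =>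
        ofPoly K (MvPolynomial.monomial x.1 1) * dop K x.2) ?_)
    rintro _ ⟨α, β, h, rfl⟩
    refine ⟨(α, β), ⟨?_, ?_⟩, rfl⟩
    · change ∑ j, α j ≤ i
      omega
    · change ∑ j, β j ≤ i
      omega

theorem filtrationEquiv_refl {D : Type*} [Ring D] [Algebra K D] (G : ℕ → Submodule K D) :
    FiltrationEquiv G G :=
  ⟨1, 0, 1, 0, one_pos, one_pos, Filter.Eventually.of_forall fun i => by simp⟩

end Filtration

/-! ### The filtration U(m)_i: direct sum description and Poincaré series -/

section FilU

variable (K : Type u) [Field K] {n : ℕ} (p : ℕ) [Fact p.Prime] [CharP K p]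
  (m : MaximalSpectrum (Pn K n))

theorem mem_oneTensorV (v : modV K p m) : tmulU K p m 1 v ∈ oneTensorV K p m := ⟨v, rfl⟩

instance : FiniteDimensional K (oneTensorV K p m) :=
  inferInstanceAs (FiniteDimensional K (LinearMap.range (tmulU K p m 1)))

theorem isStandardType_filU : IsStandardType K n (modU K p m) (filU K p m) := by
  refine ⟨canonicalFil K n, oneTensorV K p m, isFinFiltration_canonicalFil K,
    filtrationEquiv_refl K _, inferInstance, ?_, fun _ => rfl⟩
  rw [eq_top_iff]
  rintro u -
  obtain ⟨d, rfl⟩ := exists_smul_oneU K p m u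
  exact Submodule.smul_mem _ _ (Submodule.subset_span (mem_oneTensorV K p m _))

theorem dopTmul_mem_map {s : Set (Fin n →₀ ℕ)} {β : Fin n →₀ ℕ} (hβ : β ∈ s) (v : modV K p m) :
    dopTmul K p m β v ∈ (Finsupp.supported (modV K p m) K s).map (expandU K p m) := by
  refine ⟨Finsupp.single β v, Finsupp.single_mem_supported K v hβ, ?_⟩
  rw [expandU_eq, Finsupp.lsum_single]

theorem map_supported_le {s : Set (Fin n →₀ ℕ)} {S : Submodule K (modU K p m)}
    (h : ∀ β ∈ s, ∀ v, dopTmul K p m β v ∈ S) :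
    (Finsupp.supported (modV K p m) K s).map (expandU K p m) ≤ S := by
  rintro _ ⟨f, hf, rfl⟩
  rw [expandU_eq, Finsupp.lsum_apply]
  exact Submodule.sum_mem _ fun β hβ => h β ((Finsupp.mem_supported K f).1 hf hβ) _

/-- Write F_i with the divided powers on the left and divide β by p^k with remainder γ. The factor
∂^[γ] x^α lies in A(m) and is absorbed by V(m). -/
theorem filU_eq (i : ℕ) : filU K p m i = (Finsupp.supported (modV K p m) K
    {β : Fin n →₀ ℕ | ∑ j, β j * p ^ kExp K p m j ≤ i}).map (expandU K p m) := by
  apply le_antisymm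
  · refine filMul_le_of_span (canonicalFil_eq_span K i) ?_
    rintro _ ⟨α, β, h, rfl⟩ _ ⟨v, rfl⟩
    obtain ⟨β', γ, hγ, rfl⟩ := exists_scale_add p (kExp K p m) β
    have h1 : (dop K (scale p (kExp K p m) β' + γ) * ofPoly K (MvPolynomial.monomial α 1)) •
        tmulU K p m 1 v = dopTmul K p m β'
          ((dopA K p m γ hγ * polyA K p m (MvPolynomial.monomial α 1)) • v) := by
      rw [← Induced.tmul_eq_smul, dopTmul, ← tmulU_mul, ← dop_scale_mul_dop K p _ β' hγ, mul_assoc]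
      rfl
    change _ • tmulU K p m 1 v ∈ _
    rw [h1]
    refine dopTmul_mem_map K p m ?_ _
    change ∑ j, scale p (kExp K p m) β' j ≤ i
    simp only [Finsupp.add_apply, Finset.sum_add_distrib] at h
    omega
  · refine map_supported_le K p m fun β hβ v => ?_
    rw [dopTmul, Induced.tmul_eq_smul]
    exact smul_mem_filMul (dop_mem_canonicalFil K hβ) (mem_oneTensorV K p m v)

theorem finrank_map_supported (s : Finset (Fin n →₀ ℕ)) :
    Module.finrank K ((Finsupp.supported (modV K p m) K (s : Set (Fin n →₀ ℕ))).map
      (expandU K p m)) = s.card * Module.finrank K (modV K p m) := by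
  rw [(Submodule.equivMapOfInjective _ (expandU_bijective K p m).1 _).symm.finrank_eq,
    (Finsupp.supportedEquivFinsupp (M := modV K p m) (R := K) _).finrank_eq]
  refine (Finsupp.linearEquivFunOnFinite K (modV K p m) s).finrank_eq.trans ?_
  rw [Module.finrank_pi_fintype, Finset.sum_const, Finset.card_univ, Fintype.card_coe, smul_eq_mul]

theorem finiteDimensional_map_supported (s : Finset (Fin n →₀ ℕ)) :
    FiniteDimensional K ((Finsupp.supported (modV K p m) K (s : Set (Fin n →₀ ℕ))).map
      (expandU K p m)) :=
  Module.Finite.equiv ((Finsupp.supportedEquivFinsupp (M := modV K p m) (R := K)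
    (s : Set (Fin n →₀ ℕ))).symm.trans
      (Submodule.equivMapOfInjective _ (expandU_bijective K p m).1 _))

theorem coe_idxLE_univ {a : Fin n → ℕ} (ha : ∀ j, 0 < a j) (i : ℕ) :
    (idxLE a Finset.univ i : Set (Fin n →₀ ℕ)) = {β | ∑ j, β j * a j ≤ i} := by
  ext β
  rw [Finset.mem_coe, mem_idxLE ha]
  exact and_iff_right (Finset.subset_univ _)

omit [CharP K p] in
theorem pow_kExp_pos (j : Fin n) : 0 < p ^ kExp K p m j := pow_pos (Fact.out : p.Prime).pos _

theorem finrank_filU_eq_card (i : ℕ) : Module.finrank K (filU K p m i) =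
    (idxLE (fun j => p ^ kExp K p m j) Finset.univ i).card * Module.finrank K (modV K p m) := by
  rw [filU_eq, ← coe_idxLE_univ (pow_kExp_pos K p m), finrank_map_supported]

theorem finrank_filU (i : ℕ) : Module.finrank K (filU K p m i) =
    countSum (fun j => p ^ kExp K p m j) (fun _ => Module.finrank K (modV K p m))
      Finset.univ i := by
  rw [finrank_filU_eq_card, countSum, Finset.sum_const, smul_eq_mul]

/-- Counting indices contributes the product over the variables, and the constant sequence dim V(m)
contributes dim V(m)/(1 − X). -/
theorem poincare_series_filU :
    PowerSeries.mk (fun i => (Module.finrank K (filU K p m i) : ℚ)) *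
        ((1 - PowerSeries.X) * ∏ j, (1 - PowerSeries.X ^ (p ^ kExp K p m j))) =
      PowerSeries.C ((p : ℚ) ^ (∑ j, kExp K p m j) * Module.finrank K (residueSep K m)) := by
  simp only [finrank_filU]
  rw [mul_left_comm, mk_countSum_mul (pow_kExp_pos K p m)]
  have h : (PowerSeries.mk fun _ => (Module.finrank K (modV K p m) : ℚ)) =
      PowerSeries.C (Module.finrank K (modV K p m) : ℚ) * PowerSeries.mk 1 := by
    ext i
    rw [PowerSeries.coeff_mk, PowerSeries.coeff_C_mul, PowerSeries.coeff_mk, Pi.one_apply, mul_one]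
  rw [h, mul_left_comm, mul_comm (1 - PowerSeries.X),
    PowerSeries.mk_one_mul_one_sub_eq_one, mul_one, finrank_modV, finrank_quotient_zIdeal]
  push_cast
  rfl

end FilU


/-! ### Multiplicity -/

section Dimension

variable {K W : Type*} [Field K] [AddCommGroup W] [Module K W]

theorem eventually_le_of_fg {L : Submodule K W} (hL : L.FG) {N : ℕ → Submodule K W}
    (h : ∀ x ∈ L, ∀ᶠ j in Filter.atTop, x ∈ N j) : ∀ᶠ j in Filter.atTop, L ≤ N j := by
  obtain ⟨t, rfl⟩ := hL
  have := (Filter.eventually_all_finset t).2 fun x hx => h x (Submodule.subset_span hx)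
  filter_upwards [this] with j hj
  exact Submodule.span_le.2 hj

/-- The dimension of a direct sum of images under injective maps with independent images. -/
theorem finrank_eq_sum {ι : Type*} {L : Submodule K W} [FiniteDimensional K L] {e : ι → L →ₗ[K] W}
    (he : Function.Injective (Finsupp.lsum K e)) (s : Finset ι) (N : ι → Submodule K W)
    (hN : ∀ β, N β ≤ L) (S : Submodule K W)
    (h1 : ∀ β ∈ s, ∀ w (hw : w ∈ N β), e β ⟨w, hN β hw⟩ ∈ S)
    (h2 : ∀ T : Submodule K W, (∀ β ∈ s, ∀ w (hw : w ∈ N β), e β ⟨w, hN β hw⟩ ∈ T) → S ≤ T) :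
    Module.finrank K S = ∑ β ∈ s, Module.finrank K (N β) := by
  classical
  have hfin : ∀ β, FiniteDimensional K (N β) := fun β =>
    Submodule.finiteDimensional_of_le (hN β)
  let Θ : ((β : s) → N β) →ₗ[K] W :=
    ∑ β : s, e β ∘ₗ Submodule.inclusion (hN β) ∘ₗ LinearMap.proj β
  have hΘ : ∀ w, Θ w = ∑ β : s, e β ⟨w β, hN β (w β).2⟩ := fun w => by
    simp only [Θ, LinearMap.sum_apply, LinearMap.comp_apply, LinearMap.proj_apply]
    rfl
  have hinj : Function.Injective Θ := by
    rw [injective_iff_map_eq_zero]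
    intro w hw
    let f : ι →₀ L := Finsupp.indicator s fun β hβ => ⟨w ⟨β, hβ⟩, hN β (w ⟨β, hβ⟩).2⟩
    have hf : Finsupp.lsum K e f = 0 := by
      rw [← hw, hΘ, Finsupp.lsum_apply,
        Finsupp.sum_of_support_subset f (Finsupp.support_indicator_subset s _) _ (by simp),
        ← Finset.sum_coe_sort s]
      refine Finset.sum_congr rfl fun β _ => ?_
      rw [Finsupp.indicator_of_mem β.2]
    have hf0 := (injective_iff_map_eq_zero _).1 he f hf
    funext β
    have := DFunLike.congr_fun hf0 (β : ι)
    rw [Finsupp.indicator_of_mem β.2] at this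
    exact Subtype.ext (congrArg (fun x : L => (x : W)) this)
  have hrange : S = LinearMap.range Θ := by
    apply le_antisymm
    · refine h2 _ fun β hβ w hw => ⟨Pi.single ⟨β, hβ⟩ ⟨w, hw⟩, ?_⟩
      simp only [Θ, LinearMap.sum_apply, LinearMap.comp_apply, LinearMap.proj_apply]
      rw [Finset.sum_eq_single ⟨β, hβ⟩]
      · rw [Pi.single_eq_same]
        rfl
      · intro γ _ hγ
        rw [Pi.single_eq_of_ne hγ, map_zero, map_zero]
      · intro h
        exact absurd (Finset.mem_univ _) h
    · rintro _ ⟨w, rfl⟩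
      rw [hΘ]
      exact Submodule.sum_mem _ fun β _ => h1 β β.2 _ (w β).2
  rw [hrange, LinearMap.finrank_range_of_inj hinj, Module.finrank_pi_fintype,
    Finset.sum_coe_sort s fun β => Module.finrank K (N β)]

end Dimension

theorem smul_mem_of_mem_filMul {K D M : Type*} [Field K] [Ring D] [Algebra K D] [AddCommGroup M]
    [Module K M] [Module D M] [IsScalarTower K D M] {G : ℕ → Submodule K D} {M₀ : Submodule K M}
    {j : ℕ} {X : Set D} (hX : G j = Submodule.span K X) {S : Submodule K M} {d : D}
    (h : ∀ g ∈ X, ∀ x ∈ M₀, (d * g) • x ∈ S) {w : M} (hw : w ∈ filMul G M₀ j) : d • w ∈ S := by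
  refine filMul_le_of_span (S := S.comap (Algebra.lsmul K K M d)) hX (fun g hg x hx => ?_) hw
  have := h g hg x hx
  rwa [mul_smul] at this

/-! ### Finite dimensional layers and the Hilbert function of an arbitrary generating subspace -/

section Layer

variable (K : Type u) [Field K] {n : ℕ} (p : ℕ) [Fact p.Prime] [CharP K p]
  (m : MaximalSpectrum (Pn K n)) (k : ℕ)

/-- The subspace of `U(m)` spanned by the `a ⊗ v` with `a` in the subalgebra generated by the `x_i`
and the `∂_i^[j]`, `j < p ^ k` (if `k` is at least all `k_i`). -/
def layerU : Submodule K (modU K p m) :=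
  (Finsupp.supported (modV K p m) K {β : Fin n →₀ ℕ | ∀ i, β i < p ^ (k - kExp K p m i)}).map
    (expandU K p m)

omit [Fact p.Prime] [CharP K p] in
theorem coe_image_box (k : Fin n → ℕ) :
    ((Finset.univ.image (Box.toIdx (p := p) (k := k)) : Finset _) : Set (Fin n →₀ ℕ)) =
      {β | ∀ i, β i < p ^ k i} := by
  ext β
  simp only [Finset.coe_image, Finset.coe_univ, Set.image_univ, Set.mem_range]
  constructor
  · rintro ⟨b, rfl⟩
    exact b.toIdx_lt p k
  · exact fun h => Box.exists_toIdx p k h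

instance : FiniteDimensional K (layerU K p m k) := by
  rw [layerU, ← coe_image_box p fun i => k - kExp K p m i]
  exact finiteDimensional_map_supported K p m _

variable {k} (hk : ∀ i, kExp K p m i ≤ k)

include hk

/-- The p^∑(k − k_i) indices and the factor p^∑k_i in dim V(m) multiply to p^(kn), whatever the k_i
are. -/
theorem finrank_layerU :
    Module.finrank K (layerU K p m k) = (p ^ k) ^ n * Module.finrank K (residueSep K m) := by
  rw [layerU, ← coe_image_box p fun i => k - kExp K p m i, finrank_map_supported,
    Finset.card_image_of_injective _ (Box.toIdx_injective p _), Finset.card_univ, Box.card,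
    finrank_modV, finrank_quotient_zIdeal, ← mul_assoc, ← pow_add, ← Finset.sum_add_distrib,
    Finset.sum_congr rfl fun i _ => Nat.sub_add_cancel (hk i), Finset.sum_const, Finset.card_univ,
    Fintype.card_fin, smul_eq_mul, mul_comm n, pow_mul]

theorem tmulU_mem_layerU {a : DPn K n} (ha : a ∈ boxAlg K p fun _ => k) (v : modV K p m) :
    tmulU K p m a v ∈ layerU K p m k := by
  have h := boxAlg_le_span K p (fun _ => k) ha
  clear ha
  induction h using Submodule.span_induction with
  | mem a h =>
    obtain ⟨β, h, hβ, rfl⟩ := h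
    obtain ⟨β', γ, hγ, rfl⟩ := exists_scale_add p (kExp K p m) β
    have h1 : tmulU K p m (dop K (scale p (kExp K p m) β' + γ) * ofPoly K h) v =
        dopTmul K p m β' ((dopA K p m γ hγ * polyA K p m h) • v) := by
      rw [dopTmul, ← tmulU_mul, ← dop_scale_mul_dop K p _ β' hγ, mul_assoc]
      rfl
    rw [h1]
    refine dopTmul_mem_map K p m (fun i => ?_) _
    have h2 := hβ i
    rw [Finsupp.add_apply, scale_apply] at h2
    have h3 : p ^ k = p ^ (k - kExp K p m i) * p ^ kExp K p m i := by
      rw [← pow_add, Nat.sub_add_cancel (hk i)]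
    rw [h3] at h2
    exact lt_of_mul_lt_mul_right (lt_of_le_of_lt (Nat.le_add_right _ _) h2) (Nat.zero_le _)
  | zero => rw [map_zero, LinearMap.zero_apply]; exact zero_mem _
  | add x y _ _ hx hy => rw [map_add, LinearMap.add_apply]; exact add_mem hx hy
  | smul c x _ hx => rw [map_smul, LinearMap.smul_apply]; exact Submodule.smul_mem _ _ hx

theorem layerU_le {S : Submodule K (modU K p m)}
    (h : ∀ a ∈ boxAlg K p (fun _ => k), ∀ v, tmulU K p m a v ∈ S) : layerU K p m k ≤ S := by
  refine map_supported_le K p m fun β hβ v => h _ (dop_mem_boxAlg K p _ fun i => ?_) v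
  rw [scale_apply, ← Nat.sub_add_cancel (hk i), pow_add]
  exact Nat.mul_lt_mul_of_pos_right (hβ i) (pow_kExp_pos K p m i)

theorem smul_mem_layerU {a : DPn K n} (ha : a ∈ boxAlg K p fun _ => k) {u : modU K p m}
    (hu : u ∈ layerU K p m k) : a • u ∈ layerU K p m k := by
  refine layerU_le K p m hk (S := (layerU K p m k).comap (Algebra.lsmul K K (modU K p m) a)) ?_ hu
  intro b hb v
  change a • tmulU K p m b v ∈ layerU K p m k
  rw [Induced.smul_tmul]
  exact tmulU_mem_layerU K p m hk (mul_mem ha hb) v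

omit [CharP K p] in
theorem algA_le_boxAlg : algA K p m ≤ boxAlg K p fun _ => k := by
  refine Algebra.adjoin_mono (Set.union_subset_union_right _ ?_)
  rintro _ ⟨i, j, hj, rfl⟩
  exact ⟨i, j, hj.trans_le (Nat.pow_le_pow_right (Fact.out : p.Prime).pos (hk i)), rfl⟩

omit hk

theorem eventually_mem_layerU (u : modU K p m) :
    ∀ᶠ k in Filter.atTop, u ∈ layerU K p m k := by
  obtain ⟨d, rfl⟩ := exists_smul_oneU K p m u
  obtain ⟨k₀, hk₀⟩ := exists_mem_boxAlg K p d
  filter_upwards [Filter.eventually_ge_atTop k₀,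
    Filter.eventually_ge_atTop (Finset.univ.sup (kExp K p m))] with k h1 h2
  rw [oneU, ← Induced.tmul_eq_smul]
  exact tmulU_mem_layerU K p m (fun i => (Finset.le_sup (Finset.mem_univ i)).trans h2) (hk₀ k h1) _

variable (k) in
/-- The filtration of the subalgebra generated by the `x_i` and the `∂_i^[j]`, `j < p ^ k`. -/
def lowFil (j : ℕ) : Submodule K (DPn K n) :=
  Submodule.span K {a | ∃ α γ : Fin n →₀ ℕ, (∀ i, γ i < p ^ k) ∧ ∑ l, γ l + ∑ l, α l ≤ j ∧
    a = dop K γ * ofPoly K (MvPolynomial.monomial α 1)}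

theorem eventually_mem_lowFil {a : DPn K n} (ha : a ∈ boxAlg K p fun _ => k) :
    ∀ᶠ j in Filter.atTop, a ∈ lowFil K p k j := by
  have h := boxAlg_le_span K p (fun _ => k) ha
  clear ha
  induction h using Submodule.span_induction with
  | mem a h =>
    obtain ⟨γ, h, hγ, rfl⟩ := h
    induction h using MvPolynomial.induction_on' with
    | monomial α c =>
      filter_upwards [Filter.eventually_ge_atTop (∑ l, γ l + ∑ l, α l)] with j hj
      have h1 : MvPolynomial.monomial α c = c • MvPolynomial.monomial α (1 : K) := by
        rw [MvPolynomial.smul_monomial, smul_eq_mul, mul_one]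
      rw [h1, ← ofPolyHom_apply, map_smul, mul_smul_comm]
      exact Submodule.smul_mem _ _ (Submodule.subset_span ⟨α, γ, hγ, hj, rfl⟩)
    | add x y hx hy =>
      filter_upwards [hx, hy] with j h1 h2
      rw [ofPoly_add, mul_add]
      exact add_mem h1 h2
  | zero => exact Filter.Eventually.of_forall fun _ => zero_mem _
  | add x y _ _ hx hy =>
    filter_upwards [hx, hy] with j h1 h2
    exact add_mem h1 h2
  | smul c x _ hx =>
    filter_upwards [hx] with j h1
    exact Submodule.smul_mem _ _ h1

variable (k) in
/-- The subspace generated by `M₀` over the subalgebra generated by the `x_i` and the `∂_i^[j]`,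
`j < p ^ k`. -/
def boxSpan (M₀ : Submodule K (modU K p m)) : Submodule K (modU K p m) :=
  Submodule.span K {x | ∃ a ∈ boxAlg K p fun _ : Fin n => k, ∃ y ∈ M₀, x = a • y}

theorem smul_mem_boxSpan {M₀ : Submodule K (modU K p m)} {b : DPn K n}
    (hb : b ∈ boxAlg K p fun _ => k) {x : modU K p m}
    (hx : x ∈ boxSpan K p m k M₀) :
    b • x ∈ boxSpan K p m k M₀ := by
  induction hx using Submodule.span_induction with
  | mem x hx =>
    obtain ⟨g, hg, y, hy, rfl⟩ := hx
    rw [smul_smul]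
    exact Submodule.subset_span ⟨b * g, Subalgebra.mul_mem _ hb hg, y, hy, rfl⟩
  | zero => rw [smul_zero]; exact zero_mem _
  | add x y _ _ hx hy => rw [smul_add]; exact add_mem hx hy
  | smul c x _ hx => rw [smul_comm]; exact Submodule.smul_mem _ _ hx

include hk

theorem filMul_lowFil_le {M₀ : Submodule K (modU K p m)} (hM : M₀ ≤ layerU K p m k) (j : ℕ) :
    filMul (lowFil K (n := n) p k) M₀ j ≤ layerU K p m k := by
  refine filMul_le_of_span rfl ?_
  rintro _ ⟨α, γ, hγ, -, rfl⟩ x hx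
  exact smul_mem_layerU K p m hk
    (mul_mem (dop_mem_boxAlg K p _ hγ) (ofPoly_mem_boxAlg K p _ _)) (hM hx)

/-- The span of `M₀` over level k is a nonzero A(m)-submodule, so it contains 1 ⊗ V(m) and then the
whole layer; being finite dimensional, the layer is reached at a finite stage. -/
theorem eventually_filMul_lowFil {M₀ : Submodule K (modU K p m)} (hM : M₀ ≤ layerU K p m k)
    (h0 : M₀ ≠ ⊥) : ∀ᶠ j in Filter.atTop, filMul (lowFil K (n := n) p k) M₀ j = layerU K p m k := by
  obtain ⟨u, hu, hu0⟩ := Submodule.exists_mem_ne_zero_of_ne_bot h0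
  have hle : layerU K p m k ≤ boxSpan K p m k M₀ := by
    refine layerU_le K p m hk fun a ha v => ?_
    rw [Induced.tmul_eq_smul]
    refine smul_mem_boxSpan K p m ha (tmulU_one_mem K p m _ ?_ ?_ hu0 v)
    · exact fun a x hx => smul_mem_boxSpan K p m (algA_le_boxAlg K p m hk a.2) hx
    · rw [← one_smul (DPn K n) u]
      exact Submodule.subset_span ⟨1, one_mem _, u, hu, rfl⟩
  have hev : ∀ x ∈ boxSpan K p m k M₀,
      ∀ᶠ j in Filter.atTop, x ∈ filMul (lowFil K (n := n) p k) M₀ j := by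
    intro x hx
    induction hx using Submodule.span_induction with
    | mem x hx =>
      obtain ⟨g, hg, y, hy, rfl⟩ := hx
      filter_upwards [eventually_mem_lowFil K p hg] with j hj
      exact smul_mem_filMul (G := lowFil K p k) hj hy
    | zero => exact Filter.Eventually.of_forall fun _ => zero_mem _
    | add x y _ _ hx hy =>
      filter_upwards [hx, hy] with j h1 h2
      exact add_mem h1 h2
    | smul c x _ hx =>
      filter_upwards [hx] with j h1
      exact Submodule.smul_mem _ _ h1
  filter_upwards [eventually_le_of_fg (Module.Finite.iff_fg.1 inferInstance)
    fun x hx => hev x (hle hx)] with j hj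
  exact le_antisymm (filMul_lowFil_le K p m hk hM j) hj

omit [Fact p.Prime] [CharP K p] in
theorem frob_kExp_X_pow (i : Fin n) :
    frob K p (kExp K p m) (MvPolynomial.X i ^ p ^ (k - kExp K p m i)) =
      frob K p (fun _ => k) (MvPolynomial.X i) := by
  rw [map_pow, frob_X, frob_X, ← pow_mul, ← pow_add, Nat.add_sub_cancel' (hk i)]

/-- The layer consists of a ⊗ v with `a` of level k, which commutes with x_i^(p^k); hence only the
commutator with `d` survives. The exponent k − k_i turns x_i^(p^k_i) into x_i^(p^k). -/
theorem lowerU_smul (i : Fin n) (d : DPn K n) {u : modU K p m} (hu : u ∈ layerU K p m k) :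
    lowerU K p m (MvPolynomial.X i ^ p ^ (k - kExp K p m i)) (d • u) =
      ad K (ofPoly K (frob K p (fun _ => k) (MvPolynomial.X i))) d • u := by
  set g : Pn K n := MvPolynomial.X i ^ p ^ (k - kExp K p m i)
  set y := ofPoly K (frob K p (fun _ => k) (MvPolynomial.X i))
  have h := layerU_le K p m hk (S := LinearMap.eqLocus
    (lowerU K p m g ∘ₗ Algebra.lsmul K K (modU K p m) d)
    (Algebra.lsmul K K (modU K p m) (ad K y d))) (fun a ha v => ?_) hu
  · exact h
  · change lowerU K p m g (d • tmulU K p m a v) = ad K y d • tmulU K p m a v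
    rw [Induced.smul_tmul, Induced.smul_tmul, lowerU_tmul, frob_kExp_X_pow K p m hk, ad_mul,
      ad_apply K _ a, boxAlg_commute K p _ ha, sub_self, mul_zero, zero_add]

omit hk in
variable (k) in
/-- The map `u ↦ ∂^[p ^ k β] u` on a layer. -/
def layerMap (β : Fin n →₀ ℕ) : layerU K p m k →ₗ[K] modU K p m :=
  (Algebra.lsmul K K (modU K p m) (dop K (scale p (fun _ => k) β))).comp (layerU K p m k).subtype

omit hk in
theorem layerMap_apply (β : Fin n →₀ ℕ) (u : layerU K p m k) :
    layerMap K p m k β u = dop K (scale p (fun _ => k) β) • (u : modU K p m) := rfl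

theorem isLowering_layerMap : IsLowering (layerMap K p m k)
    fun i => lowerU K p m (MvPolynomial.X i ^ p ^ (k - kExp K p m i)) where
  succ i β u := by
    rw [layerMap_apply, lowerU_smul K p m hk i _ u.2, ad_frob_X_scale_add, layerMap_apply]
  zero i β u h := by
    rw [layerMap_apply, lowerU_smul K p m hk i _ u.2, ad_frob_X_scale_zero K p _ i β h, zero_smul]

theorem lsum_layerMap_injective : Function.Injective (Finsupp.lsum K (layerMap K p m k)) := by
  refine (isLowering_layerMap K p m hk).injective fun a b h => ?_
  rw [layerMap_apply, layerMap_apply, scale_zero, dop_zero, one_smul, one_smul] at h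
  exact Subtype.ext h

omit hk in
theorem dop_scale_smul_mem {M₀ : Submodule K (modU K p m)} {β : Fin n →₀ ℕ} {i j : ℕ}
    (hβ : ∑ l, β l * p ^ k + j ≤ i) {w : modU K p m}
    (hw : w ∈ filMul (lowFil K (n := n) p k) M₀ j) :
    dop K (scale p (fun _ => k) β) • w ∈ filMul (canonicalFil K n) M₀ i := by
  refine smul_mem_of_mem_filMul (G := lowFil K (n := n) p k) rfl ?_ hw
  rintro _ ⟨α, γ, hγ, h, rfl⟩ x hx
  rw [← mul_assoc, dop_scale_mul_dop K p _ β hγ]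
  refine smul_mem_filMul (dop_mul_monomial_mem K ?_) hx
  simp only [Finsupp.add_apply, Finset.sum_add_distrib, scale_apply]
  omega

/-- Dividing the divided powers by p^k splits F_i M₀ into the ∂^[p^k β] applied to level-k pieces of
degree i − p^k|β|. The sum is direct by `lsum_layerMap_injective`. -/
theorem finrank_filMul {M₀ : Submodule K (modU K p m)} (hM : M₀ ≤ layerU K p m k) (i : ℕ) :
    Module.finrank K (filMul (canonicalFil K n) M₀ i) =
      countSum (fun _ : Fin n => p ^ k)
        (fun j => Module.finrank K (filMul (lowFil K (n := n) p k) M₀ j)) Finset.univ i := by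
  have hpos : ∀ _ : Fin n, 0 < p ^ k := fun _ => pow_pos (Fact.out : p.Prime).pos _
  refine finrank_eq_sum (lsum_layerMap_injective K p m hk) (idxLE (fun _ => p ^ k) Finset.univ i)
    (fun β => filMul (lowFil K (n := n) p k) M₀ (i - ∑ j, β j * p ^ k))
    (fun β => filMul_lowFil_le K p m hk hM _) (filMul (canonicalFil K n) M₀ i) ?_ ?_
  · intro β hβ w hw
    exact dop_scale_smul_mem K p m (Nat.add_sub_cancel' ((mem_idxLE hpos).1 hβ).2).le hw
  · intro T hT
    refine filMul_le_of_span (canonicalFil_eq_span K i) ?_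
    rintro _ ⟨α, β, h, rfl⟩ x hx
    obtain ⟨β', γ, hγ, rfl⟩ := exists_scale_add p (fun _ => k) β
    simp only [Finsupp.add_apply, Finset.sum_add_distrib, scale_apply] at h
    rw [← dop_scale_mul_dop K p _ β' hγ, mul_assoc, mul_smul]
    exact hT β' ((mem_idxLE hpos).2 ⟨Finset.subset_univ _, by omega⟩) _
      (smul_mem_filMul (G := lowFil K (n := n) p k)
        (Submodule.subset_span ⟨α, γ, hγ, by omega, rfl⟩) hx)

omit hk [Fact p.Prime] [CharP K p] in
theorem finrank_residueSep_pos : 0 < Module.finrank K (residueSep K m) := by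
  have : Nontrivial (Pn K n ⧸ m.asIdeal) := Ideal.Quotient.nontrivial_iff.2 m.isMaximal.ne_top
  exact Module.finrank_pos

/-- The summand is eventually the dimension p^(kn)[Γ(m):K] of the layer, and n summations with step
p^k divide by p^(kn) n!. -/
theorem isAlmostPolynomial_filMul {M₀ : Submodule K (modU K p m)} (hM : M₀ ≤ layerU K p m k)
    (h0 : M₀ ≠ ⊥) :
    IsAlmostPolynomial (fun i => Module.finrank K (filMul (canonicalFil K n) M₀ i)) (p ^ k) n
      ((Module.finrank K (residueSep K m) : ℚ) / (n.factorial : ℚ)) := by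
  have hpos : 0 < p ^ k := pow_pos (Fact.out : p.Prime).pos _
  have h := isAlmostPolynomial_countSum (n := n)
    (φ := fun j => Module.finrank K (filMul (lowFil K (n := n) p k) M₀ j))
    (c := (p ^ k) ^ n * Module.finrank K (residueSep K m)) hpos
    (mul_ne_zero (pow_ne_zero _ hpos.ne') (finrank_residueSep_pos K m).ne') (by
      filter_upwards [eventually_filMul_lowFil K p m hk hM h0] with j hj
      rw [hj, finrank_layerU K p m hk]) Finset.univ
  rw [Finset.card_univ, Fintype.card_fin] at h
  have hne : ((p ^ k : ℕ) : ℚ) ^ n ≠ 0 := by exact_mod_cast pow_ne_zero _ hpos.ne'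
  rw [Nat.cast_mul, Nat.cast_pow (p ^ k), mul_div_mul_left _ _ hne] at h
  simp only [finrank_filMul K p m hk hM]
  exact h

omit hk

theorem finite_modU : Module.Finite (DPn K n) (modU K p m) :=
  haveI := finitePresentation_modU K p m
  inferInstance

/-- Every finite dimensional subspace lies in some layer. Only the period p^k depends on the choice;
degree and leading coefficient do not. -/
theorem hasMultiplicity_modU :
    HasMultiplicity K n (modU K p m) n (Module.finrank K (residueSep K m)) := by
  refine ⟨finite_modU K p m, fun M₀ hfin hM₀ => ?_⟩
  have h0 : M₀ ≠ ⊥ := by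
    rintro rfl
    rw [Submodule.bot_coe, Submodule.span_zero_singleton] at hM₀
    have : oneU K p m ∈ (⊤ : Submodule (DPn K n) (modU K p m)) := trivial
    rw [← hM₀, Submodule.mem_bot] at this
    exact oneU_ne_zero K p m this
  obtain ⟨k, h1, h2⟩ := ((eventually_le_of_fg (Module.Finite.iff_fg.1 hfin)
    fun x _ => eventually_mem_layerU K p m x).and
      (Filter.eventually_ge_atTop (Finset.univ.sup (kExp K p m)))).exists
  exact ⟨p ^ k, isAlmostPolynomial_filMul K p m
    (fun i => (Finset.le_sup (Finset.mem_univ i)).trans h2) h1 h0⟩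

theorem oneTensorV_ne_bot : oneTensorV K p m ≠ ⊥ := fun h =>
  oneU_ne_zero K p m ((Submodule.mem_bot K).1 (h ▸ mem_oneTensorV K p m (polyV K p m 1)))

/-- The layer with k = max k_i already contains 1 ⊗ V(m), which gives the stated period. For n = 0
the supremum is 0. -/
theorem isAlmostPolynomial_filU :
    IsAlmostPolynomial (fun i => Module.finrank K (filU K p m i))
      (p ^ Finset.univ.sup (kExp K p m)) n
      ((Module.finrank K (residueSep K m) : ℚ) / (n.factorial : ℚ)) := by
  have hk : ∀ i, kExp K p m i ≤ Finset.univ.sup (kExp K p m) :=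
    fun i => Finset.le_sup (Finset.mem_univ i)
  refine isAlmostPolynomial_filMul K p m hk ?_ (oneTensorV_ne_bot K p m)
  rintro _ ⟨v, rfl⟩
  exact tmulU_mem_layerU K p m hk (one_mem _) v

end Layer

/-! ### Holonomicity -/

section Holonomic

variable (K : Type u) [Field K] {n : ℕ} (p : ℕ) [Fact p.Prime] [CharP K p]

theorem card_idxLE_le {a : Fin n → ℕ} (s : Finset (Fin n)) (i : ℕ) :
    (idxLE a s i).card ≤ (i + 1) ^ n := by
  refine (Finset.card_filter_le _ _).trans ?_
  have h : (Finset.Icc (0 : Fin n →₀ ℕ) (Finsupp.equivFunOnFinite.symm fun _ => i)).card ≤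
      (Fintype.piFinset fun _ : Fin n => Finset.range (i + 1)).card := by
    refine Finset.card_le_card_of_injOn (fun β => ⇑β) (fun β hβ => ?_) DFunLike.coe_injective.injOn
    rw [Finset.mem_coe, Finset.mem_Icc] at hβ
    rw [Finset.mem_coe, Fintype.mem_piFinset]
    exact fun j => Finset.mem_range.2 (Nat.lt_succ_of_le (hβ.2 j))
  refine h.trans (le_of_eq ?_)
  simp

theorem isHolonomic_of_equiv {M : Type v} [AddCommGroup M] [Module K M] [Module (DPn K n) M]
    [IsScalarTower K (DPn K n) M] {m : MaximalSpectrum (Pn K n)}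
    (e : M ≃ₗ[DPn K n] modU K p m) : IsHolonomic K n M := by
  let ε : modU K p m →ₗ[K] M := e.symm.toLinearMap.restrictScalars K
  have hε : Function.Injective ε := e.symm.injective
  have hmap : ∀ i, filMul (canonicalFil K n) ((oneTensorV K p m).map ε) i =
      (filU K p m i).map ε := by
    intro i
    rw [filU, filMul, filMul, Submodule.map_span]
    congr 1
    ext x
    constructor
    · rintro ⟨g, hg, _, ⟨y, hy, rfl⟩, rfl⟩
      exact ⟨g • y, ⟨g, hg, y, hy, rfl⟩, e.symm.map_smul g y⟩
    · rintro ⟨_, ⟨g, hg, y, hy, rfl⟩, rfl⟩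
      exact ⟨g, hg, ε y, ⟨y, hy, rfl⟩, e.symm.map_smul g y⟩
  have hfin := finite_modU K p m
  refine ⟨⟨e.symm (oneU K p m), 0, fun h => oneU_ne_zero K p m ?_⟩, Module.Finite.equiv e.symm,
    filMul (canonicalFil K n) ((oneTensorV K p m).map ε),
    ⟨canonicalFil K n, (oneTensorV K p m).map ε, isFinFiltration_canonicalFil K,
      filtrationEquiv_refl K _, inferInstance, ?_, fun _ => rfl⟩, ?_⟩
  · rwa [map_eq_zero_iff _ e.symm.injective] at h
  · rw [eq_top_iff]
    rintro x -
    obtain ⟨d, hd⟩ := exists_smul_oneU K p m (e x)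
    rw [← e.symm_apply_apply x, hd, map_smul]
    exact Submodule.smul_mem _ _ (Submodule.subset_span ⟨_, mem_oneTensorV K p m _, rfl⟩)
  · have : Nontrivial (modV K p m) := ⟨polyV K p m 1, 0, polyV_one_ne_zero K p m⟩
    have hpos : (Module.finrank K (modV K p m) : ℚ) ≠ 0 := by
      exact_mod_cast (Module.finrank_pos (R := K) (M := modV K p m)).ne'
    -- At most (i + 1)^n multi-indices occur in degree ≤ i, each contributing a copy of V(m).
    refine ⟨Polynomial.C (Module.finrank K (modV K p m) : ℚ) *
      (Polynomial.X + Polynomial.C 1) ^ n, ?_, Filter.Eventually.of_forall fun i => ?_⟩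
    · rw [Polynomial.degree_C_mul hpos, Polynomial.degree_pow, Polynomial.degree_X_add_C]
      simp
    · rw [hmap, (Submodule.equivMapOfInjective ε hε _).symm.finrank_eq, finrank_filU_eq_card,
        Polynomial.eval_mul, Polynomial.eval_C, Polynomial.eval_pow, Polynomial.eval_add,
        Polynomial.eval_X, Polynomial.eval_C, mul_comm, Nat.cast_mul]
      refine mul_le_mul_of_nonneg_left ?_ (Nat.cast_nonneg _)
      exact_mod_cast card_idxLE_le _ i

end Holonomic

end DModCharP

end

/-! ### The theorem -/

open DModCharP
theorem mainTheorem2 (K : Type u) [Field K] (p : ℕ) [Fact p.Prime] [CharP K p] (n : ℕ) :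
    -- `V(m)` is, up to isomorphism, the only simple `A(m)`-module annihilated by the kernel of
    -- `K[x_1^{p^{k_1}}, …, x_n^{p^{k_n}}] → P_n/m`
    (∀ m : MaximalSpectrum (Pn K n),
      IsSimpleModule (algA K p m) (modV K p m) ∧
      (∀ h ∈ centralKer K p m, ∀ a : algA K p m, (a : DPn K n) = ofPoly K h →
        ∀ v : modV K p m, a • v = 0) ∧
      ∀ (W : Type v) [AddCommGroup W] [Module (algA K p m) W],
        IsSimpleModule (algA K p m) W →
        (∀ h ∈ centralKer K p m, ∀ a : algA K p m, (a : DPn K n) = ofPoly K h →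
          ∀ w : W, a • w = 0) →
        Nonempty (W ≃ₗ[algA K p m] modV K p m)) ∧
    -- classification: `m ↦ [U(m)]` is a bijection onto the isoclasses, with inverse `[M] ↦ ass(M)`
    (∃ hU : ∀ m : MaximalSpectrum (Pn K n),
        IsSimpleModule (DPn K n) (modU K p m) ∧ Module.FinitePresentation (DPn K n) (modU K p m),
      Function.Bijective (fun m => isoClass (DPn K n) (modU K p m) (hU m)) ∧
      ∀ (c : SimpleFPClass (DPn K n)) (m : MaximalSpectrum (Pn K n)),
        isoClass (DPn K n) (modU K p m) (hU m) = c ↔ assClass K n c = {m.asIdeal}) ∧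
    (∀ m : MaximalSpectrum (Pn K n), assP K n (modU K p m) = {m.asIdeal}) ∧
    -- simple finitely presented modules (in any universe) are holonomic, and isomorphic to some `U(m)`
    (∀ (M : Type v) [AddCommGroup M] [Module K M] [Module (DPn K n) M]
        [IsScalarTower K (DPn K n) M],
      IsSimpleModule (DPn K n) M → Module.FinitePresentation (DPn K n) M →
      IsHolonomic K n M ∧
      ∃ m : MaximalSpectrum (Pn K n), assP K n M = {m.asIdeal} ∧
        Nonempty (M ≃ₗ[DPn K n] modU K p m)) ∧
    -- the endomorphism algebra
    (∀ m : MaximalSpectrum (Pn K n),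
      Nonempty (Module.End (DPn K n) (modU K p m) ≃ₐ[K] residueSep K m)) ∧
    -- the filtration `{U(m)_i}`, Poincare series, multiplicity, Hilbert function
    (∀ m : MaximalSpectrum (Pn K n),
      IsStandardType K n (modU K p m) (filU K p m) ∧
      Function.Bijective (expandU K p m) ∧
      (∀ i, filU K p m i = (Finsupp.supported (modV K p m) K
          {β : Fin n →₀ ℕ | ∑ j, β j * p ^ kExp K p m j ≤ i}).map (expandU K p m)) ∧
      (PowerSeries.mk (fun i => (Module.finrank K (filU K p m i) : ℚ)) *
          ((1 - PowerSeries.X) * ∏ j, (1 - PowerSeries.X ^ (p ^ kExp K p m j))) =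
        PowerSeries.C ((p : ℚ) ^ (∑ j, kExp K p m j) * Module.finrank K (residueSep K m))) ∧
      HasMultiplicity K n (modU K p m) n (Module.finrank K (residueSep K m)) ∧
      Module.finrank K (residueSep K m) =
        Module.finrank K (Module.End (DPn K n) (modU K p m)) ∧
      IsAlmostPolynomial (fun i => Module.finrank K (filU K p m i))
        (p ^ Finset.univ.sup (kExp K p m)) n
        ((Module.finrank K (residueSep K m) : ℚ) / (n.factorial : ℚ))) := by
  have hU : ∀ m : MaximalSpectrum (Pn K n),
      IsSimpleModule (DPn K n) (modU K p m) ∧ Module.FinitePresentation (DPn K n) (modU K p m) :=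
    fun m => ⟨isSimpleModule_modU K p m, finitePresentation_modU K p m⟩
  have hass : ∀ m, assClass K n (isoClass (DPn K n) (modU K p m) (hU m)) = {m.asIdeal} :=
    fun m => assP_modU K p m
  have hsurj : ∀ c : SimpleFPClass (DPn K n), ∃ m, isoClass (DPn K n) (modU K p m) (hU m) = c := by
    intro c
    induction c using Quotient.inductionOn with
    | h M =>
      obtain ⟨m, hm⟩ := exists_isMaximal_mem_assP K p M.carrier M.isSimple M.isFinitelyPresented
      obtain ⟨e⟩ := nonempty_equiv_modU K p M.isSimple m hm
      exact ⟨m, Quotient.sound ⟨e.symm⟩⟩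
  have hinj : ∀ m m' : MaximalSpectrum (Pn K n),
      ({m.asIdeal} : Set (Ideal (Pn K n))) = {m'.asIdeal} → m = m' :=
    fun m m' h => MaximalSpectrum.ext (Set.singleton_injective h)
  refine ⟨fun m => ⟨isSimpleModule_modV K p m, ?_, fun W _ _ hW hz =>
      nonempty_equiv_modV K p m W hW hz⟩, ⟨hU, ⟨fun m m' h => ?_, hsurj⟩, fun c m => ?_⟩,
    assP_modU K p, ?_, fun m => ⟨endEquiv K p m⟩, fun m => ⟨isStandardType_filU K p m,
      expandU_bijective K p m, filU_eq K p m, poincare_series_filU K p m,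
      hasMultiplicity_modU K p m, (endEquiv K p m).toLinearEquiv.finrank_eq.symm,
      isAlmostPolynomial_filU K p m⟩⟩
  · intro h hh a ha v
    obtain ⟨g, hg, rfl⟩ := (mem_centralKer K p m).1 hh
    rw [eq_polyA K p m ha]
    exact polyA_frob_smul_eq_zero K p m hg v
  · refine hinj m m' ?_
    rw [← hass m, ← hass m']
    exact congrArg (assClass K n) h
  · constructor
    · rintro rfl
      exact hass m
    · intro h
      obtain ⟨m', rfl⟩ := hsurj c
      rw [hass] at h
      rw [hinj m m' h.symm]
  · intro M _ _ _ _ hM hfp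
    obtain ⟨m, hm⟩ := exists_isMaximal_mem_assP K p M hM hfp
    obtain ⟨e⟩ := nonempty_equiv_modU K p hM m hm
    exact ⟨isHolonomic_of_equiv K p e, m, (assP_congr K n e).trans (assP_modU K p m), ⟨e⟩⟩
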